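/- **Setting.** Let $F$ be a totally real field of even degree $d$ over $\mathbb{Q}$, and let $p$ be a rational prime that is inert in $F$. Write $F_p$ for the completion of $F$ at $p$, $O_{F,p}$ for its ring of integers, and $I$ for the set of embeddings of $F$ into $\overline{\mathbb{Q}}_p$ (equivalently, of continuous embeddings of $F_p$). Let $D$ be a totally definite quaternion algebra over $F$, ramified exactly at the infinite places. Put $G_f=(D\otimes_F\mathbb{A}_{F,f})^\times$ and fix an isomorphism $D\otimes_F F_p\cong M_2(F_p)$; for $u\in G_f$ let $u_p$ be its component in $GL_2(F_p)$. Let $R\subseteq\overline{\mathbb{Q}}_p$ be a subring containing $\tau(O_{F,p})$ for all $\tau\in I$. A *weight* is a family $\mathbf{k}=(k_\tau)_{\tau\in I}$ of integers $k_\tau\ge 2$ of the same parity. Attached to it are $m_\tau=k_\tau-2$ and the integers $v_\tau\ge 0$, at least one of them $0$, for which $m_\tau+2v_\tau$ is independent of $\tau$. Let $S_{a,b}(R)$ be the space of binary forms of degree $a$ over $R$, on which $\gamma=\begin{pmatrix}\gamma_{11}&\gamma_{12}\\ \gamma_{21}&\gamma_{22}\end{pmatrix}\in M_2(R)$ acts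 by $(\gamma f)(x,y)=\det(\gamma)^b f(\gamma_{11}x+\gamma_{21}y,\ \gamma_{12}x+\gamma_{22}y)$. Let $L_{\mathbf{k}}(R)=\bigotimes_{\tau\in I}S_{m_\tau,v_\tau}(R)$, where $M_2(O_{F,p})$ acts on the factor at $\tau$ through $\tau$. Let $U\subset G_f$ be an open compact subgroup such that for all $u\in U$ the matrix $u_p=\begin{pmatrix}a&b\\c&e\end{pmatrix}$ has entries in $O_{F,p}$ with $a\equiv e\equiv 1$ and $c\equiv 0 \pmod p$. Let $\mathcal S^D_{\mathbf{k}}(U,R)$ be the $R$-module of functions $f:D^\times\backslash G_f\to L_{\mathbf{k}}(R)$ with $u_p f(xu)=f(x)$ for all $x\in G_f$, $u\in U$. Let $\eta_p\in G_f$ be $\begin{pmatrix}p&0\\0&1\end{pmatrix}$ at $p$ and $1$ at all other places, write $U\eta_pU=\coprod_i x_iU$, and put $(T_pf)(x)=\sum_i (x_i)_p f(xx_i)$. For $\alpha\in\mathbb{R}$ let $D(\mathbf{k},\alpha)$ be the number of eigenvalues in $\overline{\mathbb{Q}}_p$, counted with algebraic multiplicity, of $\xi=p^{-\sum_\tau v_\tau}T_p$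 on $\mathcal S^D_{\mathbf{k}}(U,R)$ whose $p$-adic valuation (normalised by $v_p(p)=1$) is $\alpha$. Let $h=|D^\times\backslash G_f/U|$. For $\gamma\in G_f$ let $\widetilde\Gamma^\gamma(U)$ be the group of $\delta\in D^\times$ whose image in $G_f$ lies in $\gamma U\gamma^{-1}$, and let $\Gamma^\gamma(U)=\widetilde\Gamma^\gamma(U)/(\widetilde\Gamma^\gamma(U)\cap F^\times)$. **Theorem.** There are real constants $\beta_1>0$ and $\beta_2$, depending only on $d$ and $h$, with the following property. Suppose that $\Gamma^\gamma(U)$ is trivial for every $\gamma\in G_f$. Let $\alpha\in\mathbb{R}$ and $$n(\alpha)=\max\bigl(0,\lfloor(\beta_1\alpha-\beta_2)^{d+1}\rfloor\bigr).$$ If $\mathbf{k},\mathbf{k}'$ are weights with $k_\tau\ge n(\alpha)$, $k'_\tau\ge n(\alpha)$ and $k_\tau\equiv k'_\tau\pmod{p^{n(\alpha)}}$ for all $\tau\in I$, then $$D(\mathbf{k},\alpha)=D(\mathbf{k}',\alpha).$$ -/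

import Mathlib

open scoped TensorProduct NumberField
open IsDedekindDomain

noncomputable section

namespace QuatForms

/-! ### Symmetric powers and the weight modules -/

section Weight

/-- Substitution `f(x, y) ↦ f(a x + c y, b x + d y)` for a matrix `(a b; c d)`, where `x = X 0`
and `y = X 1`. -/
def subst {R : Type*} [CommRing R] (A : Matrix (Fin 2) (Fin 2) R) :
    MvPolynomial (Fin 2) R →ₐ[R] MvPolynomial (Fin 2) R :=
  MvPolynomial.aeval fun j => ∑ i, MvPolynomial.C (A i j) * MvPolynomial.X i

theorem subst_X {R : Type*} [CommRing R] (A : Matrix (Fin 2) (Fin 2) R) (j : Fin 2) :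
    subst A (MvPolynomial.X j) = ∑ i, MvPolynomial.C (A i j) * MvPolynomial.X i := by
  simp [subst]

theorem subst_one {R : Type*} [CommRing R] :
    subst (1 : Matrix (Fin 2) (Fin 2) R) = AlgHom.id R _ := by
  apply MvPolynomial.algHom_ext
  intro j
  fin_cases j <;> simp [subst_X, Fin.sum_univ_two]

theorem subst_mul {R : Type*} [CommRing R] (A B : Matrix (Fin 2) (Fin 2) R) :
    subst (A * B) = (subst A).comp (subst B) := by
  apply MvPolynomial.algHom_ext
  intro j
  simp only [AlgHom.comp_apply, subst_X, map_mul, Fin.sum_univ_two, Matrix.mul_apply,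
    map_add, MvPolynomial.algHom_C, MvPolynomial.algebraMap_eq]
  ring

theorem subst_mem {R : Type*} [CommRing R] (A : Matrix (Fin 2) (Fin 2) R) (a : ℕ)
    (f : MvPolynomial (Fin 2) R) (hf : f ∈ MvPolynomial.homogeneousSubmodule (Fin 2) R a) :
    subst A f ∈ MvPolynomial.homogeneousSubmodule (Fin 2) R a := by
  have h := MvPolynomial.IsHomogeneous.aeval (n := 1) (S := R) hf
    (fun j => ∑ i, MvPolynomial.C (A i j) * MvPolynomial.X i)
    (fun j => MvPolynomial.IsHomogeneous.sum _ _ _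
      (fun i _ => MvPolynomial.isHomogeneous_C_mul_X (A i j) i))
  rw [one_mul] at h
  exact h

/-- `Symm^a(R²)`: binary forms of degree `a`. -/
abbrev Sym (R : Type*) [CommRing R] (a : ℕ) : Type _ :=
  MvPolynomial.homogeneousSubmodule (Fin 2) R a

/-- The action of a matrix `A` on `S_{a,b}(R)`:
`f(x, y) ↦ det(A)^b f(a₁₁ x + a₂₁ y, a₁₂ x + a₂₂ y)`. -/
def symAct {R : Type*} [CommRing R] (a b : ℕ) :
    Matrix (Fin 2) (Fin 2) R →* Module.End R (Sym R a) where
  toFun A := A.det ^ b • LinearMap.codRestrict _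
    ((subst A).toLinearMap.comp (Submodule.subtype _)) (fun f => subst_mem A a f.1 f.2)
  map_one' := by
    refine LinearMap.ext fun f => Subtype.ext ?_
    simp [subst_one]
  map_mul' A B := by
    refine LinearMap.ext fun f => Subtype.ext ?_
    simp only [Matrix.det_mul, mul_pow, subst_mul, LinearMap.smul_apply, Module.End.mul_apply,
      map_smul, Submodule.coe_smul, LinearMap.codRestrict_apply, LinearMap.comp_apply,
      AlgHom.toLinearMap_apply, AlgHom.comp_apply, Submodule.subtype_apply, mul_smul]
    exact smul_comm _ _ _

variable {ι O R : Type*} [CommRing O] [CommRing R]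

/-- `L_k(R) = ⊗_τ S_{m_τ, v_τ}(R)`, as a module (the action is `weightAct`). -/
abbrev WeightModule (R : Type*) [CommRing R] (m : ι → ℕ) : Type _ := ⨂[R] τ, Sym R (m τ)

/-- The action of `M₂(O)` on `L_k(R) = ⊗_τ S_{m_τ, v_τ}(R)`, on the `τ`-th factor through
the ring homomorphism `σ τ : O → R`. -/
def weightAct (σ : ι → O →+* R) (m v : ι → ℕ) :
    Matrix (Fin 2) (Fin 2) O →* Module.End R (WeightModule R m) where
  toFun A := PiTensorProduct.map fun τ => symAct (m τ) (v τ) ((σ τ).mapMatrix A)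
  map_one' := by
    simp only [map_one]
    exact PiTensorProduct.map_one
  map_mul' A B := by
    simp only [map_mul]
    exact PiTensorProduct.map_mul _ _

end Weight

/-! ### The adelic group of a quaternion algebra -/

section Adelic

variable (F : Type*) [Field F] [NumberField F]

/-- `D` is a totally definite quaternion algebra over `F`, i.e. a central simple algebra of
dimension four which ramifies exactly at the infinite places (`F` being totally real). -/
structure IsTotallyDefinite (D : Type*) [Ring D] [Algebra F D] : Prop where
  central : Algebra.IsCentral F D
  simple : IsSimpleRing D
  finrank_eq : Module.finrank F D = 4
  ramified : ∀ s : F →+* ℝ, letI := s.toAlgebra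
    Nonempty (ℝ ⊗[F] D ≃ₐ[ℝ] Quaternion ℝ)
  unramified : ∀ w : HeightOneSpectrum (𝓞 F),
    Nonempty (w.adicCompletion F ⊗[F] D ≃ₐ[w.adicCompletion F]
      Matrix (Fin 2) (Fin 2) (w.adicCompletion F))

variable (D : Type*) [Ring D] [Algebra F D]

/-- `D ⊗_F A_{F,f}`. -/
abbrev AdelicAlg : Type _ := FiniteAdeleRing (𝓞 F) F ⊗[F] D

/-- `G_f = (D ⊗_F A_{F,f})ˣ`. -/
abbrev Gf : Type _ := (AdelicAlg F D)ˣ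

/-- `D ⊗_F A_{F,f}` carries the topology of a finite free module over `A_{F,f}`; `G_f` gets the
topology of its unit group. -/
def IsOpenCompact (U : Subgroup (Gf F D)) : Prop :=
  letI : TopologicalSpace (AdelicAlg F D) := moduleTopology (FiniteAdeleRing (𝓞 F) F) _
  IsOpen (U : Set (Gf F D)) ∧ IsCompact (U : Set (Gf F D))

/-- The diagonal embedding `Dˣ → G_f`. -/
def diag : Dˣ →* Gf F D :=
  Units.map (Algebra.TensorProduct.includeRight : D →ₐ[F] AdelicAlg F D).toMonoidHom

variable {F}

/-- The projection `A_{F,f} → F_w`. -/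
def evalAt (w : HeightOneSpectrum (𝓞 F)) :
    FiniteAdeleRing (𝓞 F) F →ₐ[F] w.adicCompletion F where
  toFun a := a w
  map_one' := rfl
  map_mul' _ _ := rfl
  map_zero' := rfl
  map_add' _ _ := rfl
  commutes' _ := rfl

/-- The projection `D ⊗_F A_{F,f} → D ⊗_F F_w`. -/
def component (w : HeightOneSpectrum (𝓞 F)) :
    AdelicAlg F D →ₐ[F] w.adicCompletion F ⊗[F] D :=
  Algebra.TensorProduct.map (evalAt w) (AlgHom.id F D)

open scoped Classical in
/-- The finite adele which is `x` at `w` and zero at all other places. -/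
def singleFun (w : HeightOneSpectrum (𝓞 F)) (x : w.adicCompletion F) :
    FiniteAdeleRing (𝓞 F) F :=
  RestrictedProduct.single (fun u : HeightOneSpectrum (𝓞 F) => u.adicCompletionIntegers F) w x

theorem singleFun_same (w : HeightOneSpectrum (𝓞 F)) (x : w.adicCompletion F) :
    singleFun w x w = x := by
  classical exact Pi.single_eq_same w x

theorem singleFun_ne (w : HeightOneSpectrum (𝓞 F)) (x : w.adicCompletion F)
    (u : HeightOneSpectrum (𝓞 F)) (h : u ≠ w) : singleFun w x u = 0 := by
  classical exact Pi.single_eq_of_ne h x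

theorem adele_smul_apply (c : F) (a : FiniteAdeleRing (𝓞 F) F) (u : HeightOneSpectrum (𝓞 F)) :
    (c • a) u = c • a u :=
  map_smul (evalAt u) c a

theorem adele_add_apply (a b : FiniteAdeleRing (𝓞 F) F) (u : HeightOneSpectrum (𝓞 F)) :
    (a + b) u = a u + b u :=
  map_add (evalAt u) a b

theorem adele_mul_apply (a b : FiniteAdeleRing (𝓞 F) F) (u : HeightOneSpectrum (𝓞 F)) :
    (a * b) u = a u * b u :=
  map_mul (evalAt u) a b

/-- The inclusion `F_w → A_{F,f}` which is zero at all places other than `w`. -/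
def singleAt (w : HeightOneSpectrum (𝓞 F)) :
    w.adicCompletion F →ₗ[F] FiniteAdeleRing (𝓞 F) F where
  toFun x := singleFun w x
  map_add' x y := by
    refine FiniteAdeleRing.ext _ fun u => ?_
    rw [adele_add_apply]
    rcases eq_or_ne u w with rfl | h
    · simp only [singleFun_same]
    · simp only [singleFun_ne _ _ _ h, add_zero]
  map_smul' c x := by
    refine FiniteAdeleRing.ext _ fun u => ?_
    rw [RingHom.id_apply, adele_smul_apply]
    rcases eq_or_ne u w with rfl | h
    · simp only [singleFun_same]
    · simp only [singleFun_ne _ _ _ h, smul_zero]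

theorem singleAt_mul (w : HeightOneSpectrum (𝓞 F)) (x y : w.adicCompletion F) :
    singleAt w x * singleAt w y = singleAt w (x * y) := by
  refine FiniteAdeleRing.ext _ fun u => ?_
  rw [adele_mul_apply]
  change singleFun w x u * singleFun w y u = singleFun w (x * y) u
  rcases eq_or_ne u w with rfl | h
  · simp only [singleFun_same]
  · simp only [singleFun_ne _ _ _ h, mul_zero]

theorem evalAt_singleAt (w : HeightOneSpectrum (𝓞 F)) (x : w.adicCompletion F) :
    evalAt w (singleAt w x) = x := singleFun_same w x

/-- The inclusion `D ⊗_F F_w → D ⊗_F A_{F,f}` which is zero at all places other than `w`. -/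
def singleComponent (w : HeightOneSpectrum (𝓞 F)) :
    w.adicCompletion F ⊗[F] D →ₗ[F] AdelicAlg F D :=
  TensorProduct.map (singleAt w) LinearMap.id

theorem singleComponent_mul (w : HeightOneSpectrum (𝓞 F)) (x y : w.adicCompletion F ⊗[F] D) :
    singleComponent D w x * singleComponent D w y = singleComponent D w (x * y) := by
  induction x with
  | zero => simp
  | add x₁ x₂ h₁ h₂ => simp only [map_add, add_mul, h₁, h₂]
  | tmul a b =>
    induction y with
    | zero => simp
    | add y₁ y₂ h₁ h₂ => simp only [map_add, mul_add, h₁, h₂]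
    | tmul a' b' =>
      simp [singleComponent, Algebra.TensorProduct.tmul_mul_tmul, singleAt_mul]

theorem component_singleComponent (w : HeightOneSpectrum (𝓞 F))
    (x : w.adicCompletion F ⊗[F] D) : component D w (singleComponent D w x) = x := by
  induction x with
  | zero => simp
  | add x₁ x₂ h₁ h₂ => simp only [map_add, h₁, h₂]
  | tmul a b => simp [component, singleComponent, evalAt_singleAt]

theorem idem_aux {A : Type*} [Ring A] (e x y z : A) (h1 : e * e = e) (h2 : e * y = y)
    (h3 : x * e = x) (h4 : x * y = z) : (1 - e + x) * (1 - e + y) = 1 - e + z := by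
  simp only [mul_add, add_mul, sub_mul, mul_sub, one_mul, mul_one, h1, h2, h3, h4]
  abel

/-- The element of `G_f` which is `g` at the place `w` and `1` at all other places. -/
def localUnit (w : HeightOneSpectrum (𝓞 F)) (g : (w.adicCompletion F ⊗[F] D)ˣ) : Gf F D where
  val := 1 - singleComponent D w 1 + singleComponent D w g
  inv := 1 - singleComponent D w 1 + singleComponent D w (g⁻¹ : (w.adicCompletion F ⊗[F] D)ˣ)
  val_inv := by
    rw [idem_aux _ _ _ (singleComponent D w 1)]
    · abel
    all_goals simp [singleComponent_mul]
  inv_val := by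
    rw [idem_aux _ _ _ (singleComponent D w 1)]
    · abel
    all_goals simp [singleComponent_mul]

theorem component_localUnit (w : HeightOneSpectrum (𝓞 F)) (g : (w.adicCompletion F ⊗[F] D)ˣ) :
    component D w (localUnit D w g).1 = g.1 := by
  simp [localUnit, component_singleComponent]

/-! ### Class set and arithmetic groups -/

variable {D}

/-- `X(U) = Dˣ \ G_f / U`. -/
abbrev ClassSet (U : Subgroup (Gf F D)) : Type _ :=
  DoubleCoset.Quotient ((diag F D).range : Set (Gf F D)) (U : Set (Gf F D))

/-- `Dˣ ∩ γ U G_∞ γ⁻¹`, that is, the `δ ∈ Dˣ` whose image in `G_f` lies in `γ U γ⁻¹`. -/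
def GammaTilde (U : Subgroup (Gf F D)) (γ : Gf F D) : Subgroup Dˣ :=
  (U.map (MulAut.conj γ).toMonoidHom).comap (diag F D)

/-- The central subgroup `Fˣ` of `Dˣ`. -/
def scalars : Subgroup Dˣ := (Units.map (algebraMap F D).toMonoidHom).range

/-- `Γ(U) = GammaTilde / (GammaTilde ∩ Fˣ)`, for the representative `γ`. -/
abbrev Gamma (U : Subgroup (Gf F D)) (γ : Gf F D) : Type _ :=
  GammaTilde U γ ⧸ (scalars (F := F) (D := D)).subgroupOf (GammaTilde U γ)

/-! ### The place `p`, levels and automorphic forms -/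

variable {w : HeightOneSpectrum (𝓞 F)}
  (θ : w.adicCompletion F ⊗[F] D ≃ₐ[w.adicCompletion F]
    Matrix (Fin 2) (Fin 2) (w.adicCompletion F))

/-- `u ↦ u_p ∈ M₂(F_p)`, where `D ⊗ F_p` is identified with `M₂(F_p)` through `θ`. -/
def pComp : Gf F D →* Matrix (Fin 2) (Fin 2) (w.adicCompletion F) :=
  (θ.toRingEquiv.toRingHom.toMonoidHom.comp (component D w).toRingHom.toMonoidHom).comp
    (Units.coeHom _)

/-- The semigroup of the `u ∈ G_f` with `u_p ∈ M₂(O_{F,p})`. -/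
def integralAt : Submonoid (Gf F D) where
  carrier := {u | ∀ i j, pComp θ u i j ∈ w.adicCompletionIntegers F}
  one_mem' i j := by
    rw [map_one, Matrix.one_apply]
    split_ifs
    exacts [one_mem _, zero_mem _]
  mul_mem' {u u'} hu hu' i j := by
    rw [map_mul, Matrix.mul_apply]
    exact sum_mem fun l _ => mul_mem (hu i l) (hu' l j)

/-- `u ↦ u_p`, as a matrix over `O_{F,p}`. -/
def pInt : integralAt θ →* Matrix (Fin 2) (Fin 2) (w.adicCompletionIntegers F) where
  toFun u := Matrix.of fun i j => ⟨pComp θ u.1 i j, u.2 i j⟩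
  map_one' := by
    ext i j
    simp only [OneMemClass.coe_one, map_one, Matrix.of_apply, Matrix.one_apply]
    split_ifs <;> rfl
  map_mul' u u' := by
    ext i j
    simp [Matrix.mul_apply]

/-- A level: an open compact subgroup `U` of `G_f` whose projection to `GL₂(F_p)` consists of
matrices `(a b; c d)` over `O_{F,p}` with `a ≡ d ≡ 1` and `c ≡ 0` modulo `p`. -/
structure Level (p : ℕ) where
  U : Subgroup (Gf F D)
  isOpenCompact : IsOpenCompact F D U
  integral : U.toSubmonoid ≤ integralAt θ
  cong_a : ∀ u (hu : u ∈ U), (p : w.adicCompletionIntegers F) ∣ pInt θ ⟨u, integral hu⟩ 0 0 - 1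
  cong_c : ∀ u (hu : u ∈ U), (p : w.adicCompletionIntegers F) ∣ pInt θ ⟨u, integral hu⟩ 1 0
  cong_d : ∀ u (hu : u ∈ U), (p : w.adicCompletionIntegers F) ∣ pInt θ ⟨u, integral hu⟩ 1 1 - 1

variable {θ} {p : ℕ} (𝓤 : Level θ p)
  {ι R : Type*} [CommRing R] (σ : ι → w.adicCompletionIntegers F →+* R) (m v : ι → ℕ)

/-- The function `x ↦ u_p f(x u)`, for `u ∈ G_f` with `u_p` integral. -/
def slash (u : integralAt θ) :
    (Gf F D → WeightModule R m) →ₗ[R] (Gf F D → WeightModule R m) where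
  toFun f x := weightAct σ m v (pInt θ u) (f (x * u.1))
  map_add' f g := by
    funext x
    simp
  map_smul' c f := by
    funext x
    simp

theorem slash_mul (u u' : integralAt θ) (f : Gf F D → WeightModule R m) :
    slash σ m v (u * u') f = slash σ m v u (slash σ m v u' f) := by
  funext x
  simp [slash, mul_assoc]

/-- `S_k^D(U, R)`: the functions `f : Dˣ \ G_f → L_k(R)` with `u_p f(x u) = f(x)` for all
`u ∈ U`. -/
def Forms : Submodule R (Gf F D → WeightModule R m) where
  carrier := {f | (∀ (δ : Dˣ) (x : Gf F D), f (diag F D δ * x) = f x) ∧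
    ∀ (u : Gf F D) (hu : u ∈ 𝓤.U), slash σ m v ⟨u, 𝓤.integral hu⟩ f = f}
  add_mem' {f g} hf hg :=
    ⟨fun δ x => by rw [Pi.add_apply, Pi.add_apply, hf.1, hg.1],
      fun u hu => by rw [map_add, hf.2 u hu, hg.2 u hu]⟩
  zero_mem' := ⟨fun _ _ => rfl, fun _ _ => map_zero _⟩
  smul_mem' c f hf :=
    ⟨fun δ x => by rw [Pi.smul_apply, Pi.smul_apply, hf.1],
      fun u hu => by rw [map_smul, hf.2 u hu]⟩

/-! ### Hecke operators -/

/-- The set of left cosets `x U` contained in `U g U`. -/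
def cosets (U : Subgroup (Gf F D)) (g : Gf F D) : Set (Gf F D ⧸ U) :=
  {c | ∃ u ∈ U, c = QuotientGroup.mk (u * g)}

theorem out_eq {U : Subgroup (Gf F D)} {g : Gf F D} (c : cosets U g) :
    ∃ u ∈ U, ∃ u' ∈ U, c.1.out = u * g * u' := by
  obtain ⟨c, u, hu, rfl⟩ := c
  obtain ⟨h, hh⟩ := QuotientGroup.mk_out_eq_mul U (u * g)
  exact ⟨u, hu, h.1, h.2, hh⟩

theorem cosets_finite {U : Subgroup (Gf F D)} (hU : IsOpenCompact F D U) (g : Gf F D) :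
    (cosets U g).Finite := by
  let _ : TopologicalSpace (AdelicAlg F D) := moduleTopology (FiniteAdeleRing (𝓞 F) F) _
  have : IsModuleTopology (FiniteAdeleRing (𝓞 F) F) (AdelicAlg F D) := ⟨rfl⟩
  have := IsModuleTopology.toContinuousAdd (FiniteAdeleRing (𝓞 F) F) (AdelicAlg F D)
  obtain ⟨ho, hc⟩ := hU
  have hL : ∀ a : AdelicAlg F D, Continuous fun x : AdelicAlg F D => a * x := fun a =>
    IsModuleTopology.continuous_of_linearMap (LinearMap.mulLeft (FiniteAdeleRing (𝓞 F) F) a)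
  have hR : ∀ a : AdelicAlg F D, Continuous fun x : AdelicAlg F D => x * a := fun a =>
    IsModuleTopology.continuous_of_linearMap (LinearMap.mulRight (FiniteAdeleRing (𝓞 F) F) a)
  have hV : ∀ a b : Gf F D, Continuous fun x : Gf F D => a * x * b := by
    intro a b
    rw [Units.continuous_iff]
    constructor
    · exact (hR b.1).comp ((hL a.1).comp Units.continuous_val)
    · have : (fun x : Gf F D => ((a * x * b)⁻¹ : Gf F D).1)
          = fun x : Gf F D => b⁻¹.1 * ((x⁻¹ : Gf F D).1 * a⁻¹.1) := by
        funext x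
        simp [mul_assoc]
      change Continuous fun x : Gf F D => ((a * x * b)⁻¹ : Gf F D).1
      rw [this]
      exact (hL _).comp ((hR _).comp Units.continuous_coe_inv)
  have hN : ∀ x ∈ (U : Set (Gf F D)),
      {y : Gf F D | (QuotientGroup.mk (x * g) : Gf F D ⧸ U) = QuotientGroup.mk (y * g)} ∈
        nhds x := by
    intro x _
    have h1 : {y : Gf F D | (QuotientGroup.mk (x * g) : Gf F D ⧸ U) = QuotientGroup.mk (y * g)}
        = (fun y : Gf F D => (x * g)⁻¹ * y * g) ⁻¹' (U : Set (Gf F D)) := by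
      ext y
      simp [QuotientGroup.eq, mul_assoc]
    rw [h1]
    refine (ho.preimage (hV _ _)).mem_nhds ?_
    simp [mul_assoc]
  obtain ⟨t, -, ht⟩ := hc.elim_nhds_subcover _ hN
  refine (t.finite_toSet.image fun x => (QuotientGroup.mk (x * g) : Gf F D ⧸ U)).subset ?_
  rintro c ⟨u, hu, rfl⟩
  obtain ⟨x, hx, hxu⟩ := Set.mem_iUnion₂.1 (ht hu)
  exact ⟨x, hx, hxu⟩

instance cosetsFintype (g : Gf F D) : Fintype (cosets 𝓤.U g) :=
  (cosets_finite 𝓤.isOpenCompact g).fintype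

/-- A representative of a coset `x U ⊆ U g U`. -/
def rep (g : integralAt θ) (c : cosets 𝓤.U g.1) : integralAt θ :=
  ⟨c.1.out, by
    obtain ⟨u, hu, u', hu', h⟩ := out_eq c
    rw [h]
    exact mul_mem (mul_mem (𝓤.integral hu) g.2) (𝓤.integral hu')⟩

theorem smul_mem_cosets {U : Subgroup (Gf F D)} {g u : Gf F D} (hu : u ∈ U) (c : Gf F D ⧸ U)
    (hc : c ∈ cosets U g) : u • c ∈ cosets U g := by
  obtain ⟨u', hu', rfl⟩ := hc
  exact ⟨u * u', mul_mem hu hu', by rw [mul_assoc]; rfl⟩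

/-- Left multiplication by `u ∈ U` permutes the cosets `x U ⊆ U g U`. -/
def cosetPerm {U : Subgroup (Gf F D)} (g : Gf F D) {u : Gf F D} (hu : u ∈ U) :
    cosets U g ≃ cosets U g where
  toFun c := ⟨u • c.1, smul_mem_cosets hu c.1 c.2⟩
  invFun c := ⟨u⁻¹ • c.1, smul_mem_cosets (inv_mem hu) c.1 c.2⟩
  left_inv c := Subtype.ext (inv_smul_smul u c.1)
  right_inv c := Subtype.ext (smul_inv_smul u c.1)

theorem slash_rep {f : Gf F D → WeightModule R m} (hf : f ∈ Forms 𝓤 σ m v) (g : integralAt θ)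
    {u : Gf F D} (hu : u ∈ 𝓤.U) (c : cosets 𝓤.U g.1) :
    slash σ m v ⟨u, 𝓤.integral hu⟩ (slash σ m v (rep 𝓤 g c) f)
      = slash σ m v (rep 𝓤 g (cosetPerm g.1 hu c)) f := by
  have h1 : (QuotientGroup.mk ((cosetPerm g.1 hu c).1.out) : Gf F D ⧸ 𝓤.U)
      = QuotientGroup.mk (u * c.1.out) := by
    rw [QuotientGroup.out_eq']
    change u • c.1 = _
    conv_lhs => rw [← QuotientGroup.out_eq' c.1]
    rfl
  rw [QuotientGroup.eq] at h1
  have h2 : (⟨u, 𝓤.integral hu⟩ : integralAt θ) * rep 𝓤 g c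
      = rep 𝓤 g (cosetPerm g.1 hu c) * ⟨_, 𝓤.integral h1⟩ := by
    apply Subtype.ext
    simp [rep]
  rw [← slash_mul, h2, slash_mul, hf.2 _ h1]

/-- The Hecke operator `[U g U] : f ↦ ∑ x_i f(· x_i)` on `S_k^D(U, R)`, where
`U g U = ∐ x_i U`. -/
def hecke (g : integralAt θ) : Module.End R (Forms 𝓤 σ m v) :=
  (∑ c : cosets 𝓤.U g.1, slash σ m v (rep 𝓤 g c)).restrict (by
    intro f hf
    refine ⟨fun δ x => ?_, fun u hu => ?_⟩
    · simp only [LinearMap.sum_apply, Finset.sum_apply]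
      refine Finset.sum_congr rfl fun c _ => ?_
      simp only [slash, LinearMap.coe_mk, AddHom.coe_mk, mul_assoc, hf.1]
    · rw [LinearMap.sum_apply, map_sum]
      simp only [slash_rep 𝓤 σ m v hf g hu]
      exact Equiv.sum_comp (cosetPerm g.1 hu) fun c => slash σ m v (rep 𝓤 g c) f)

variable (θ p)

/-- The matrix `(p 0; 0 1)` in `GL₂(F_p)`. -/
def etaMat [Fact p.Prime] : (Matrix (Fin 2) (Fin 2) (w.adicCompletion F))ˣ :=
  Matrix.GeneralLinearGroup.mkOfDetNeZero !![(p : w.adicCompletion F), 0; 0, 1] (by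
    have h : algebraMap F (w.adicCompletion F) (p : F) ≠ 0 := by
      rw [map_ne_zero]
      exact_mod_cast (Fact.out : p.Prime).ne_zero
    rw [Matrix.det_fin_two_of]
    simpa using h)

/-- `η_p ∈ G_f`: the element equal to `(p 0; 0 1)` at `p` and to `1` at all other places. -/
def eta [Fact p.Prime] : Gf F D :=
  localUnit D w (Units.map θ.symm.toRingEquiv.toRingHom.toMonoidHom (etaMat p))

theorem pComp_eta [Fact p.Prime] :
    pComp θ (eta θ p) = !![(p : w.adicCompletion F), 0; 0, 1] := by
  change θ (component D w (eta θ p).1) = _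
  rw [eta, component_localUnit]
  exact θ.apply_symm_apply _

theorem eta_mem [Fact p.Prime] : eta θ p ∈ integralAt θ := by
  intro i j
  rw [pComp_eta]
  fin_cases i <;> fin_cases j
  · exact natCast_mem _ p
  · exact zero_mem _
  · exact zero_mem _
  · exact one_mem _

variable {θ p}

/-- `T_p = [U η_p U]`. -/
def Tp [Fact p.Prime] : Module.End R (Forms 𝓤 σ m v) := hecke 𝓤 σ m v ⟨eta θ p, eta_mem θ p⟩

end Adelic

/-! ### Weights, slopes -/

/-- `k = (k_τ)` is a weight and `v = (v_τ)` is the attached twist: all `k_τ ≥ 2` have the same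
parity, `v_τ ≥ 0`, some `v_τ` vanishes, and `(k_τ - 2) + 2 v_τ` does not depend on `τ`. -/
structure IsWeight {ι : Type*} (k v : ι → ℕ) : Prop where
  two_le : ∀ τ, 2 ≤ k τ
  parity : ∀ τ τ', k τ ≡ k τ' [MOD 2]
  exists_zero : ∃ τ, v τ = 0
  parallel : ∃ μ : ℕ, ∀ τ, (k τ - 2) + 2 * v τ = μ

/-- The index set of the weights: the continuous embeddings of `F_p` into `ℚ̄_p`. -/
abbrev Emb (p : ℕ) [Fact p.Prime] {F : Type*} [Field F] [NumberField F]
    (w : HeightOneSpectrum (𝓞 F)) : Type _ :=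
  {τ : w.adicCompletion F →+* PadicAlgCl p // Continuous τ}

instance Emb.finite (p : ℕ) [Fact p.Prime] {F : Type*} [Field F] [NumberField F]
    (w : HeightOneSpectrum (𝓞 F)) : Finite (Emb p w) := by
  have hd : DenseRange (algebraMap F (w.adicCompletion F)) :=
    HeightOneSpectrum.denseRange_algebraMap F w
  refine Finite.of_injective
    (fun τ : Emb p w => (τ.1.comp (algebraMap F (w.adicCompletion F)) : F →+* PadicAlgCl p)) ?_
  intro τ τ' h
  apply Subtype.ext
  apply RingHom.ext
  refine congrFun (hd.equalizer τ.2 τ'.2 ?_)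
  funext x
  exact RingHom.congr_fun h x

instance Emb.fintype (p : ℕ) [Fact p.Prime] {F : Type*} [Field F] [NumberField F]
    (w : HeightOneSpectrum (𝓞 F)) : Fintype (Emb p w) := Fintype.ofFinite _

/-- The number of eigenvalues of slope `α` of an endomorphism of a finite-dimensional
`ℚ̄_p`-vector space, counted with algebraic multiplicity: the eigenvalues `z` with
`|z|_p = p^{-α}`, i.e. of valuation `α`, where `p` has valuation `1`. -/
def slopeCount (p : ℕ) [Fact p.Prime] {V : Type*} [AddCommGroup V] [Module (PadicAlgCl p) V]
    (φ : Module.End (PadicAlgCl p) V) (α : ℝ) : ℕ :=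
  Module.finrank (PadicAlgCl p)
    (⨆ z ∈ {z : PadicAlgCl p | ‖z‖ = (p : ℝ) ^ (-α)}, φ.maxGenEigenspace z :
      Submodule (PadicAlgCl p) V)

/-- `D(k, α)`: the number of eigenvalues of slope `α` of `ξ = p^{-∑ v_τ} T_p` on
`S_k^D(U, R)`, for `R ⊆ ℚ̄_p`. -/
def slopeDim {p : ℕ} [Fact p.Prime] {F : Type*} [Field F] [NumberField F]
    {D : Type*} [Ring D] [Algebra F D] {w : HeightOneSpectrum (𝓞 F)}
    {θ : w.adicCompletion F ⊗[F] D ≃ₐ[w.adicCompletion F]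
      Matrix (Fin 2) (Fin 2) (w.adicCompletion F)}
    (𝓤 : Level θ p) {R : Type*} [CommRing R] [Algebra R (PadicAlgCl p)]
    (σ : Emb p w → w.adicCompletionIntegers F →+* R) (k v : Emb p w → ℕ) (α : ℝ) : ℕ :=
  slopeCount p
    (((p : PadicAlgCl p) ^ ∑ τ, v τ)⁻¹ •
      (Tp 𝓤 σ (fun τ => k τ - 2) v).baseChange (PadicAlgCl p)) α

end QuatForms
end

/-!
The algebra `D` is totally definite, so that a form is determined by its values on representatives
of the finite class set `Dˣ \ G_f / U`. If the groups `Γ` are trivial then these values are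
arbitrary (`Forms.eval_bijective`), except when `p = 2` and a global unit acts by `-1`, in which
case there are no forms in either weight. On these values `T_p` acts as a block matrix, whose
blocks are given by matrices `(p a, b; p c, e)` with `e ≡ 1` modulo `p` and of determinant `p u`,
`u ≡ 1` modulo `p`, which do not depend on the weight (`exists_localHecke`).

After conjugation by powers of `p`, the row of the matrix of `p^{-∑ v_τ} T_p` which belongs to the
multi-index `(j_τ)` is divisible by `p^{∑ j_τ}` (`HeckeData.matrix`). This has two consequences.
First, the coefficients of the characteristic power series have a lower bound for their valuations,
of the order `N^{1 + 1/d}`, in which the weight does not occur. Secondly, for two weights which are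
congruent modulo `p^n` the rows with `∑ j_τ < n - 1` agree modulo `p^{n - 1}`, while the other rows
vanish modulo `p^{n - 1}`, so that the characteristic power series are congruent. If `n` is large in
comparison with `α`, then the two Newton polygons have the same part of slope `α`
(`countP_norm_eq_of_coeff`, `HeckeData.countP_eq`).

The congruence of the weights also involves the twists `v_τ`, which become congruent only after the
addition of a constant to all of them (`exists_modEq_twist`). Such a constant multiplies the blocks
of the matrix by powers of `∏_τ τ(u)`, and one has to know that this is a coboundary on the class
set. It is one because the norm of the reduced norm at `p`, divided by its part outside of `p`, is a
character of `Dˣ \ G_f` (`exists_character`): reduced norms from `D` are totally positive, and the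
product formula holds.

Finally, the class set is finite (`finite_classSet`), for in each lattice of `D` an element of
minimal norm generates a submodule of bounded index (`exists_smul_mem_principal`).
-/

noncomputable section

namespace QuatForms

/-! ### Newton polygons -/

section Newton

open Polynomial

variable {K : Type*} [NormedField K]

/-- The polynomial `∏ (1 - z X)` with the given reciprocal roots `z`. -/
def recipPoly (s : Multiset K) : K[X] := (s.map fun z => 1 - C z * X).prod

/-- The weighted absolute values `‖a_N‖ r ^ N` of the coefficients of `∏ (1 - z X)` are maximal at
`N = #{z | 1 < ‖z‖ r}` and at `N = #{z | 1 ≤ ‖z‖ r}`, and strictly smaller outside of the interval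
between these two indices: this is the side of the Newton polygon of a given slope. -/
theorem recipPoly_newton [IsUltrametricDist K] (s : Multiset K) {r : ℝ} (hr : 0 < r) :
    ∃ μ : ℝ, 0 < μ ∧ (∀ N, ‖(recipPoly s).coeff N‖ * r ^ N ≤ μ) ∧
      ‖(recipPoly s).coeff (s.countP fun z => 1 < ‖z‖ * r)‖ *
        r ^ (s.countP fun z => 1 < ‖z‖ * r) = μ ∧
      ‖(recipPoly s).coeff (s.countP fun z => 1 ≤ ‖z‖ * r)‖ *
        r ^ (s.countP fun z => 1 ≤ ‖z‖ * r) = μ ∧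
      (∀ N < s.countP fun z => 1 < ‖z‖ * r, ‖(recipPoly s).coeff N‖ * r ^ N < μ) ∧
      ∀ N > s.countP fun z => 1 ≤ ‖z‖ * r, ‖(recipPoly s).coeff N‖ * r ^ N < μ := by
  induction s using Multiset.induction_on with
  | empty =>
    refine ⟨1, one_pos, fun N => ?_, by simp [recipPoly], by simp [recipPoly], by simp, ?_⟩
    · rcases N with _ | N <;> simp [recipPoly, coeff_one]
    · rintro (_ | N) hN
      · simp at hN
      · simp [recipPoly, coeff_one]
  | cons z s ih =>
    obtain ⟨μ, hμ, hle, hA, hB, hltA, hltB⟩ := ih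
    simp only [Multiset.countP_cons]
    set A := s.countP fun z => 1 < ‖z‖ * r with hAdef
    set B := s.countP fun z => 1 ≤ ‖z‖ * r with hBdef
    have hAB : A ≤ B := by
      simp only [hAdef, hBdef, Multiset.countP_eq_card_filter]
      exact Multiset.card_le_card
        (Multiset.monotone_filter_right s fun _ h => le_of_lt h)
    set P := recipPoly s with hP
    have hPz : recipPoly (z ::ₘ s) = P - C z * (P * X) := by
      rw [recipPoly, Multiset.map_cons, Multiset.prod_cons, ← recipPoly, ← hP]
      ring
    have h0 : (recipPoly (z ::ₘ s)).coeff 0 = P.coeff 0 := by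
      rw [hPz]
      simp
    have hS : ∀ N, (recipPoly (z ::ₘ s)).coeff (N + 1) = P.coeff (N + 1) - z * P.coeff N := by
      intro N
      rw [hPz]
      simp
    set ρ := ‖z‖ * r with hρ
    have hρ0 : 0 ≤ ρ := by positivity
    have hmax : ∀ N, ‖(recipPoly (z ::ₘ s)).coeff (N + 1)‖ * r ^ (N + 1) ≤
        max (‖P.coeff (N + 1)‖ * r ^ (N + 1)) (ρ * (‖P.coeff N‖ * r ^ N)) := by
      intro N
      have h := IsUltrametricDist.norm_add_le_max (P.coeff (N + 1)) (-(z * P.coeff N))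
      rw [← sub_eq_add_neg, norm_neg] at h
      have h2 : ρ * (‖P.coeff N‖ * r ^ N) = ‖z * P.coeff N‖ * r ^ (N + 1) := by
        rw [norm_mul, pow_succ, hρ]
        ring
      rw [hS, h2, ← max_mul_of_nonneg _ _ (by positivity)]
      exact mul_le_mul_of_nonneg_right h (by positivity)
    have hne : ∀ N, ‖P.coeff (N + 1)‖ * r ^ (N + 1) ≠ ρ * (‖P.coeff N‖ * r ^ N) →
        ‖(recipPoly (z ::ₘ s)).coeff (N + 1)‖ * r ^ (N + 1) =
        max (‖P.coeff (N + 1)‖ * r ^ (N + 1)) (ρ * (‖P.coeff N‖ * r ^ N)) := by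
      intro N hN
      have h2 : ρ * (‖P.coeff N‖ * r ^ N) = ‖z * P.coeff N‖ * r ^ (N + 1) := by
        rw [norm_mul, pow_succ, hρ]
        ring
      rw [h2] at hN ⊢
      have h3 : ‖P.coeff (N + 1)‖ ≠ ‖-(z * P.coeff N)‖ := by
        rw [norm_neg]
        exact fun h => hN (by rw [h])
      rw [hS, ← max_mul_of_nonneg _ _ (by positivity), sub_eq_add_neg,
        IsUltrametricDist.norm_add_eq_max_of_norm_ne_norm h3, norm_neg]
    rcases lt_trichotomy ρ 1 with h1 | h1 | h1
    · simp only [not_lt.2 h1.le, not_le.2 h1, if_false, add_zero]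
      have hsmall : ∀ N, ρ * (‖P.coeff N‖ * r ^ N) < μ := fun N =>
        lt_of_le_of_lt (mul_le_mul_of_nonneg_left (hle N) hρ0) (by nlinarith)
      have heq : ∀ N, ‖P.coeff N‖ * r ^ N = μ →
          ‖(recipPoly (z ::ₘ s)).coeff N‖ * r ^ N = μ := by
        rintro (_ | N) hN
        · rw [h0, hN]
        · rw [hne N (by rw [hN]; exact (hsmall N).ne'), hN, max_eq_left (hsmall N).le]
      have hlt : ∀ N, ‖P.coeff N‖ * r ^ N < μ →
          ‖(recipPoly (z ::ₘ s)).coeff N‖ * r ^ N < μ := by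
        rintro (_ | N) hN
        · rwa [h0]
        · exact (hmax N).trans_lt (max_lt hN (hsmall N))
      refine ⟨μ, hμ, ?_, heq _ hA, heq _ hB, fun N hN => hlt N (hltA N hN),
        fun N hN => hlt N (hltB N hN)⟩
      rintro (_ | N)
      · rw [h0]
        exact hle 0
      · exact (hmax N).trans (max_le (hle _) (hsmall N).le)
    · simp only [h1, lt_irrefl, le_refl, if_true, if_false, add_zero]
      simp only [h1, one_mul] at hmax hne
      refine ⟨μ, hμ, ?_, ?_, ?_, ?_, ?_⟩
      · rintro (_ | N)
        · rw [h0]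
          exact hle 0
        · exact (hmax N).trans (max_le (hle _) (hle _))
      · rcases hA' : A with _ | N
        · rw [h0, ← hA']
          rwa [hA'] at hA ⊢
        · have h4 := hltA N (by omega)
          rw [hA'] at hA
          rw [hne N (by rw [hA]; exact h4.ne'), hA, max_eq_left h4.le]
      · have h4 := hltB (B + 1) (by omega)
        rw [hne B (by rw [hB]; exact h4.ne), hB, max_eq_right h4.le]
      · rintro (_ | N) hN
        · rw [h0]
          exact hltA _ hN
        · exact (hmax N).trans_lt (max_lt (hltA _ hN) (hltA _ (by omega)))
      · rintro (_ | N) hN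
        · omega
        · exact (hmax N).trans_lt (max_lt (hltB _ (by omega)) (hltB _ (by omega)))
    · simp only [h1, h1.le, if_true]
      have hρμ : μ < ρ * μ := by nlinarith
      have hstep : ∀ N, ‖P.coeff N‖ * r ^ N = μ →
          ‖(recipPoly (z ::ₘ s)).coeff (N + 1)‖ * r ^ (N + 1) = ρ * μ := by
        intro N hN
        have h4 := (hle (N + 1)).trans_lt hρμ
        rw [hne N (by rw [hN]; exact h4.ne), hN, max_eq_right h4.le]
      have hstep' : ∀ N, ‖P.coeff N‖ * r ^ N < μ →
          ‖(recipPoly (z ::ₘ s)).coeff (N + 1)‖ * r ^ (N + 1) < ρ * μ := fun N hN =>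
        (hmax N).trans_lt (max_lt ((hle _).trans_lt hρμ)
          (mul_lt_mul_of_pos_left hN (by linarith)))
      refine ⟨ρ * μ, by positivity, ?_, hstep _ hA, hstep _ hB, ?_, ?_⟩
      · rintro (_ | N)
        · rw [h0]
          exact (hle 0).trans hρμ.le
        · exact (hmax N).trans (max_le ((hle _).trans hρμ.le)
            (mul_le_mul_of_nonneg_left (hle _) hρ0))
      · rintro (_ | N) hN
        · rw [h0]
          exact (hle 0).trans_lt hρμ
        · exact hstep' N (hltA N (by omega))
      · rintro (_ | N) hN
        · omega
        · exact hstep' N (hltB N (by omega))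

theorem countP_norm_split (s : Multiset K) (r : ℝ) :
    (s.countP fun z => 1 ≤ ‖z‖ * r) =
      (s.countP fun z => 1 < ‖z‖ * r) + s.countP fun z => ‖z‖ * r = 1 := by
  induction s using Multiset.induction_on with
  | empty => simp
  | cons z s ih =>
    simp only [Multiset.countP_cons, ih]
    rcases lt_trichotomy (‖z‖ * r) 1 with h | h | h
    · simp [h.not_gt, h.not_ge, h.ne]
    · simp [h]
      omega
    · simp [h, h.le, h.ne']
      omega

/-- Two polynomials `∏ (1 - z X)` have the same number of reciprocal roots of absolute value
`r⁻¹` as soon as those of their coefficients which matter for the side of slope `r` of the Newton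
polygon, i.e. those with `1 ≤ ‖a_N‖ r ^ N`, have the same absolute values. -/
theorem countP_norm_eq_of_coeff [IsUltrametricDist K] (s s' : Multiset K) {r : ℝ} (hr : 0 < r)
    (h : ∀ N, (1 ≤ ‖(recipPoly s).coeff N‖ * r ^ N ∨ 1 ≤ ‖(recipPoly s').coeff N‖ * r ^ N) →
      ‖(recipPoly s).coeff N‖ = ‖(recipPoly s').coeff N‖) :
    (s.countP fun z => ‖z‖ * r = 1) = s'.countP fun z => ‖z‖ * r = 1 := by
  have hone : ∀ t : Multiset K, (recipPoly t).coeff 0 = 1 := by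
    intro t
    induction t using Multiset.induction_on with
    | empty => simp [recipPoly]
    | cons z t ih =>
      rw [recipPoly, Multiset.map_cons, Multiset.prod_cons, ← recipPoly, mul_coeff_zero, ih]
      simp
  obtain ⟨μ, -, hle, hA, hB, hltA, hltB⟩ := recipPoly_newton s hr
  obtain ⟨μ', -, hle', hA', hB', hltA', hltB'⟩ := recipPoly_newton s' hr
  have h1 : 1 ≤ μ := by simpa [hone] using hle 0
  have h1' : 1 ≤ μ' := by simpa [hone] using hle' 0
  have e1 := h _ (Or.inl (hA.symm ▸ h1))
  have e2 := h _ (Or.inl (hB.symm ▸ h1))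
  have e3 := h _ (Or.inr (hA'.symm ▸ h1'))
  have e4 := h _ (Or.inr (hB'.symm ▸ h1'))
  rw [e1] at hA
  rw [e2] at hB
  rw [← e3] at hA'
  rw [← e4] at hB'
  have hμ : μ = μ' := le_antisymm (hA ▸ hle' _) (hA' ▸ hle _)
  subst hμ
  have k1 := le_antisymm (not_lt.1 fun hlt => (hltA _ hlt).ne hA')
    (not_lt.1 fun hlt => (hltA' _ hlt).ne hA)
  have k2 := le_antisymm (not_lt.1 fun hlt => (hltB' _ hlt).ne hB)
    (not_lt.1 fun hlt => (hltB _ hlt).ne hB')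
  have := countP_norm_split s r
  have := countP_norm_split s' r
  omega

theorem reverse_prod_X_sub_C (s : Multiset K) :
    (s.map fun z => X - C z).prod.reverse = recipPoly s := by
  induction s using Multiset.induction_on with
  | empty =>
    rw [Multiset.map_zero, Multiset.prod_zero, recipPoly, Multiset.map_zero, Multiset.prod_zero,
      ← C_1, reverse_C]
  | cons z s ih =>
    rw [Multiset.map_cons, Multiset.prod_cons, reverse_mul_of_domain, ih, recipPoly, recipPoly,
      Multiset.map_cons, Multiset.prod_cons]
    congr 1
    rw [reverse, natDegree_X_sub_C, reflect_sub, reflect_C]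
    have : (X : K[X]) = X ^ 1 := (pow_one X).symm
    conv_lhs => rw [this]
    rw [reflect_monomial]
    simp

end Newton

section Slope

open Polynomial Module

variable {p : ℕ} [Fact p.Prime]

theorem slopeCount_eq_countP {V : Type*} [AddCommGroup V] [Module (PadicAlgCl p) V]
    [FiniteDimensional (PadicAlgCl p) V] (φ : End (PadicAlgCl p) V) (α : ℝ) :
    slopeCount p φ α = φ.charpoly.roots.countP fun z => ‖z‖ * (p : ℝ) ^ α = 1 := by
  classical
  have hp : (0 : ℝ) < p := by exact_mod_cast (Fact.out : p.Prime).pos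
  have hiff : ∀ z : PadicAlgCl p, ‖z‖ = (p : ℝ) ^ (-α) ↔ ‖z‖ * (p : ℝ) ^ α = 1 := by
    intro z
    rw [Real.rpow_neg hp.le, mul_eq_one_iff_eq_inv₀ (Real.rpow_pos_of_pos hp α).ne']
  set T : Finset (PadicAlgCl p) :=
    φ.charpoly.roots.toFinset.filter fun z => ‖z‖ * (p : ℝ) ^ α = 1 with hT
  have hsup : (⨆ z ∈ {z : PadicAlgCl p | ‖z‖ = (p : ℝ) ^ (-α)}, φ.maxGenEigenspace z) =
      ⨆ z : T, φ.maxGenEigenspace z := by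
    rw [iSup_subtype]
    apply le_antisymm
    · refine iSup₂_le fun z hz => ?_
      by_cases hroot : z ∈ T
      · exact le_iSup₂_of_le z hroot le_rfl
      · have : φ.charpoly.rootMultiplicity z = 0 := by
          rw [← count_roots, Multiset.count_eq_zero]
          intro h
          exact hroot (by rw [hT, Finset.mem_filter, Multiset.mem_toFinset];
                          exact ⟨h, (hiff z).1 hz⟩)
        rw [← LinearMap.finrank_maxGenEigenspace_eq, Submodule.finrank_eq_zero] at this
        rw [this]
        exact bot_le
    · refine iSup₂_le fun z hz => ?_
      exact le_iSup₂_of_le z ((hiff z).2 (Finset.mem_filter.1 hz).2) le_rfl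
  have hind : iSupIndep fun z : T => φ.maxGenEigenspace (z : PadicAlgCl p) :=
    (End.independent_maxGenEigenspace φ).comp Subtype.val_injective
  rw [slopeCount, hsup, Submodule.iSup_eq_range_dfinsupp_lsum,
    LinearMap.finrank_range_of_inj hind.dfinsupp_lsum_injective]
  change finrank (PadicAlgCl p) (DirectSum T fun z => φ.maxGenEigenspace (z : PadicAlgCl p)) = _
  rw [finrank_directSum]
  simp only [LinearMap.finrank_maxGenEigenspace_eq, ← count_roots]
  rw [Multiset.countP_eq_card_filter, ← Multiset.toFinset_sum_count_eq, Multiset.toFinset_filter,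
    ← hT, Finset.sum_coe_sort T fun z => φ.charpoly.roots.count z]
  exact Finset.sum_congr rfl fun z hz =>
    (Multiset.count_filter_of_pos (p := fun z => ‖z‖ * (p : ℝ) ^ α = 1)
      (Finset.mem_filter.1 hz).2).symm

end Slope

/-! ### The matrices of the Hecke operator -/

section CharpolyRev

open Polynomial Matrix

variable {A : Type*} [CommRing A] {n n' : Type*} [Fintype n] [DecidableEq n] [Fintype n']
  [DecidableEq n']

theorem charpolyRev_map {B : Type*} [CommRing B] (M : Matrix n n A) (φ : A →+* B) :
    (M.map φ).charpolyRev = M.charpolyRev.map φ := by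
  rw [charpolyRev, charpolyRev, ← coe_mapRingHom, RingHom.map_det]
  congr 1
  ext i j
  by_cases h : i = j <;> simp [h]

theorem charpolyRev_eq_of_row_eq_zero (M : Matrix n n A) (q : n → Prop) [DecidablePred q]
    (e : n' ≃ {i // q i}) (h : ∀ i, ¬ q i → ∀ j, M i j = 0) :
    M.charpolyRev = (M.submatrix (fun x => (e x).1) fun x => (e x).1).charpolyRev := by
  have h0 : ∀ i, ¬ q i → ∀ j, (1 - (X : A[X]) • M.map C) i j = (1 : Matrix n n A[X]) i j :=
    fun i hi j => by simp [h i hi j]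
  rw [charpolyRev, twoBlockTriangular_det _ q]
  · have h1 : (toSquareBlockProp (1 - (X : A[X]) • M.map C) fun i => ¬ q i) = 1 := by
      ext1 i j
      rw [toSquareBlockProp_def, of_apply, h0 i.1 i.2, one_apply, one_apply]
      simp only [Subtype.ext_iff]
    rw [h1, det_one, mul_one, charpolyRev]
    refine (det_submatrix_equiv_self e _).symm.trans ?_
    congr 1
    ext1 i j
    simp only [toSquareBlockProp_def, one_apply, submatrix_apply, of_apply, Matrix.sub_apply,
      Matrix.smul_apply,
      map_apply, Subtype.val_inj, e.injective.eq_iff]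
  · rintro i hi j hj
    rw [h0 i hi, one_apply_ne]
    rintro rfl
    exact hi hj

/-- Indices whose rows vanish do not contribute to `det (1 - X M)`. -/
theorem charpolyRev_submatrix_of_row_eq_zero (M : Matrix n n A) (f : n' → n)
    (hf : Function.Injective f) (h : ∀ i, i ∉ Set.range f → ∀ j, M i j = 0) :
    M.charpolyRev = (M.submatrix f f).charpolyRev := by
  classical
  exact charpolyRev_eq_of_row_eq_zero M (fun i => i ∈ Set.range f) (Equiv.ofInjective f hf) h

/-- If the `i`-th row of `M` is divisible by `q ^ w i`, then the coefficient of `X ^ N` in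
`det (1 - X M)` is divisible by the least of the `q ^ (∑ i ∈ S, w i)`, `S` of size `N`. -/
theorem pow_dvd_coeff_charpolyRev (M : Matrix n n A) (q : A) (w : n → ℕ)
    (h : ∀ i j, q ^ w i ∣ M i j) (N H : ℕ) (hH : ∀ S : Finset n, S.card = N → H ≤ ∑ i ∈ S, w i) :
    q ^ H ∣ M.charpolyRev.coeff N := by
  have h1 : M.charpolyRev = det (1 + (X : A[X]) • (-M).map C) := by
    rw [charpolyRev, sub_eq_add_neg]
    congr 2
    rw [Matrix.map_neg C (map_neg C) M, smul_neg]
  rw [h1, coeff_det_one_add_X_smul_eq_sum_minors]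
  refine Finset.dvd_sum fun S hS => ?_
  refine (pow_dvd_pow q (hH S (Finset.mem_powersetCard.1 hS).2)).trans ?_
  choose B hB using h
  have h2 : (-M).submatrix (Subtype.val : S → n) (Subtype.val : S → n) =
      Matrix.of fun i j => q ^ w i.1 * (-B i.1 j.1) := by
    ext i j
    simp [hB i.1 j.1]
  rw [h2, det_mul_column (fun i : S => q ^ w i.1) (fun i j => -B i.1 j.1),
    Finset.prod_coe_sort S (fun i => q ^ w i),
    Finset.prod_pow_eq_pow_sum]
  exact dvd_mul_right _ _

end CharpolyRev

section Family

open Polynomial Matrix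

variable {ι Cl Co O : Type*} [CommRing O]

/-- The substitution of a matrix `(p a, b; p c, e)` into the monomial `x ^ j y ^ (m - j)`,
dehomogenized by `y = 1`, and with the variable `x` rescaled by `p`. -/
def substPoly (p : ℕ) (a b c e : O) (m j : ℕ) : O[X] :=
  (C (p * a) * X + C c) ^ j * (C (p * b) * X + C e) ^ (m - j)

/-- The combinatorial data of a Hecke operator: it maps a function `f` on `Cl` to
`i ↦ ∑ c, γ(i,c) f(next i c)`, where `γ(i,c) = (p a, b; p c, e)` acts on the factor at `τ` through
its image under `τ`, and where `det γ(i,c) = p u`. -/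
structure HeckeData (ι Cl Co O : Type*) where
  next : Cl → Co → Cl
  a : Cl → Co → ι → O
  b : Cl → Co → ι → O
  c : Cl → Co → ι → O
  e : Cl → Co → ι → O
  u : Cl → Co → ι → O

/-- The matrix of the operator `ξ` of weight `m` and twist `v`. The basis of `L_k` consists of the
monomials `∏ x ^ (j τ) y ^ (m τ - j τ)`, rescaled by `p ^ (∑ j τ)`. -/
def HeckeData.matrix [Fintype ι] [DecidableEq Cl] [Fintype Co]
    (H : HeckeData ι Cl Co O) (p : ℕ) (m v : ι → ℕ) :
    Matrix (Cl × (ι → ℕ)) (Cl × (ι → ℕ)) O := fun x y =>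
  ∑ c, if H.next x.1 c = y.1 then
    ∏ τ, H.u x.1 c τ ^ v τ * (substPoly p (H.a x.1 c τ) (H.b x.1 c τ) (H.c x.1 c τ) (H.e x.1 c τ)
      (m τ) (y.2 τ)).coeff (x.2 τ) else 0

/-- The index set of the basis of `Cl → L_k`. -/
abbrev Idx (Cl : Type*) {ι : Type*} (m : ι → ℕ) : Type _ := Cl × ((τ : ι) → Fin (m τ + 1))

/-- The inclusion of the indices of weight `m` into the indices of all weights. -/
def Idx.emb {m : ι → ℕ} (x : Idx Cl m) : Cl × (ι → ℕ) := (x.1, fun τ => x.2 τ)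

theorem Idx.emb_injective {m : ι → ℕ} : Function.Injective (Idx.emb (Cl := Cl) (m := m)) := by
  rintro ⟨i, j⟩ ⟨i', j'⟩ h
  simp only [emb, Prod.mk.injEq, funext_iff] at h
  exact Prod.ext h.1 (funext fun τ => Fin.ext (h.2 τ))

/-- The matrix of `ξ` on `Cl → L_k`. -/
def HeckeData.fin [Fintype ι] [DecidableEq Cl] [Fintype Co]
    (H : HeckeData ι Cl Co O) (p : ℕ) (m v : ι → ℕ) :
    Matrix (Idx Cl m) (Idx Cl m) O := (H.matrix p m v).submatrix Idx.emb Idx.emb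

theorem pow_dvd_coeff_substPoly (p : ℕ) (a b c e : O) (m j i : ℕ) :
    (p : O) ^ i ∣ (substPoly p a b c e m j).coeff i := by
  have h : substPoly p a b c e m j =
      ((C a * X + C c) ^ j * (C b * X + C e) ^ (m - j)).comp (C (p : O) * X) := by
    simp only [substPoly, mul_comp, pow_comp, add_comp, C_comp, X_comp, C_mul]
    ring
  rw [h, comp_C_mul_X_coeff]
  exact dvd_mul_left _ _

theorem HeckeData.pow_dvd_matrix [Fintype ι] [DecidableEq Cl] [Fintype Co]
    (H : HeckeData ι Cl Co O) (p : ℕ) (m v : ι → ℕ)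
    (x y : Cl × (ι → ℕ)) : (p : O) ^ ∑ τ, x.2 τ ∣ H.matrix p m v x y := by
  refine Finset.dvd_sum fun c _ => ?_
  split_ifs
  · rw [← Finset.prod_pow_eq_pow_sum]
    exact Finset.prod_dvd_prod_of_dvd _ _ fun τ _ =>
      (pow_dvd_coeff_substPoly p _ _ _ _ _ _ _).mul_left _
  · exact dvd_zero _

theorem pow_eq_pow_of_modEq_of_dvd_sub_one {p N : ℕ} {x : O} (hx : (p : O) ∣ x - 1)
    (hN : (p : O) ^ N = 0) {r s : ℕ} (h : r ≡ s [MOD p ^ N]) : x ^ r = x ^ s := by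
  have h1 : x ^ p ^ N = 1 := by
    have h := dvd_sub_pow_of_dvd_sub hx N
    rw [pow_succ, hN, zero_mul, zero_dvd_iff, one_pow, sub_eq_zero] at h
    exact h
  have h2 : ∀ r, x ^ r = x ^ (r % p ^ N) := fun r => by
    conv_lhs => rw [← Nat.div_add_mod r (p ^ N), pow_add, pow_mul, h1, one_pow, one_mul]
  rw [h2 r, h2 s, h]

theorem substPoly_eq_of_modEq {p N : ℕ} (a b c : O) {e : O} (he : (p : O) ∣ e - 1)
    (hN : (p : O) ^ N = 0) {m m' j : ℕ} (hj : j ≤ m) (hj' : j ≤ m') (h : m ≡ m' [MOD p ^ N]) :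
    substPoly p a b c e m j = substPoly p a b c e m' j := by
  rw [substPoly, substPoly]
  congr 1
  refine pow_eq_pow_of_modEq_of_dvd_sub_one (p := p) (N := N) ?_ ?_ ?_
  · obtain ⟨e', he'⟩ := he
    refine ⟨C b * X + C e', ?_⟩
    have : (C e : O[X]) = C (1 + p * e') := by rw [← he']; simp
    rw [this]
    simp
    ring
  · rw [← C_eq_natCast, ← C_pow, hN, C_0]
  · refine Nat.ModEq.add_right_cancel' j ?_
    rwa [Nat.sub_add_cancel hj, Nat.sub_add_cancel hj']

/-- Modulo `p ^ N`, the polynomial `det (1 - X M)` depends only on the weight modulo `p ^ N`, as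
long as the weights are large. -/
theorem HeckeData.charpolyRev_fin_eq [Fintype ι] [DecidableEq ι] [Fintype Cl]
    [DecidableEq Cl] [Fintype Co] (H : HeckeData ι Cl Co O) (p N : ℕ)
    (hN : (p : O) ^ N = 0)
    (he : ∀ i c τ, (p : O) ∣ H.e i c τ - 1) (hu : ∀ i c τ, (p : O) ∣ H.u i c τ - 1)
    (m v m' v' : ι → ℕ) (hm : ∀ τ, N ≤ m τ + 1) (hm' : ∀ τ, N ≤ m' τ + 1)
    (hmm : ∀ τ, m τ ≡ m' τ [MOD p ^ N]) (hvv : ∀ τ, v τ ≡ v' τ [MOD p ^ N]) :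
    (H.fin p m v).charpolyRev = (H.fin p m' v').charpolyRev := by
  classical
  set m₀ : ι → ℕ := fun τ => min (m τ) (m' τ) with hm₀
  have key : ∀ (m v : ι → ℕ) (h : ∀ τ, m₀ τ ≤ m τ), (∀ τ, N ≤ m₀ τ + 1) →
      (H.fin p m v).charpolyRev =
        ((H.matrix p m v).submatrix (Idx.emb (m := m₀)) Idx.emb).charpolyRev := by
    intro m v h hm
    let f : Idx Cl m₀ → Idx Cl m := fun x =>
      (x.1, fun τ => Fin.castLE (Nat.succ_le_succ (h τ)) (x.2 τ))
    have hf : ∀ x, (f x).emb = x.emb := fun x => rfl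
    rw [charpolyRev_submatrix_of_row_eq_zero _ f]
    · rfl
    · intro x y hxy
      refine Idx.emb_injective ?_
      rw [← hf, ← hf, hxy]
    · intro x hx y
      have hx' : ∃ τ, m₀ τ < x.2 τ := by
        by_contra! hcon
        refine hx ⟨(x.1, fun τ => ⟨x.2 τ, Nat.lt_succ_of_le (hcon τ)⟩), ?_⟩
        rfl
      obtain ⟨τ, hτ⟩ := hx'
      have hle : N ≤ ∑ τ, x.emb.2 τ :=
        ((hm τ).trans hτ).trans (Finset.single_le_sum (f := fun τ => x.emb.2 τ)
          (fun _ _ => Nat.zero_le _) (Finset.mem_univ τ))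
      have := (pow_dvd_pow (p : O) hle).trans (H.pow_dvd_matrix p m v x.emb y.emb)
      rw [hN, zero_dvd_iff] at this
      exact this
  rw [key m v (fun τ => min_le_left _ _)
      (fun τ => by simp only [hm₀]; have := hm τ; have := hm' τ; omega),
    key m' v' (fun τ => min_le_right _ _)
      (fun τ => by simp only [hm₀]; have := hm τ; have := hm' τ; omega)]
  congr 1
  ext x y
  simp only [submatrix_apply, HeckeData.matrix]
  refine Finset.sum_congr rfl fun c _ => ?_
  congr 1
  refine Finset.prod_congr rfl fun τ _ => ?_
  have hy : y.emb.2 τ ≤ m₀ τ := Nat.lt_succ_iff.1 (y.2 τ).2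
  rw [pow_eq_pow_of_modEq_of_dvd_sub_one (hu _ _ τ) hN (hvv τ),
    substPoly_eq_of_modEq _ _ _ (he _ _ τ) hN (hy.trans (min_le_left _ _))
      (hy.trans (min_le_right _ _)) (hmm τ)]

/-- At most `#Cl * t ^ #ι` of the basis vectors have degree less than `t`. -/
theorem Idx.le_sum_degree [Fintype ι] [Fintype Cl] {m : ι → ℕ} (S : Finset (Idx Cl m)) (t : ℕ) :
    t * (S.card - Fintype.card Cl * t ^ Fintype.card ι) ≤ ∑ x ∈ S, ∑ τ, x.emb.2 τ := by
  classical
  have h1 : (S.filter fun x => ∑ τ, x.emb.2 τ < t).card ≤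
      Fintype.card Cl * t ^ Fintype.card ι := by
    have := Finset.card_le_card_of_injOn (s := S.filter fun x => ∑ τ, x.emb.2 τ < t)
      (t := (Finset.univ : Finset Cl) ×ˢ Fintype.piFinset fun _ : ι => Finset.range t) Idx.emb
      (by
        intro x hx
        rw [Finset.mem_coe, Finset.mem_product, Fintype.mem_piFinset]
        refine ⟨Finset.mem_univ _, fun τ => Finset.mem_range.2 ?_⟩
        exact lt_of_le_of_lt (Finset.single_le_sum (f := fun τ => x.emb.2 τ)
          (fun _ _ => Nat.zero_le _) (Finset.mem_univ τ)) (Finset.mem_filter.1 hx).2)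
      Idx.emb_injective.injOn
    simpa using this
  calc t * (S.card - Fintype.card Cl * t ^ Fintype.card ι)
      ≤ t * (S.filter fun x => ¬ ∑ τ, x.emb.2 τ < t).card := by
        refine Nat.mul_le_mul_left _ ?_
        have := Finset.card_filter_add_card_filter_not (s := S) fun x => ∑ τ, x.emb.2 τ < t
        omega
    _ = ∑ x ∈ S.filter (fun x => ¬ ∑ τ, x.emb.2 τ < t), t := by
        rw [Finset.sum_const, smul_eq_mul, mul_comm]
    _ ≤ ∑ x ∈ S.filter (fun x => ¬ ∑ τ, x.emb.2 τ < t), ∑ τ, x.emb.2 τ :=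
        Finset.sum_le_sum fun x hx => not_lt.1 (Finset.mem_filter.1 hx).2
    _ ≤ _ := Finset.sum_le_sum_of_subset (Finset.filter_subset _ _)

theorem HeckeData.pow_dvd_coeff_charpolyRev_fin [Fintype ι] [DecidableEq ι] [Fintype Cl]
    [DecidableEq Cl] [Fintype Co] (H : HeckeData ι Cl Co O) (p : ℕ) (m v : ι → ℕ)
    (N t : ℕ) : (p : O) ^ (t * (N - Fintype.card Cl * t ^ Fintype.card ι)) ∣
      (H.fin p m v).charpolyRev.coeff N := by
  classical
  refine pow_dvd_coeff_charpolyRev _ _ (fun x => ∑ τ, x.emb.2 τ)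
    (fun x y => H.pow_dvd_matrix p m v x.emb y.emb) N _ ?_
  rintro S rfl
  exact Idx.le_sum_degree S t

/-- The same Hecke data over another ring. -/
def HeckeData.map (H : HeckeData ι Cl Co O) {O' : Type*} [CommRing O'] (φ : O →+* O') :
    HeckeData ι Cl Co O' where
  next := H.next
  a i c τ := φ (H.a i c τ)
  b i c τ := φ (H.b i c τ)
  c i c τ := φ (H.c i c τ)
  e i c τ := φ (H.e i c τ)
  u i c τ := φ (H.u i c τ)

theorem substPoly_map {O' : Type*} [CommRing O'] (φ : O →+* O') (p : ℕ) (a b c e : O) (m j : ℕ) :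
    (substPoly p a b c e m j).map φ = substPoly p (φ a) (φ b) (φ c) (φ e) m j := by
  simp [substPoly]

theorem HeckeData.fin_map [Fintype ι] [DecidableEq Cl] [Fintype Co]
    (H : HeckeData ι Cl Co O) {O' : Type*} [CommRing O'] (φ : O →+* O')
    (p : ℕ) (m v : ι → ℕ) : (H.map φ).fin p m v = ((H.fin p m v).map φ) := by
  ext x y
  simp only [fin, submatrix_apply, matrix, Matrix.map_apply, map_sum, apply_ite φ, map_zero,
    map_prod, map_mul, map_pow, ← coeff_map, substPoly_map]
  rfl

end Family

/-! ### Local constancy of the number of eigenvalues of a given slope -/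

section LocalConstancy

open Polynomial Matrix

theorem recipPoly_roots_charpoly {K : Type*} [NormedField K] [IsAlgClosed K] {n : Type*}
    [Fintype n] [DecidableEq n] (M : Matrix n n K) :
    recipPoly M.charpoly.roots = M.charpolyRev := by
  rw [← reverse_prod_X_sub_C, ← reverse_charpoly]
  congr 1
  exact ((IsAlgClosed.splits M.charpoly).eq_prod_roots_of_monic M.charpoly_monic).symm

variable {p : ℕ} [Fact p.Prime] {ι Cl Co O : Type*} [CommRing O] [Fintype ι] [DecidableEq ι]
  [Fintype Cl] [DecidableEq Cl] [Fintype Co]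

theorem norm_map_le_of_pow_dvd (φ : O →+* PadicAlgCl p) (hφ : ∀ x, ‖φ x‖ ≤ 1) {N : ℕ} {x : O}
    (h : (p : O) ^ N ∣ x) : ‖φ x‖ ≤ ((p : ℝ) ^ N)⁻¹ := by
  obtain ⟨y, rfl⟩ := h
  have hp : ‖(p : PadicAlgCl p)‖ = (p : ℝ)⁻¹ := by
    have := PadicAlgCl.norm_extends p (p : ℚ_[p])
    rwa [map_natCast, Padic.norm_p] at this
  rw [map_mul, map_pow, map_natCast, norm_mul, norm_pow, hp, inv_pow]
  exact mul_le_of_le_one_right (by positivity) (hφ y)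

/-- The operators in question have no eigenvalues of negative slope. -/
theorem HeckeData.countP_eq_zero_of_neg (H : HeckeData ι Cl Co O) (φ : O →+* PadicAlgCl p)
    (hφ : ∀ x, ‖φ x‖ ≤ 1) (m v : ι → ℕ) {α : ℝ} (hα : α < 0) :
    ((((H.fin p m v).map φ).charpoly.roots).countP fun z => ‖z‖ * (p : ℝ) ^ α = 1) = 0 := by
  have hp : (1 : ℝ) < p := by exact_mod_cast (Fact.out : p.Prime).one_lt
  have hr : (0 : ℝ) < (p : ℝ) ^ α := Real.rpow_pos_of_pos (by linarith) _
  rw [countP_norm_eq_of_coeff _ 0 hr, Multiset.countP_zero]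
  rintro (_ | k) hk
  · rw [recipPoly_roots_charpoly, coeff_zero_eq_eval_zero, eval_charpolyRev]
    simp [recipPoly]
  · have h0 : (recipPoly (0 : Multiset (PadicAlgCl p))).coeff (k + 1) = 0 := by
      simp [recipPoly, coeff_one]
    rw [recipPoly_roots_charpoly, charpolyRev_map, coeff_map, h0, norm_zero, zero_mul] at hk
    exfalso
    have h1 : ((p : ℝ) ^ α) ^ (k + 1) < 1 :=
      pow_lt_one₀ hr.le (Real.rpow_lt_one_of_one_lt_of_neg hp hα) (by omega)
    have h2 := hφ ((H.fin p m v).charpolyRev.coeff (k + 1))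
    rcases hk with hk | hk
    · nlinarith [pow_pos hr (k + 1), norm_nonneg (φ ((H.fin p m v).charpolyRev.coeff (k + 1)))]
    · linarith

/-- **Local constancy**: `n - 1 > 2 h α (2 α + 1) ^ d` suffices in order that the number of
eigenvalues of slope `α` depend only on the weight modulo `p ^ n`. -/
theorem HeckeData.countP_eq (H : HeckeData ι Cl Co O) (φ : O →+* PadicAlgCl p)
    (hφ : ∀ x, ‖φ x‖ ≤ 1) (he : ∀ i c τ, (p : O) ∣ H.e i c τ - 1)
    (hu : ∀ i c τ, (p : O) ∣ H.u i c τ - 1) (N : ℕ) (m v m' v' : ι → ℕ)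
    (hm : ∀ τ, N ≤ m τ + 1) (hm' : ∀ τ, N ≤ m' τ + 1) (hmm : ∀ τ, m τ ≡ m' τ [MOD p ^ N])
    (hvv : ∀ τ, v τ ≡ v' τ [MOD p ^ N]) {α : ℝ} (hα : 0 ≤ α)
    (hN : 2 * Fintype.card Cl * α * (2 * α + 1) ^ Fintype.card ι < N) :
    ((((H.fin p m v).map φ).charpoly.roots).countP fun z => ‖z‖ * (p : ℝ) ^ α = 1) =
    ((((H.fin p m' v').map φ).charpoly.roots).countP fun z => ‖z‖ * (p : ℝ) ^ α = 1) := by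
  have hp : (1 : ℝ) < p := by exact_mod_cast (Fact.out : p.Prime).one_lt
  have hp0 : (0 : ℝ) < p := by linarith
  have hr : (0 : ℝ) < (p : ℝ) ^ α := Real.rpow_pos_of_pos hp0 _
  have hpow : ∀ k : ℕ, ((p : ℝ) ^ α) ^ k = (p : ℝ) ^ (α * k) := fun k => by
    rw [Real.rpow_mul hp0.le, Real.rpow_natCast]
  have hle : ∀ (k M : ℕ), α * k < M → ∀ x : O, (p : O) ^ M ∣ x → ‖φ x‖ * ((p : ℝ) ^ α) ^ k < 1 := by
    intro k M hk x hx
    rw [hpow]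
    calc ‖φ x‖ * (p : ℝ) ^ (α * k) ≤ ((p : ℝ) ^ M)⁻¹ * (p : ℝ) ^ (α * k) :=
          mul_le_mul_of_nonneg_right (norm_map_le_of_pow_dvd φ hφ hx) (by positivity)
      _ < ((p : ℝ) ^ M)⁻¹ * (p : ℝ) ^ (M : ℝ) := by
          refine mul_lt_mul_of_pos_left ?_ (by positivity)
          exact Real.rpow_lt_rpow_of_exponent_lt hp hk
      _ = 1 := by
          rw [Real.rpow_natCast]
          exact inv_mul_cancel₀ (by positivity)
  refine countP_norm_eq_of_coeff _ _ hr fun k hk => ?_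
  rw [recipPoly_roots_charpoly, recipPoly_roots_charpoly, charpolyRev_map, charpolyRev_map,
    coeff_map, coeff_map] at *
  set x := (H.fin p m v).charpolyRev.coeff k with hx
  set y := (H.fin p m' v').charpolyRev.coeff k with hy
  by_cases hkN : α * k < N
  · -- the two coefficients are congruent modulo `p ^ N`
    have hxy : (p : O) ^ N ∣ x - y := by
      rw [← Ideal.mem_span_singleton, ← Ideal.Quotient.eq]
      set π := Ideal.Quotient.mk (Ideal.span {(p : O) ^ N}) with hπ
      have h0 : ((p : ℕ) : O ⧸ Ideal.span {(p : O) ^ N}) ^ N = 0 := by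
        rw [← map_natCast π, ← map_pow, hπ, Ideal.Quotient.eq_zero_iff_mem]
        exact Ideal.mem_span_singleton_self _
      have hdvd : ∀ z : O, (p : O) ∣ z - 1 →
          ((p : ℕ) : O ⧸ Ideal.span {(p : O) ^ N}) ∣ π z - 1 := by
        intro z hz
        have := map_dvd π hz
        rwa [map_natCast, map_sub, map_one] at this
      have := (H.map π).charpolyRev_fin_eq p N h0 (fun i c τ => hdvd _ (he i c τ))
        (fun i c τ => hdvd _ (hu i c τ)) m v m' v' hm hm' hmm hvv
      rw [HeckeData.fin_map, HeckeData.fin_map, charpolyRev_map, charpolyRev_map] at this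
      have := congrArg (fun P => P.coeff k) this
      simpa only [coeff_map] using this
    have hlt := hle k N hkN _ hxy
    have hpk : 0 < ((p : ℝ) ^ α) ^ k := pow_pos hr k
    rw [map_sub] at hlt
    by_contra hne
    have h2 := IsUltrametricDist.norm_add_eq_max_of_norm_ne_norm
      (x := φ x) (y := -φ y) (by rwa [norm_neg])
    rw [← sub_eq_add_neg, norm_neg] at h2
    rw [h2, max_mul_of_nonneg _ _ hpk.le, max_lt_iff] at hlt
    rcases hk with hk | hk <;> linarith [hlt.1, hlt.2]
  · -- both coefficients are too small to matter
    exfalso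
    have hα0 : 0 < α := by
      refine lt_of_le_of_ne hα fun h => hkN ?_
      rw [← h] at hN ⊢
      simpa using hN
    set t : ℕ := ⌊2 * α⌋₊ + 1 with ht
    have ht1 : 2 * α ≤ t := by rw [ht]; push_cast; exact (Nat.lt_floor_add_one _).le
    have ht2 : (t : ℝ) ≤ 2 * α + 1 := by
      rw [ht]
      push_cast
      linarith [Nat.floor_le (by positivity : 0 ≤ 2 * α)]
    have hk2 : 2 * ((Fintype.card Cl * t ^ Fintype.card ι : ℕ) : ℝ) < k := by
      push_cast
      have h1 : α * (2 * Fintype.card Cl * (2 * α + 1) ^ Fintype.card ι) < α * k := by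
        linarith [not_lt.1 hkN]
      have h2 := lt_of_mul_lt_mul_left h1 hα
      have h3 : (t : ℝ) ^ Fintype.card ι ≤ (2 * α + 1) ^ Fintype.card ι :=
        pow_le_pow_left₀ (by positivity) ht2 _
      nlinarith [(by positivity : (0 : ℝ) ≤ 2 * Fintype.card Cl)]
    have hlt : α * k < (t * (k - Fintype.card Cl * t ^ Fintype.card ι) : ℕ) := by
      have h1 : Fintype.card Cl * t ^ Fintype.card ι ≤ k := by
        have : ((Fintype.card Cl * t ^ Fintype.card ι : ℕ) : ℝ) ≤ k :=
          le_trans (by linarith [Nat.cast_nonneg (α := ℝ) (Fintype.card Cl * t ^ Fintype.card ι)])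
            hk2.le
        exact_mod_cast this
      rw [Nat.cast_mul, Nat.cast_sub h1]
      have ht0 : (0 : ℝ) < t := by linarith
      have h4 := mul_lt_mul_of_pos_left hk2 ht0
      have h5 := mul_le_mul_of_nonneg_right ht1 (Nat.cast_nonneg (α := ℝ) k)
      linarith
    rcases hk with hk | hk
    · exact absurd hk (not_le.2 (hle k _ hlt _ (H.pow_dvd_coeff_charpolyRev_fin p m v k t)))
    · exact absurd hk (not_le.2 (hle k _ hlt _ (H.pow_dvd_coeff_charpolyRev_fin p m' v' k t)))

end LocalConstancy

/-! ### Matrices of the weight modules -/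

section WeightBasis

variable {R : Type*} [CommRing R]

/-- The exponent of the monomial `x ^ i y ^ (a - i)`. -/
def monExp (a i : ℕ) : Fin 2 →₀ ℕ := Finsupp.single 0 i + Finsupp.single 1 (a - i)

theorem monExp_zero (a i : ℕ) : monExp a i 0 = i := by simp [monExp]

theorem monExp_one (a i : ℕ) : monExp a i 1 = a - i := by simp [monExp]

theorem eq_monExp {a : ℕ} {e : Fin 2 →₀ ℕ} (h : e.degree = a) : e = monExp a (e 0) := by
  rw [Finsupp.degree_eq_sum, Fin.sum_univ_two] at h
  ext i
  fin_cases i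
  · simp [monExp_zero]
  · simp [monExp_one]
    omega

theorem degree_monExp {a i : ℕ} (h : i ≤ a) : (monExp a i).degree = a := by
  rw [Finsupp.degree_eq_sum, Fin.sum_univ_two, monExp_zero, monExp_one]
  omega

/-- The binary form `x ^ i y ^ (a - i)`. -/
def symMon (R : Type*) [CommRing R] (a : ℕ) (i : Fin (a + 1)) : Sym R a :=
  ⟨MvPolynomial.monomial (monExp a i) 1, (MvPolynomial.mem_homogeneousSubmodule _ _).2
    (MvPolynomial.isHomogeneous_monomial _ (degree_monExp (Nat.lt_succ_iff.1 i.2)))⟩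

theorem coeff_sum_symMon (a : ℕ) (c : Fin (a + 1) → R) (e : Fin 2 →₀ ℕ) :
    (∑ i, c i • symMon R a i : Sym R a).1.coeff e =
      ∑ i : Fin (a + 1), if monExp a i = e then c i else 0 := by
  classical
  simp [symMon, MvPolynomial.coeff_sum, MvPolynomial.coeff_monomial]

/-- The basis `x ^ i y ^ (a - i)` of the binary forms of degree `a`. -/
def symBasis (R : Type*) [CommRing R] (a : ℕ) : Module.Basis (Fin (a + 1)) R (Sym R a) :=
  Module.Basis.ofEquivFun
    { toFun f i := f.1.coeff (monExp a i)
      map_add' f g := by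
        ext i
        simp
      map_smul' c f := by
        ext i
        simp
      invFun c := ∑ i, c i • symMon R a i
      left_inv f := by
        refine Subtype.ext (MvPolynomial.ext _ _ fun e => ?_)
        refine (coeff_sum_symMon a _ e).trans ?_
        by_cases he : e.degree = a
        · have h0 : e 0 < a + 1 := by
            rw [Finsupp.degree_eq_sum, Fin.sum_univ_two] at he
            omega
          rw [Finset.sum_eq_single (⟨e 0, h0⟩ : Fin (a + 1))]
          · rw [if_pos (eq_monExp he).symm]
            exact congrArg _ (eq_monExp he).symm
          · intro i _ hi
            rw [if_neg]
            rintro rfl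
            exact hi (Fin.ext (monExp_zero a i).symm)
          · simp
        · have h1 : f.1.coeff e = 0 :=
            MvPolynomial.IsHomogeneous.coeff_eq_zero
              ((MvPolynomial.mem_homogeneousSubmodule _ _).1 f.2) he
          rw [h1]
          refine Finset.sum_eq_zero fun i _ => if_neg ?_
          rintro rfl
          exact he (degree_monExp (Nat.lt_succ_iff.1 i.2))
      right_inv c := by
        funext i
        refine (coeff_sum_symMon a _ _).trans ?_
        rw [Finset.sum_eq_single i]
        · simp
        · intro j _ hj
          rw [if_neg]
          intro h
          exact hj (Fin.ext (by rw [← monExp_zero a j, h, monExp_zero]))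
        · simp }

theorem symBasis_repr (a : ℕ) (f : Sym R a) (i : Fin (a + 1)) :
    (symBasis R a).repr f i = f.1.coeff (monExp a i) := rfl

theorem symBasis_apply (a : ℕ) (j : Fin (a + 1)) :
    ((symBasis R a j : Sym R a) : MvPolynomial (Fin 2) R) =
      MvPolynomial.X 0 ^ (j : ℕ) * MvPolynomial.X 1 ^ (a - j) := by
  classical
  have h : symBasis R a j = symMon R a j := by
    rw [symBasis, Module.Basis.coe_ofEquivFun]
    change ∑ i, (Pi.single j (1 : R) : Fin (a + 1) → R) i • symMon R a i = _
    simp [Pi.single_apply]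
  rw [h]
  change MvPolynomial.monomial (Finsupp.single 0 (j : ℕ) + Finsupp.single 1 (a - (j : ℕ))) 1 = _
  rw [MvPolynomial.X_pow_eq_monomial, MvPolynomial.X_pow_eq_monomial,
    MvPolynomial.monomial_mul, one_mul]

/-- Dehomogenization `y = 1`. -/
def dehom : MvPolynomial (Fin 2) R →ₐ[R] Polynomial R :=
  MvPolynomial.aeval ![Polynomial.X, 1]

theorem coeff_dehom (a : ℕ) (f : Sym R a) (i : Fin (a + 1)) :
    (dehom f.1).coeff i = f.1.coeff (monExp a i) := by
  conv_lhs => rw [← (symBasis R a).sum_repr f]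
  simp only [Submodule.coe_sum, Submodule.coe_smul, map_sum, map_smul, symBasis_apply, map_mul,
    map_pow, dehom, MvPolynomial.aeval_X, Matrix.cons_val_zero, Matrix.cons_val_one, one_pow,
    mul_one, Polynomial.finsetSum_coeff, Polynomial.coeff_smul, Polynomial.coeff_X_pow,
    smul_eq_mul, mul_ite, mul_zero]
  rw [Finset.sum_eq_single i]
  · simp [symBasis_repr]
  · intro j _ hj
    rw [if_neg]
    exact fun h => hj (Fin.ext h.symm)
  · simp

open Polynomial in
theorem symBasis_repr_symAct (a b : ℕ) (A : Matrix (Fin 2) (Fin 2) R) (i j : Fin (a + 1)) :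
    (symBasis R a).repr (symAct a b A (symBasis R a j)) i = A.det ^ b *
      ((C (A 0 0) * X + C (A 1 0)) ^ (j : ℕ) * (C (A 0 1) * X + C (A 1 1)) ^ (a - j)).coeff i := by
  rw [symBasis_repr, ← coeff_dehom]
  have h : ((symAct a b A (symBasis R a j) : Sym R a) : MvPolynomial (Fin 2) R) =
      A.det ^ b • subst A (symBasis R a j : Sym R a).1 := rfl
  rw [h, map_smul, Polynomial.coeff_smul, smul_eq_mul, symBasis_apply]
  congr 2
  simp only [map_mul, map_pow, subst_X, Fin.sum_univ_two, map_add, dehom, MvPolynomial.aeval_X,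
    MvPolynomial.algHom_C, Matrix.cons_val_zero, Matrix.cons_val_one, mul_one]
  rfl

variable {ι : Type*} [Fintype ι] {O : Type*} [CommRing O]

/-- The monomial basis of `L_k(R)`. -/
def weightBasis (R : Type*) [CommRing R] (m : ι → ℕ) :
    Module.Basis ((τ : ι) → Fin (m τ + 1)) R (WeightModule R m) :=
  Basis.piTensorProduct fun τ => symBasis R (m τ)

theorem weightBasis_repr_weightAct (σ : ι → O →+* R) (m v : ι → ℕ)
    (A : Matrix (Fin 2) (Fin 2) O) (i j : (τ : ι) → Fin (m τ + 1)) :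
    (weightBasis R m).repr (weightAct σ m v A (weightBasis R m j)) i =
      ∏ τ, (symBasis R (m τ)).repr
        (symAct (m τ) (v τ) ((σ τ).mapMatrix A) (symBasis R (m τ) (j τ))) (i τ) := by
  rw [weightBasis, Basis.piTensorProduct_apply]
  change (Basis.piTensorProduct fun τ => symBasis R (m τ)).repr
    (PiTensorProduct.map _ (PiTensorProduct.tprod R _)) i = _
  rw [PiTensorProduct.map_tprod, Basis.piTensorProduct_repr_tprod_apply]

theorem toMatrix_sum_comp {L κ Cl Co : Type*} [AddCommMonoid L] [Module R L] [Fintype κ]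
    [DecidableEq κ] [Fintype Cl] [DecidableEq Cl] [Fintype Co] (b : Module.Basis κ R L)
    (next : Cl → Co → Cl) (g : Cl → Co → Module.End R L) (T : Module.End R (Cl → L))
    (hT : ∀ f i, T f i = ∑ c, g i c (f (next i c))) (x y : Cl × κ) :
    LinearMap.toMatrix ((Pi.basis fun _ : Cl => b).reindex (Equiv.sigmaEquivProd Cl κ))
      ((Pi.basis fun _ : Cl => b).reindex (Equiv.sigmaEquivProd Cl κ)) T x y =
      ∑ c, if next x.1 c = y.1 then b.repr (g x.1 c (b y.2)) x.2 else 0 := by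
  obtain ⟨i, k⟩ := x
  obtain ⟨i', k'⟩ := y
  rw [LinearMap.toMatrix_apply]
  simp only [Module.Basis.reindex_apply, Module.Basis.repr_reindex_apply,
    Equiv.sigmaEquivProd_symm_apply, Pi.basis_repr, Pi.basis_apply, hT, map_sum,
    Finsupp.coe_finsetSum, Finset.sum_apply]
  refine Finset.sum_congr rfl fun c _ => ?_
  by_cases h : next i c = i'
  · subst h
    simp
  · simp [h]

theorem charpoly_eq_of_diagonal_conj {K n : Type*} [Field K] [Fintype n] [DecidableEq n]
    (M N : Matrix n n K) (d : n → K) (hd : ∀ i, d i ≠ 0)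
    (h : ∀ i j, N i j = d i * M i j * (d j)⁻¹) : N.charpoly = M.charpoly := by
  let u : (Matrix n n K)ˣ :=
    ⟨Matrix.diagonal d, Matrix.diagonal fun i => (d i)⁻¹, by simp [hd], by simp [hd]⟩
  have : N = u.1 * M * (u⁻¹ : (Matrix n n K)ˣ).1 := by
    ext i j
    simp [u, h]
  rw [this]
  exact (congrArg Matrix.charpoly (by rw [Matrix.coe_units_inv])).trans
    (Matrix.charpoly_units_conj u M)

end WeightBasis

/-! ### The number of eigenvalues of a given slope in terms of matrices -/

section SlopeMatrix

variable {p : ℕ} [Fact p.Prime]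

/-- The ring of integers of `ℚ̄_p`. -/
abbrev clInt (p : ℕ) [Fact p.Prime] : Subring (PadicAlgCl p) :=
  (PadicAlgCl.valued p).v.integer

theorem mem_clInt {x : PadicAlgCl p} : x ∈ clInt p ↔ ‖x‖ ≤ 1 := Iff.rfl

variable {F : Type*} [Field F] [NumberField F] {w : HeightOneSpectrum (𝓞 F)}

theorem exists_valued_le_subset_of_mem_nhds_zero {F : Type*} [Field F] [NumberField F]
    {w : HeightOneSpectrum (𝓞 F)} {s : Set (w.adicCompletion F)} (hs : s ∈ nhds 0) :
    ∃ g : w.adicCompletion F, g ≠ 0 ∧ ∀ x, Valued.v x ≤ Valued.v g → x ∈ s := by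
  obtain ⟨γ, hγ⟩ := (Valued.mem_nhds_zero).1 hs
  obtain ⟨r, t, hr, ht, hrt⟩ := Valued.v.exists_div_eq_of_unit γ
  obtain ⟨π, hπ⟩ := w.valuedAdicCompletion_surjective F (WithZero.exp (-1))
  have hr0 := (Valuation.ne_zero_iff _).1 hr.ne'
  have ht0 := (Valuation.ne_zero_iff _).1 ht.ne'
  have hπ0 : π ≠ 0 := by
    rw [← Valuation.ne_zero_iff Valued.v, hπ]
    exact WithZero.exp_ne_zero
  have hπ1 : Valued.v π < 1 := by
    rw [hπ, ← WithZero.exp_zero]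
    exact WithZero.exp_lt_exp.2 (by norm_num)
  refine ⟨π * (r / t), mul_ne_zero hπ0 (div_ne_zero hr0 ht0), fun x hx => hγ ?_⟩
  change Valued.v.restrict x < γ.1
  rw [← hrt, ← map_div₀, Valuation.restrict_lt_iff]
  refine lt_of_le_of_lt hx ?_
  rw [map_mul]
  have : 0 < Valued.v (r / t) := by
    rw [zero_lt_iff, Valuation.ne_zero_iff]
    exact div_ne_zero hr0 ht0
  exact mul_lt_of_lt_one_left this hπ1

theorem Emb.norm_le_one (τ : Emb p w) (x : w.adicCompletionIntegers F) : ‖τ.1 x‖ ≤ 1 := by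
  have h1 : {y : w.adicCompletion F | ‖τ.1 y‖ < 1} ∈ nhds (0 : w.adicCompletion F) := by
    have := (continuous_norm.comp τ.2).continuousAt (x := 0)
    exact this (Iio_mem_nhds (by simp))
  obtain ⟨g, hg0, hg⟩ := exists_valued_le_subset_of_mem_nhds_zero h1
  by_contra! hx
  have hτg : 0 < ‖τ.1 g‖ := norm_pos_iff.2 (by simpa using hg0)
  obtain ⟨n, hn⟩ := pow_unbounded_of_one_lt (‖τ.1 g‖⁻¹) hx
  have h2 : ‖τ.1 (g * (x : w.adicCompletion F) ^ n)‖ < 1 := by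
    refine hg _ ?_
    rw [map_mul, map_pow]
    exact mul_le_of_le_one_right' (pow_le_one' x.2 n)
  rw [map_mul, map_pow, norm_mul, norm_pow] at h2
  rw [inv_lt_iff_one_lt_mul₀ hτg] at hn
  linarith

/-- The restriction of an embedding of `F_p` to the rings of integers. -/
def Emb.toInt (τ : Emb p w) : w.adicCompletionIntegers F →+* clInt p :=
  (τ.1.comp (w.adicCompletionIntegers F).subtype).codRestrict (clInt p)
    fun x => mem_clInt.2 (τ.norm_le_one x)

/-- An explicit form of `T_p`: the data of the matrices `(p a, b; p c, e) ∈ M₂(O_{F,p})` of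
determinant `p u` which describe `T_p` on the functions on a set `Cl` of representatives, and a
function `t` through which the norm of `u` is a coboundary. -/
structure LocalHecke (p : ℕ) [Fact p.Prime] {F : Type*} [Field F] [NumberField F]
    (w : HeightOneSpectrum (𝓞 F)) (Cl Co : Type*) where
  next : Cl → Co → Cl
  a : Cl → Co → w.adicCompletionIntegers F
  b : Cl → Co → w.adicCompletionIntegers F
  c : Cl → Co → w.adicCompletionIntegers F
  e : Cl → Co → w.adicCompletionIntegers F
  u : Cl → Co → w.adicCompletionIntegers F
  t : Cl → PadicAlgCl p
  t_ne_zero : ∀ i, t i ≠ 0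
  e_cong : ∀ i j, (p : w.adicCompletionIntegers F) ∣ e i j - 1
  u_cong : ∀ i j, (p : w.adicCompletionIntegers F) ∣ u i j - 1
  det_eq : ∀ i j, p * a i j * e i j - b i j * (p * c i j) = p * u i j
  twist : ∀ i j, ∏ τ : Emb p w, τ.1 (u i j) = t (next i j) * (t i)⁻¹

variable {Cl Co : Type*}

/-- The matrix `(p a, b; p c, e)`. -/
def LocalHecke.mat (X : LocalHecke p w Cl Co) (i : Cl) (j : Co) :
    Matrix (Fin 2) (Fin 2) (w.adicCompletionIntegers F) :=
  !![p * X.a i j, X.b i j; p * X.c i j, X.e i j]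

/-- The images of the matrices under all embeddings. -/
def LocalHecke.data (X : LocalHecke p w Cl Co) : HeckeData (Emb p w) Cl Co (clInt p) where
  next := X.next
  a i j τ := τ.toInt (X.a i j)
  b i j τ := τ.toInt (X.b i j)
  c i j τ := τ.toInt (X.c i j)
  e i j τ := τ.toInt (X.e i j)
  u i j τ := τ.toInt (X.u i j)

open Polynomial in
theorem pow_mul_coeff_substPoly {K : Type*} [CommRing K] (p : ℕ) (a b c e : K) (m i j : ℕ) :
    (p : K) ^ j * (substPoly p a b c e m j).coeff i = (p : K) ^ i *
      ((C ((p : K) * a) * X + C ((p : K) * c)) ^ j * (C b * X + C e) ^ (m - j)).coeff i := by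
  have h1 : substPoly p a b c e m j =
      ((C a * X + C c) ^ j * (C b * X + C e) ^ (m - j)).comp (C (p : K) * X) := by
    simp only [substPoly, mul_comp, pow_comp, add_comp, C_comp, X_comp, C_mul]
    ring
  have h2 : (C ((p : K) * a) * X + C ((p : K) * c)) ^ j * (C b * X + C e) ^ (m - j) =
      C ((p : K) ^ j) * ((C a * X + C c) ^ j * (C b * X + C e) ^ (m - j)) := by
    have : C ((p : K) * a) * X + C ((p : K) * c) = C (p : K) * (C a * X + C c) := by
      simp only [C_mul]
      ring
    rw [this, mul_pow, C_pow, mul_assoc]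
  rw [h1, h2, comp_C_mul_X_coeff, coeff_C_mul]
  ring

/-- The slopes of (a scalar multiple of) an operator `f ↦ (i ↦ ∑ c, g(i,c) f(next i c))`. -/
theorem slopeCount_smul_baseChange {R : Type*} [CommRing R] [Algebra R (PadicAlgCl p)]
    {V L κ : Type*} [AddCommMonoid V] [Module R V] [AddCommMonoid L] [Module R L] [Fintype κ]
    [DecidableEq κ] [Fintype Cl] [DecidableEq Cl] [Fintype Co] (b : Module.Basis κ R L)
    (T : Module.End R V) (E : V ≃ₗ[R] (Cl → L)) (next : Cl → Co → Cl)
    (g : Cl → Co → Module.End R L) (hE : ∀ f i, E (T f) i = ∑ c, g i c (E f (next i c)))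
    (s : PadicAlgCl p) (N : Matrix (Cl × κ) (Cl × κ) (PadicAlgCl p)) (d : Cl × κ → PadicAlgCl p)
    (hd : ∀ x, d x ≠ 0)
    (hN : ∀ x y, N x y = ∑ c, if next x.1 c = y.1 then
      d x * (s * algebraMap R (PadicAlgCl p) (b.repr (g x.1 c (b y.2)) x.2)) * (d y)⁻¹ else 0)
    (α : ℝ) :
    slopeCount p (s • T.baseChange (PadicAlgCl p)) α =
      N.charpoly.roots.countP fun z => ‖z‖ * (p : ℝ) ^ α = 1 := by
  classical
  let B₀ := (Pi.basis fun _ : Cl => b).reindex (Equiv.sigmaEquivProd Cl κ)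
  let B := B₀.map E.symm
  let BK := Algebra.TensorProduct.basis (PadicAlgCl p) B
  have hfin : FiniteDimensional (PadicAlgCl p) (PadicAlgCl p ⊗[R] V) :=
    BK.finiteDimensional_of_finite
  rw [slopeCount_eq_countP, ← LinearMap.charpoly_toMatrix _ BK]
  congr 2
  symm
  refine charpoly_eq_of_diagonal_conj _ _ d hd ?_
  intro x y
  have hT : LinearMap.toMatrix B B T =
      LinearMap.toMatrix B₀ B₀ (E.toLinearMap ∘ₗ T ∘ₗ E.symm.toLinearMap) := by
    ext i j
    simp [B, LinearMap.toMatrix_apply]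
  have hM := toMatrix_sum_comp b next g (E.toLinearMap ∘ₗ T ∘ₗ E.symm.toLinearMap)
    (fun f i => by simp [hE]) x y
  rw [hN, map_smul, LinearMap.toMatrix_baseChange, hT, Matrix.smul_apply, Matrix.map_apply,
    hM, map_sum, smul_eq_mul, Finset.mul_sum, Finset.mul_sum, Finset.sum_mul]
  refine Finset.sum_congr rfl fun c _ => ?_
  split_ifs <;> simp

/-- Comparison of the entries of the matrix of `ξ` with respect to the monomial basis with those
of `HeckeData.fin`. -/
theorem LocalHecke.entry_eq (X : LocalHecke p w Cl Co) {R : Type*} [CommRing R]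
    [Algebra R (PadicAlgCl p)] (σ : Emb p w → w.adicCompletionIntegers F →+* R)
    (hσ : ∀ τ x, algebraMap R (PadicAlgCl p) (σ τ x) = τ.1 x) (m v : Emb p w → ℕ) (n : ℕ)
    (i : Cl) (j : Co) (x y : (τ : Emb p w) → Fin (m τ + 1)) :
    (clInt p).subtype (∏ τ, X.data.u i j τ ^ (v τ + n) * (substPoly p (X.data.a i j τ)
      (X.data.b i j τ) (X.data.c i j τ) (X.data.e i j τ) (m τ) (y τ)).coeff (x τ)) =
    (p : PadicAlgCl p) ^ (∑ τ, (x τ : ℕ)) * (X.t i ^ n)⁻¹ *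
      (((p : PadicAlgCl p) ^ ∑ τ, v τ)⁻¹ * algebraMap R (PadicAlgCl p)
        ((weightBasis R m).repr (weightAct σ m v (X.mat i j) (weightBasis R m y)) x)) *
      ((p : PadicAlgCl p) ^ (∑ τ, (y τ : ℕ)) * (X.t (X.next i j) ^ n)⁻¹)⁻¹ := by
  have hp0 : (p : PadicAlgCl p) ≠ 0 := by exact_mod_cast (Fact.out : p.Prime).ne_zero
  have hdet : ∀ τ : Emb p w, algebraMap R (PadicAlgCl p) ((σ τ).mapMatrix (X.mat i j)).det =
      p * τ.1 (X.u i j) := by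
    intro τ
    rw [← RingHom.map_det, hσ, Matrix.det_fin_two, LocalHecke.mat]
    simp only [Matrix.cons_val', Matrix.cons_val_zero, Matrix.cons_val_one, Matrix.of_apply,
      Matrix.cons_val_fin_one, X.det_eq]
    push_cast
    simp
  have hone : ∀ τ : Emb p w, algebraMap R (PadicAlgCl p) ((symBasis R (m τ)).repr
        (symAct (m τ) (v τ) ((σ τ).mapMatrix (X.mat i j)) (symBasis R (m τ) (y τ))) (x τ)) *
        p ^ (x τ : ℕ) * τ.1 (X.u i j) ^ n =
      p ^ (y τ : ℕ) * p ^ v τ * (clInt p).subtype (X.data.u i j τ ^ (v τ + n) *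
        (substPoly p (X.data.a i j τ) (X.data.b i j τ) (X.data.c i j τ) (X.data.e i j τ) (m τ)
          (y τ)).coeff (x τ)) := by
    intro τ
    rw [symBasis_repr_symAct, map_mul, map_pow, hdet, map_mul, ← Polynomial.coeff_map,
      ← Polynomial.coeff_map, substPoly_map, map_pow]
    have h := pow_mul_coeff_substPoly p (τ.1 (X.a i j)) (τ.1 (X.b i j)) (τ.1 (X.c i j))
      (τ.1 (X.e i j)) (m τ) (x τ) (y τ)
    have h2 : (clInt p).subtype (X.data.u i j τ) = τ.1 (X.u i j) := rfl
    have h3 : substPoly p ((clInt p).subtype (X.data.a i j τ))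
        ((clInt p).subtype (X.data.b i j τ)) ((clInt p).subtype (X.data.c i j τ))
        ((clInt p).subtype (X.data.e i j τ)) (m τ) (y τ) =
      substPoly p (τ.1 (X.a i j)) (τ.1 (X.b i j)) (τ.1 (X.c i j)) (τ.1 (X.e i j)) (m τ) (y τ) :=
      rfl
    have h4 : ∀ k l, algebraMap R (PadicAlgCl p) ((σ τ).mapMatrix (X.mat i j) k l) =
        τ.1 (X.mat i j k l) := fun k l => hσ τ _
    rw [h2, h3]
    simp only [Polynomial.map_mul, Polynomial.map_pow, Polynomial.map_add, Polynomial.map_C,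
      Polynomial.map_X, h4]
    have h5 : τ.1 (X.mat i j 0 0) = p * τ.1 (X.a i j) := by simp [LocalHecke.mat]
    have h6 : τ.1 (X.mat i j 1 0) = p * τ.1 (X.c i j) := by simp [LocalHecke.mat]
    have h7 : τ.1 (X.mat i j 0 1) = τ.1 (X.b i j) := rfl
    have h8 : τ.1 (X.mat i j 1 1) = τ.1 (X.e i j) := rfl
    rw [h5, h6, h7, h8, mul_pow, pow_add]
    linear_combination (-(p : PadicAlgCl p) ^ v τ * τ.1 (X.u i j) ^ v τ * τ.1 (X.u i j) ^ n) * h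
  have hprod := Finset.prod_congr (rfl : (Finset.univ : Finset (Emb p w)) = _)
    fun τ _ => hone τ
  rw [weightBasis_repr_weightAct, map_prod, map_prod]
  rw [Finset.prod_mul_distrib, Finset.prod_mul_distrib, Finset.prod_mul_distrib,
    Finset.prod_mul_distrib, Finset.prod_pow, Finset.prod_pow_eq_pow_sum,
    Finset.prod_pow_eq_pow_sum, Finset.prod_pow_eq_pow_sum, X.twist] at hprod
  have ht := X.t_ne_zero i
  have ht' := X.t_ne_zero (X.next i j)
  generalize (∏ τ : Emb p w, algebraMap R (PadicAlgCl p) _) = A at hprod ⊢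
  generalize (∏ τ : Emb p w, (clInt p).subtype _) = B at hprod ⊢
  rw [mul_pow, inv_pow] at hprod
  have ht2 := pow_ne_zero n ht
  have ht2' := pow_ne_zero n ht'
  have hx := pow_ne_zero (∑ τ, (x τ : ℕ)) hp0
  have hy := pow_ne_zero (∑ τ, (y τ : ℕ)) hp0
  have hv := pow_ne_zero (∑ τ, v τ) hp0
  field_simp at hprod ⊢
  linear_combination -hprod

/-- The eigenvalues of `ξ` are those of the matrix of `HeckeData.fin`, where the twist `v` may be
changed by a constant. -/
theorem slopeDim_eq_countP {D : Type*} [Ring D] [Algebra F D]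
    {θ : w.adicCompletion F ⊗[F] D ≃ₐ[w.adicCompletion F]
      Matrix (Fin 2) (Fin 2) (w.adicCompletion F)}
    (𝓤 : Level θ p) {R : Type*} [CommRing R] [Algebra R (PadicAlgCl p)]
    (σ : Emb p w → w.adicCompletionIntegers F →+* R)
    (hσ : ∀ τ x, algebraMap R (PadicAlgCl p) (σ τ x) = τ.1 x)
    [Fintype Cl] [DecidableEq Cl] [Fintype Co] [DecidableEq (Emb p w)]
    (X : LocalHecke p w Cl Co) (k v : Emb p w → ℕ)
    (E : Forms 𝓤 σ (fun τ => k τ - 2) v ≃ₗ[R] (Cl → WeightModule R fun τ => k τ - 2))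
    (hE : ∀ f i, E (Tp 𝓤 σ (fun τ => k τ - 2) v f) i =
      ∑ j, weightAct σ (fun τ => k τ - 2) v (X.mat i j) (E f (X.next i j)))
    (n : ℕ) (α : ℝ) :
    slopeDim 𝓤 σ k v α = (((X.data.fin p (fun τ => k τ - 2) fun τ => v τ + n).map
      (clInt p).subtype).charpoly.roots).countP fun z => ‖z‖ * (p : ℝ) ^ α = 1 := by
  have hp0 : (p : PadicAlgCl p) ≠ 0 := by exact_mod_cast (Fact.out : p.Prime).ne_zero
  rw [slopeDim]
  refine slopeCount_smul_baseChange (V := Forms 𝓤 σ (fun τ => k τ - 2) v)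
    (L := WeightModule R fun τ => k τ - 2) (weightBasis R fun τ => k τ - 2)
    (Tp 𝓤 σ (fun τ => k τ - 2) v) E X.next
    (fun i j => weightAct σ (fun τ => k τ - 2) v (X.mat i j)) hE _ _
    (fun x : Idx Cl fun τ => k τ - 2 => (p : PadicAlgCl p) ^ (∑ τ, (x.2 τ : ℕ)) *
      (X.t x.1 ^ n)⁻¹)
    (fun x => mul_ne_zero (pow_ne_zero _ hp0) (inv_ne_zero (pow_ne_zero _ (X.t_ne_zero _)))) ?_ α
  intro x y
  rw [Matrix.map_apply, HeckeData.fin, Matrix.submatrix_apply, HeckeData.matrix, map_sum]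
  refine Finset.sum_congr rfl fun j _ => ?_
  change (clInt p).subtype (if X.next x.1 j = y.1 then _ else 0) = _
  by_cases hj : X.next x.1 j = y.1
  swap
  · rw [if_neg hj, if_neg hj, map_zero]
  rw [if_pos hj, if_pos hj]
  refine (X.entry_eq σ hσ (fun τ => k τ - 2) v n x.1 j x.2 y.2).trans ?_
  rw [hj]

end SlopeMatrix

/-! ### Automorphic forms as functions on the class set -/

section ClassFunctions

variable {p : ℕ} [Fact p.Prime] {F : Type*} [Field F] [NumberField F]
  {D : Type*} [Ring D] [Algebra F D] {w : HeightOneSpectrum (𝓞 F)}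
  {θ : w.adicCompletion F ⊗[F] D ≃ₐ[w.adicCompletion F]
    Matrix (Fin 2) (Fin 2) (w.adicCompletion F)}

/-- The class of `x` in `Dˣ \ G_f / U`. -/
def cls (U : Subgroup (Gf F D)) (x : Gf F D) : ClassSet U := DoubleCoset.mk (diag F D).range U x

/-- The chosen representative of a class. -/
def clsOut {U : Subgroup (Gf F D)} (i : ClassSet U) : Gf F D := Quotient.out i

theorem cls_eq_of_eq_mul {U : Subgroup (Gf F D)} {x y : Gf F D} (δ : Dˣ) {u : Gf F D} (hu : u ∈ U)
    (h : y = diag F D δ * x * u) : cls U y = cls U x :=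
  ((DoubleCoset.eq (diag F D).range U x y).2 ⟨diag F D δ, ⟨δ, rfl⟩, u, hu, h⟩).symm

theorem cls_clsOut {U : Subgroup (Gf F D)} (i : ClassSet U) : cls U (clsOut i) = i :=
  DoubleCoset.out_eq' _ _ i

theorem exists_eq_diag_mul_clsOut_mul (U : Subgroup (Gf F D)) (x : Gf F D) :
    ∃ (δ : Dˣ) (u : Gf F D), u ∈ U ∧ x = diag F D δ * clsOut (cls U x) * u := by
  obtain ⟨_, ⟨δ, rfl⟩, u, hu, h⟩ := (DoubleCoset.eq _ _ _ _).1 (cls_clsOut (cls U x))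
  exact ⟨δ, u, hu, h⟩

variable (𝓤 : Level θ p) {R : Type*} [CommRing R]
  (σ : Emb p w → w.adicCompletionIntegers F →+* R) (m v : Emb p w → ℕ)

/-- The action of `u ∈ U` on `L_k(R)` through its component at `p`. -/
def levelAct {u : Gf F D} (hu : u ∈ 𝓤.U) : Module.End R (WeightModule R m) :=
  weightAct σ m v (pInt θ ⟨u, 𝓤.integral hu⟩)

theorem levelAct_congr {u u' : Gf F D} (hu : u ∈ 𝓤.U) (hu' : u' ∈ 𝓤.U) (h : u = u') :
    levelAct 𝓤 σ m v hu = levelAct 𝓤 σ m v hu' := by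
  subst h
  rfl

theorem levelAct_mul {u u' : Gf F D} (hu : u ∈ 𝓤.U) (hu' : u' ∈ 𝓤.U) :
    levelAct 𝓤 σ m v (mul_mem hu hu') = levelAct 𝓤 σ m v hu * levelAct 𝓤 σ m v hu' := by
  rw [levelAct, levelAct, levelAct, ← map_mul, ← map_mul]
  rfl

theorem levelAct_mul_inv {u : Gf F D} (hu : u ∈ 𝓤.U) :
    levelAct 𝓤 σ m v hu * levelAct 𝓤 σ m v (inv_mem hu) = 1 := by
  rw [levelAct, levelAct, ← map_mul, ← map_mul, ← map_one (weightAct σ m v), ← map_one (pInt θ)]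
  congr 2
  exact Subtype.ext (mul_inv_cancel u)

/-- If the groups `Γ` are trivial and global units act trivially on the weight module, then the
element `u⁻¹` in a decomposition `x = δ r u` acts on the weight module in a way which does not
depend on the decomposition. -/
theorem levelAct_inv_eq (hΓ : ∀ γ : Gf F D, Subsingleton (Gamma 𝓤.U γ))
    (htriv : ∀ (z : Fˣ) (hz : diag F D (Units.map (algebraMap F D).toMonoidHom z) ∈ 𝓤.U),
      levelAct 𝓤 σ m v hz = 1)
    {δ δ' : Dˣ} {r u u' : Gf F D} (hu : u ∈ 𝓤.U) (hu' : u' ∈ 𝓤.U)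
    (h : diag F D δ * r * u = diag F D δ' * r * u') :
    levelAct 𝓤 σ m v (inv_mem hu) = levelAct 𝓤 σ m v (inv_mem hu') := by
  have h1 : diag F D (δ'⁻¹ * δ) = r * (u' * u⁻¹) * r⁻¹ := by
    rw [map_mul, map_inv, inv_mul_eq_iff_eq_mul]
    calc diag F D δ = (diag F D δ * r * u) * u⁻¹ * r⁻¹ := by group
      _ = _ := by rw [h]; group
  have h2 : δ'⁻¹ * δ ∈ GammaTilde 𝓤.U r :=
    ⟨u' * u⁻¹, mul_mem hu' (inv_mem hu), h1.symm⟩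
  obtain ⟨z, hz⟩ : δ'⁻¹ * δ ∈ scalars (F := F) (D := D) := by
    have := hΓ r
    have h3 := Subsingleton.elim
      (QuotientGroup.mk (⟨_, h2⟩ : GammaTilde 𝓤.U r) : Gamma 𝓤.U r) (QuotientGroup.mk 1)
    rw [QuotientGroup.eq] at h3
    have h4 := inv_mem h3
    simpa [Subgroup.mem_subgroupOf] using h4
  have hcomm : r * diag F D (δ'⁻¹ * δ) = diag F D (δ'⁻¹ * δ) * r := by
    rw [← hz]
    apply Units.ext
    change r.1 * (Algebra.TensorProduct.includeRight (algebraMap F D z)) =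
      (Algebra.TensorProduct.includeRight (algebraMap F D z)) * r.1
    rw [AlgHom.commutes]
    exact (Algebra.commutes _ _).symm
  have h5 : diag F D (δ'⁻¹ * δ) = u' * u⁻¹ := by
    have : r * diag F D (δ'⁻¹ * δ) = r * (u' * u⁻¹) := by
      rw [hcomm, h1]
      group
    exact mul_left_cancel this
  have hmem : diag F D (Units.map (algebraMap F D).toMonoidHom z) ∈ 𝓤.U := by
    rw [hz, h5]
    exact mul_mem hu' (inv_mem hu)
  have h6 := htriv z hmem
  have h7 : levelAct 𝓤 σ m v (mul_mem hu' (inv_mem hu)) = 1 := by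
    rw [← h6]
    exact levelAct_congr 𝓤 σ m v _ _ (by rw [hz, h5])
  have h8 : levelAct 𝓤 σ m v (inv_mem hu) =
      levelAct 𝓤 σ m v (inv_mem hu') * levelAct 𝓤 σ m v (mul_mem hu' (inv_mem hu)) := by
    rw [← levelAct_mul]
    exact levelAct_congr 𝓤 σ m v _ _ (by group)
  rw [h8, h7, mul_one]

variable {m v} in
theorem Forms.apply_eq {f : Gf F D → WeightModule R m} (hf : f ∈ Forms 𝓤 σ m v) (δ : Dˣ)
    (r : Gf F D) {u : Gf F D} (hu : u ∈ 𝓤.U) :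
    f (diag F D δ * r * u) = levelAct 𝓤 σ m v (inv_mem hu) (f r) := by
  have h := congrFun (hf.2 u⁻¹ (inv_mem hu)) (diag F D δ * r * u)
  rw [← h]
  change levelAct 𝓤 σ m v (inv_mem hu) (f (diag F D δ * r * u * u⁻¹)) = _
  rw [mul_inv_cancel_right, hf.1]

/-- Evaluation at representatives of the classes. -/
def Forms.eval : Forms 𝓤 σ m v →ₗ[R] (ClassSet 𝓤.U → WeightModule R m) where
  toFun f i := f.1 (clsOut i)
  map_add' _ _ := rfl
  map_smul' _ _ := rfl

theorem Forms.eval_bijective (hΓ : ∀ γ : Gf F D, Subsingleton (Gamma 𝓤.U γ))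
    (htriv : ∀ (z : Fˣ) (hz : diag F D (Units.map (algebraMap F D).toMonoidHom z) ∈ 𝓤.U),
      levelAct 𝓤 σ m v hz = 1) :
    Function.Bijective (Forms.eval 𝓤 σ m v) := by
  constructor
  · intro f g hfg
    refine Subtype.ext (funext fun x => ?_)
    obtain ⟨δ, u, hu, hx⟩ := exists_eq_diag_mul_clsOut_mul 𝓤.U x
    rw [hx, Forms.apply_eq 𝓤 σ f.2 δ _ hu, Forms.apply_eq 𝓤 σ g.2 δ _ hu]
    exact congrArg _ (congrFun hfg _)
  · intro g
    choose δ u hu hx using exists_eq_diag_mul_clsOut_mul 𝓤.U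
    set f : Gf F D → WeightModule R m :=
      fun x => levelAct 𝓤 σ m v (inv_mem (hu x)) (g (cls 𝓤.U x)) with hf
    have key : ∀ (ε : Dˣ) (i : ClassSet 𝓤.U) {y : Gf F D} (hy : y ∈ 𝓤.U),
        f (diag F D ε * clsOut i * y) = levelAct 𝓤 σ m v (inv_mem hy) (g i) := by
      intro ε i y hy
      have hc : cls 𝓤.U (diag F D ε * clsOut i * y) = i :=
        (cls_eq_of_eq_mul ε hy rfl).trans (cls_clsOut i)
      have h := hx (diag F D ε * clsOut i * y)
      rw [hc] at h
      simp only [hf]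
      rw [hc, levelAct_inv_eq 𝓤 σ m v hΓ htriv (hu _) hy h.symm]
    refine ⟨⟨f, fun ε x => ?_, fun y hy => funext fun x => ?_⟩, funext fun i => ?_⟩
    · conv_lhs => rw [hx x, ← mul_assoc, ← mul_assoc, ← map_mul]
      rw [key _ _ (hu x)]
    · change levelAct 𝓤 σ m v hy (f (x * y)) = f x
      conv_lhs => rw [hx x, mul_assoc]
      rw [key _ _ (mul_mem (hu x) hy), ← Module.End.mul_apply]
      change (levelAct 𝓤 σ m v hy * _) _ = levelAct 𝓤 σ m v (inv_mem (hu x)) (g (cls 𝓤.U x))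
      rw [← levelAct_mul]
      exact congrFun (congrArg _ (levelAct_congr 𝓤 σ m v _ _ (by group))) _
    · have h := key 1 i (one_mem 𝓤.U)
      rw [map_one, one_mul, mul_one] at h
      change f (clsOut i) = g i
      rw [h]
      have : levelAct 𝓤 σ m v (inv_mem (one_mem 𝓤.U)) = 1 := by
        have h2 := levelAct_mul_inv 𝓤 σ m v (one_mem 𝓤.U)
        rw [← levelAct_mul] at h2
        rw [← h2]
        exact levelAct_congr 𝓤 σ m v _ _ (by group)
      rw [this]
      rfl

/-- `T_p` in terms of the values at the representatives `r` of the classes: if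
`r i * x_j = δ * r (next i j) * u` then `x_j u⁻¹` describes how the value at `r (next i j)`
contributes to the value of `T_p f` at `r i`. -/
theorem Forms.eval_hecke (g : integralAt θ) (next : ClassSet 𝓤.U → cosets 𝓤.U g.1 → ClassSet 𝓤.U)
    (δ : ClassSet 𝓤.U → cosets 𝓤.U g.1 → Dˣ) (u : ClassSet 𝓤.U → cosets 𝓤.U g.1 → Gf F D)
    (hu : ∀ i j, u i j ∈ 𝓤.U)
    (h : ∀ i j, clsOut i * (rep 𝓤 g j).1 = diag F D (δ i j) * clsOut (next i j) * u i j)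
    (f : Forms 𝓤 σ m v) (i : ClassSet 𝓤.U) :
    Forms.eval 𝓤 σ m v (hecke 𝓤 σ m v g f) i = ∑ j, weightAct σ m v
      (pInt θ (rep 𝓤 g j * ⟨_, 𝓤.integral (inv_mem (hu i j) : (u i j)⁻¹ ∈ 𝓤.U)⟩))
        (Forms.eval 𝓤 σ m v f (next i j)) := by
  change (∑ c : cosets 𝓤.U g.1, slash σ m v (rep 𝓤 g c)) f.1 (clsOut i) = _
  rw [LinearMap.sum_apply, Finset.sum_apply]
  refine Finset.sum_congr rfl fun j _ => ?_
  change weightAct σ m v (pInt θ (rep 𝓤 g j)) (f.1 (clsOut i * (rep 𝓤 g j).1)) = _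
  rw [h, Forms.apply_eq 𝓤 σ f.2 _ _ (hu i j), map_mul, map_mul]
  rfl

end ClassFunctions

/-! ### The components at `p` -/

section LocalShape

/-- A product of `diag(p, 1)` with two matrices which are upper unipotent modulo `p`. -/
theorem exists_shape_of_mul {O : Type*} [CommRing O] {p : O} {A B : Matrix (Fin 2) (Fin 2) O}
    (hA0 : p ∣ A 0 0 - 1) (hA1 : p ∣ A 1 0) (hA2 : p ∣ A 1 1 - 1)
    (hB0 : p ∣ B 0 0 - 1) (hB1 : p ∣ B 1 0) (hB2 : p ∣ B 1 1 - 1) :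
    ∃ a b c e : O, A * !![p, 0; 0, 1] * B = !![p * a, b; p * c, e] ∧ p ∣ e - 1 ∧
      p ∣ A.det * B.det - 1 ∧ p * a * e - b * (p * c) = p * (A.det * B.det) := by
  obtain ⟨x, hx⟩ := hA0
  obtain ⟨y, hy⟩ := hA1
  obtain ⟨z, hz⟩ := hA2
  obtain ⟨x', hx'⟩ := hB0
  obtain ⟨y', hy'⟩ := hB1
  obtain ⟨z', hz'⟩ := hB2
  rw [sub_eq_iff_eq_add] at hx hz hx' hz'
  refine ⟨A 0 0 * B 0 0 + A 0 1 * y', p * A 0 0 * B 0 1 + A 0 1 * B 1 1,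
    A 1 0 * B 0 0 + A 1 1 * y', p * A 1 0 * B 0 1 + A 1 1 * B 1 1, ?_, ?_, ?_, ?_⟩
  · ext i j
    fin_cases i <;> fin_cases j <;>
      simp [Matrix.mul_apply, Fin.sum_univ_two, hy'] <;> ring
  · refine ⟨A 1 0 * B 0 1 + z + z' + p * z * z', ?_⟩
    rw [hz, hz']
    ring
  · rw [Matrix.det_fin_two, Matrix.det_fin_two, hx, hy, hz, hx', hy', hz']
    refine ⟨(x + z + p * x * z - A 0 1 * y) + (x' + z' + p * x' * z' - B 0 1 * y') +
      p * (x + z + p * x * z - A 0 1 * y) * (x' + z' + p * x' * z' - B 0 1 * y'), ?_⟩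
    ring
  · rw [Matrix.det_fin_two, Matrix.det_fin_two, hy']
    ring

variable {p : ℕ} [Fact p.Prime] {F : Type*} [Field F] [NumberField F]
  {D : Type*} [Ring D] [Algebra F D] {w : HeightOneSpectrum (𝓞 F)}
  {θ : w.adicCompletion F ⊗[F] D ≃ₐ[w.adicCompletion F]
    Matrix (Fin 2) (Fin 2) (w.adicCompletion F)}
  (𝓤 : Level θ p)

theorem pInt_eta : pInt θ ⟨eta θ p, eta_mem θ p⟩ =
    !![(p : w.adicCompletionIntegers F), 0; 0, 1] := by
  refine Matrix.ext fun i j => Subtype.ext ?_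
  change pComp θ (eta θ p) i j = _
  rw [pComp_eta]
  fin_cases i <;> fin_cases j <;> simp

theorem exists_rep_eq (c : cosets 𝓤.U (eta θ p)) :
    ∃ u₁ ∈ 𝓤.U, ∃ u₂ ∈ 𝓤.U, (rep 𝓤 ⟨eta θ p, eta_mem θ p⟩ c).1 = u₁ * eta θ p * u₂ :=
  out_eq c

/-- `T_p` in explicit form, given a character `ψ` of `Dˣ \ G_f` which interpolates the norm of the
determinant of the component at `p`. -/
theorem exists_localHecke (ψ : Gf F D →* PadicAlgCl p) (hψD : ∀ δ, ψ (diag F D δ) = 1)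
    (hψU : ∀ u (hu : u ∈ 𝓤.U),
      ψ u = ∏ τ : Emb p w, τ.1 (pInt θ ⟨u, 𝓤.integral hu⟩).det)
    (hψη : ψ (eta θ p) = 1) (hΓ : ∀ γ : Gf F D, Subsingleton (Gamma 𝓤.U γ)) :
    ∃ X : LocalHecke p w (ClassSet 𝓤.U) (cosets 𝓤.U (eta θ p)),
      ∀ (R : Type*) [CommRing R] (σ : Emb p w → w.adicCompletionIntegers F →+* R)
        (m v : Emb p w → ℕ),
        (∀ (z : Fˣ) (hz : diag F D (Units.map (algebraMap F D).toMonoidHom z) ∈ 𝓤.U),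
          levelAct 𝓤 σ m v hz = 1) →
        ∃ E : Forms 𝓤 σ m v ≃ₗ[R] (ClassSet 𝓤.U → WeightModule R m), ∀ f i,
          E (Tp 𝓤 σ m v f) i = ∑ j, weightAct σ m v (X.mat i j) (E f (X.next i j)) := by
  set g : integralAt θ := ⟨eta θ p, eta_mem θ p⟩ with hg
  choose δ u hu hx using exists_eq_diag_mul_clsOut_mul 𝓤.U
  -- the coset representative `x_j`, translated to the chosen representative of its class
  have hshape : ∀ (i : ClassSet 𝓤.U) (j : cosets 𝓤.U (eta θ p)), ∃ a b c e q,
      pInt θ (rep 𝓤 g j * ⟨_, 𝓤.integral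
        (inv_mem (hu (clsOut i * (rep 𝓤 g j).1)) : (u (clsOut i * (rep 𝓤 g j).1))⁻¹ ∈ 𝓤.U)⟩) =
        !![(p : w.adicCompletionIntegers F) * a, b; p * c, e] ∧
      (p : w.adicCompletionIntegers F) ∣ e - 1 ∧ (p : w.adicCompletionIntegers F) ∣ q - 1 ∧
      p * a * e - b * (p * c) = p * q ∧
      ∏ τ : Emb p w, τ.1 (q : w.adicCompletionIntegers F) =
        ψ (clsOut (cls 𝓤.U (clsOut i * (rep 𝓤 g j).1))) * (ψ (clsOut i))⁻¹ := by
    intro i j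
    set x := clsOut i * (rep 𝓤 g j).1 with hxdef
    obtain ⟨u₁, hu₁, u₂, hu₂, hrep⟩ := exists_rep_eq 𝓤 j
    have hu₃ := mul_mem hu₂ (inv_mem (hu x))
    have hA : rep 𝓤 g j * ⟨_, 𝓤.integral (inv_mem (hu x) : (u x)⁻¹ ∈ 𝓤.U)⟩ =
        ⟨u₁, 𝓤.integral hu₁⟩ * g * ⟨_, 𝓤.integral hu₃⟩ := by
      apply Subtype.ext
      change (rep 𝓤 g j).1 * (u x)⁻¹ = u₁ * eta θ p * (u₂ * (u x)⁻¹)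
      rw [hrep]
      group
    obtain ⟨a, b, c, e, h1, h2, h3, h4⟩ := exists_shape_of_mul (𝓤.cong_a _ hu₁) (𝓤.cong_c _ hu₁)
      (𝓤.cong_d _ hu₁) (𝓤.cong_a _ hu₃) (𝓤.cong_c _ hu₃) (𝓤.cong_d _ hu₃)
    refine ⟨a, b, c, e, _, ?_, h2, h3, h4, ?_⟩
    · rw [hA, map_mul, map_mul, hg, pInt_eta, h1]
    · have h5 : ψ (clsOut i) * ψ (rep 𝓤 g j).1 = ψ (clsOut (cls 𝓤.U x)) * ψ (u x) := by
        rw [← map_mul, ← hxdef]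
        conv_lhs => rw [hx x]
        rw [map_mul, map_mul, hψD, one_mul]
      rw [hrep, map_mul, map_mul, hψη, mul_one] at h5
      have hne : ∀ y, ψ y ≠ 0 := fun y hy => by
        have : ψ (y * y⁻¹) = 0 := by rw [map_mul, hy, zero_mul]
        rw [mul_inv_cancel, map_one] at this
        exact one_ne_zero this
      have h6 : ψ (u₂ * (u x)⁻¹) = ψ u₂ * (ψ (u x))⁻¹ := by
        rw [map_mul, eq_mul_inv_iff_mul_eq₀ (hne _), mul_assoc, ← map_mul, inv_mul_cancel,
          map_one, mul_one]
      simp only [MulMemClass.coe_mul, map_mul, Finset.prod_mul_distrib]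
      rw [← hψU u₁ hu₁, ← hψU _ hu₃, h6]
      have h7 := hne (u x)
      have h8 := hne (clsOut i)
      field_simp
      linear_combination h5
  choose a b c e q h1 h2 h3 h4 h5 using hshape
  have hne : ∀ y, ψ y ≠ 0 := fun y hy => by
    have : ψ (y * y⁻¹) = 0 := by rw [map_mul, hy, zero_mul]
    rw [mul_inv_cancel, map_one] at this
    exact one_ne_zero this
  refine ⟨⟨fun i j => cls 𝓤.U (clsOut i * (rep 𝓤 g j).1), a, b, c, e, q, fun i => ψ (clsOut i),
    fun i => hne _, h2, h3, h4, h5⟩, ?_⟩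
  intro R _ σ m v htriv
  refine ⟨LinearEquiv.ofBijective _ (Forms.eval_bijective 𝓤 σ m v hΓ htriv), fun f i => ?_⟩
  refine (Forms.eval_hecke 𝓤 σ m v g (fun i j => cls 𝓤.U (clsOut i * (rep 𝓤 g j).1))
    (fun i j => δ (clsOut i * (rep 𝓤 g j).1)) (fun i j => u (clsOut i * (rep 𝓤 g j).1))
    (fun i j => hu _) (fun i j => hx _) f i).trans ?_
  refine Finset.sum_congr rfl fun j _ => ?_
  rw [h1]
  rfl

end LocalShape

/-! ### Global units and the comparison of two weights -/

section Comparison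

theorem subst_scalar {R : Type*} [CommRing R] (c : R) {a : ℕ} {f : MvPolynomial (Fin 2) R}
    (hf : f ∈ MvPolynomial.homogeneousSubmodule (Fin 2) R a) :
    subst (c • (1 : Matrix (Fin 2) (Fin 2) R)) f = c ^ a • f := by
  have h1 : ∀ j, ∑ i, MvPolynomial.C ((c • (1 : Matrix (Fin 2) (Fin 2) R)) i j) *
      MvPolynomial.X i = MvPolynomial.C c * MvPolynomial.X j := by
    intro j
    fin_cases j <;> simp [Fin.sum_univ_two]
  rw [subst]
  simp only [h1]
  rw [f.as_sum, map_sum, Finset.smul_sum]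
  refine Finset.sum_congr rfl fun e he => ?_
  have hdeg : e.degree = a := by
    by_contra hne
    exact MvPolynomial.mem_support_iff.1 he (MvPolynomial.IsHomogeneous.coeff_eq_zero
      ((MvPolynomial.mem_homogeneousSubmodule _ _).1 hf) hne)
  rw [MvPolynomial.aeval_monomial, Finsupp.prod_fintype _ _ (by simp), Fin.prod_univ_two,
    MvPolynomial.monomial_eq, Finsupp.prod_fintype _ _ (by simp), Fin.prod_univ_two, ← hdeg,
    Finsupp.degree_eq_sum, Fin.sum_univ_two, MvPolynomial.smul_eq_C_mul, MvPolynomial.C_pow,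
    pow_add, mul_pow, mul_pow, MvPolynomial.algebraMap_eq]
  ring

theorem symAct_scalar {R : Type*} [CommRing R] (c : R) (a b : ℕ) :
    symAct a b (c • (1 : Matrix (Fin 2) (Fin 2) R)) = c ^ (a + 2 * b) • LinearMap.id := by
  refine LinearMap.ext fun f => Subtype.ext ?_
  change (c • (1 : Matrix (Fin 2) (Fin 2) R)).det ^ b • subst _ f.1 = c ^ (a + 2 * b) • f.1
  rw [subst_scalar c f.2, smul_smul, Matrix.det_smul, Matrix.det_one, mul_one, Fintype.card_fin,
    ← pow_mul, ← pow_add, add_comm]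

theorem weightAct_scalar {ι O R : Type*} [Fintype ι] [CommRing O] [CommRing R] (σ : ι → O →+* R)
    (m v : ι → ℕ) (μ : ℕ) (hμ : ∀ τ, m τ + 2 * v τ = μ) (c : O) (f : WeightModule R m) :
    weightAct σ m v (c • (1 : Matrix (Fin 2) (Fin 2) O)) f = (∏ τ, σ τ c) ^ μ • f := by
  have h : weightAct σ m v (c • (1 : Matrix (Fin 2) (Fin 2) O)) =
      ((∏ τ, σ τ c) ^ μ) • LinearMap.id := by
    refine PiTensorProduct.ext (MultilinearMap.ext fun x => ?_)
    change PiTensorProduct.map _ (PiTensorProduct.tprod R x) =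
      (∏ τ, σ τ c) ^ μ • PiTensorProduct.tprod R x
    rw [PiTensorProduct.map_tprod, ← Finset.prod_pow, ← MultilinearMap.map_smul_univ]
    congr 1
    funext τ
    have h1 : (σ τ).mapMatrix (c • (1 : Matrix (Fin 2) (Fin 2) O)) =
        σ τ c • (1 : Matrix (Fin 2) (Fin 2) R) := by
      ext i j
      by_cases hij : i = j <;> simp [hij]
    rw [h1, symAct_scalar, hμ]
    rfl
  rw [h]
  rfl

theorem eq_zero_of_two_smul_eq_zero {ι R : Type*} [Fintype ι] [CommRing R] [IsDomain R]
    (h2 : (2 : R) ≠ 0) (m : ι → ℕ) {f : WeightModule R m} (h : (2 : R) • f = 0) : f = 0 := by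
  refine (weightBasis R m).ext_elem fun i => ?_
  have := congrArg (fun g => (weightBasis R m).repr g i) h
  simpa [h2] using this

/-- For any two weights which are congruent modulo a high power of `p`, the twists become congruent
after the addition of constants. -/
theorem exists_modEq_twist {ι : Type*} {p n : ℕ} (hp : p.Prime) (hn : 1 ≤ n) {m v m' v' : ι → ℕ}
    {μ μ' : ℕ} (h : ∀ τ, m τ + 2 * v τ = μ) (h' : ∀ τ, m' τ + 2 * v' τ = μ')
    (hm : ∀ τ, m τ ≡ m' τ [MOD p ^ n]) (τ₀ : ι) :
    ∃ w w' : ℕ, ∀ τ, v τ + w ≡ v' τ + w' [MOD p ^ (n - 1)] := by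
  have key : ∀ N w w' : ℕ, N ∣ p ^ n → μ + 2 * w ≡ μ' + 2 * w' [MOD N] → ∀ τ,
      2 * (v τ + w) ≡ 2 * (v' τ + w') [MOD N] := by
    intro N w w' hN hw τ
    refine Nat.ModEq.add_left_cancel ((hm τ).of_dvd hN) ?_
    have e1 : m τ + 2 * (v τ + w) = μ + 2 * w := by rw [← h τ]; ring
    have e2 : m' τ + 2 * (v' τ + w') = μ' + 2 * w' := by rw [← h' τ]; ring
    rwa [e1, e2]
  rcases hp.eq_two_or_odd' with rfl | hodd
  · -- for `p = 2`, the numbers `μ` and `μ'` have the same parity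
    have hpar : μ % 2 = μ' % 2 := by
      have := (hm τ₀).of_dvd (dvd_pow_self 2 (by omega : n ≠ 0))
      rw [← h τ₀, ← h' τ₀]
      unfold Nat.ModEq at this
      omega
    refine ⟨μ' / 2, μ / 2, fun τ => ?_⟩
    have h1 := key (2 ^ n) (μ' / 2) (μ / 2) dvd_rfl
      (by rw [show μ + 2 * (μ' / 2) = μ' + 2 * (μ / 2) by omega]) τ
    obtain ⟨l, rfl⟩ := Nat.exists_eq_add_of_le' hn
    rw [pow_succ, mul_comm (2 ^ l)] at h1
    exact Nat.ModEq.mul_left_cancel' two_ne_zero h1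
  · -- for odd `p`, the number `2` is invertible modulo powers of `p`
    have hodd' : Odd (p ^ (n - 1)) := hodd.pow
    obtain ⟨s, hs⟩ := hodd'
    refine ⟨μ' * (s + 1), μ * (s + 1), fun τ => ?_⟩
    have h1 := key (p ^ (n - 1)) (μ' * (s + 1)) (μ * (s + 1)) (pow_dvd_pow p (Nat.sub_le n 1)) (by
      have e1 : μ + 2 * (μ' * (s + 1)) = (μ + μ') + p ^ (n - 1) * μ' := by rw [hs]; ring
      have e2 : μ' + 2 * (μ * (s + 1)) = (μ + μ') + p ^ (n - 1) * μ := by rw [hs]; ring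
      rw [e1, e2, Nat.ModEq, Nat.add_mul_mod_self_left, Nat.add_mul_mod_self_left]) τ
    refine Nat.ModEq.cancel_left_of_coprime ?_ h1
    rw [hs]
    simp

variable {p : ℕ} {F : Type*} [Field F] [NumberField F]
  {D : Type*} [Ring D] [Algebra F D] {w : HeightOneSpectrum (𝓞 F)}
  {θ : w.adicCompletion F ⊗[F] D ≃ₐ[w.adicCompletion F]
    Matrix (Fin 2) (Fin 2) (w.adicCompletion F)}
  (𝓤 : Level θ p)

/-- The image of a scalar in `G_f`. -/
abbrev diagScalar (F : Type*) [Field F] [NumberField F] (D : Type*) [Ring D] [Algebra F D]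
    (z : Fˣ) : Gf F D :=
  diag F D (Units.map (algebraMap F D).toMonoidHom z)

theorem pComp_diagScalar (z : Fˣ) : pComp θ (diagScalar F D z) =
    algebraMap F (w.adicCompletion F) z • (1 : Matrix (Fin 2) (Fin 2) (w.adicCompletion F)) := by
  change θ (component D w (Algebra.TensorProduct.includeRight (algebraMap F D z))) = _
  rw [AlgHom.commutes, AlgHom.commutes,
    IsScalarTower.algebraMap_apply F (w.adicCompletion F) (w.adicCompletion F ⊗[F] D),
    AlgEquiv.commutes, Algebra.algebraMap_eq_smul_one]

/-- The coordinate of a global unit at `p`, as an element of `O_{F,p}`. -/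
def scalarAt {z : Fˣ} (hz : diagScalar F D z ∈ 𝓤.U) : w.adicCompletionIntegers F :=
  pInt θ ⟨_, 𝓤.integral hz⟩ 0 0

theorem pInt_diagScalar {z : Fˣ} (hz : diagScalar F D z ∈ 𝓤.U) :
    pInt θ ⟨_, 𝓤.integral hz⟩ = scalarAt 𝓤 hz • (1 : Matrix (Fin 2) (Fin 2) _) := by
  refine Matrix.ext fun i j => Subtype.ext ?_
  have h0 : ((scalarAt 𝓤 hz : w.adicCompletionIntegers F) : w.adicCompletion F) =
      algebraMap F _ (z : F) := by
    change pComp θ (diagScalar F D z) 0 0 = _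
    rw [pComp_diagScalar]
    simp
  change pComp θ (diagScalar F D z) i j = _
  rw [pComp_diagScalar]
  by_cases hij : i = j <;> simp [hij, h0]

variable [Fact p.Prime]

/-- The norm of a global unit in `U` is `1`, or `-1` if `p = 2`. -/
theorem prod_scalarAt (ψ : Gf F D →* PadicAlgCl p) (hψD : ∀ δ, ψ (diag F D δ) = 1)
    (hψU : ∀ u (hu : u ∈ 𝓤.U),
      ψ u = ∏ τ : Emb p w, τ.1 (pInt θ ⟨u, 𝓤.integral hu⟩).det)
    {z : Fˣ} (hz : diagScalar F D z ∈ 𝓤.U) :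
    ∏ τ : Emb p w, τ.1 (scalarAt 𝓤 hz) = 1 ∨
      p = 2 ∧ ∏ τ : Emb p w, τ.1 (scalarAt 𝓤 hz) = -1 := by
  have h1 := hψU _ hz
  rw [hψD, pInt_diagScalar 𝓤 hz, Matrix.det_smul, Matrix.det_one, mul_one, Fintype.card_fin] at h1
  have h2 : (∏ τ : Emb p w, τ.1 (scalarAt 𝓤 hz)) ^ 2 = 1 := by
    rw [← Finset.prod_pow, h1]
    refine Finset.prod_congr rfl fun τ _ => ?_
    rw [← map_pow]
    rfl
  rcases mul_self_eq_one_iff.1 ((sq _).symm.trans h2) with h | h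
  · exact Or.inl h
  refine Or.inr ⟨?_, h⟩
  -- the norm is congruent to `1` modulo `p`, so that it can be `-1` only if `p` divides `2`
  have h3 : (p : clInt p) ∣ ∏ τ : Emb p w, τ.toInt (scalarAt 𝓤 hz) - 1 := by
    refine Finset.prod_induction _ (fun x => (p : clInt p) ∣ x - 1) (fun x y hx hy => ?_)
      (by simp) fun τ _ => ?_
    · have : x * y - 1 = x * (y - 1) + (x - 1) := by ring
      rw [this]
      exact dvd_add (dvd_mul_of_dvd_right hy _) hx
    · have := map_dvd τ.toInt (𝓤.cong_a _ hz)
      rwa [map_natCast, map_sub, map_one] at this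
  have h4 : ∏ τ : Emb p w, τ.toInt (scalarAt 𝓤 hz) = -1 := by
    apply Subtype.ext
    have : ((∏ τ : Emb p w, τ.toInt (scalarAt 𝓤 hz) : clInt p) : PadicAlgCl p) =
        ∏ τ : Emb p w, τ.1 (scalarAt 𝓤 hz) := map_prod (clInt p).subtype _ _
    rw [this, h]
    rfl
  rw [h4] at h3
  by_contra hp2
  obtain ⟨s, hs⟩ := (Fact.out : p.Prime).odd_of_ne_two hp2
  have h5 : (p : clInt p) ∣ 1 := by
    have : (1 : clInt p) = p + s * (-1 - 1) := by
      have : (p : clInt p) = 2 * s + 1 := by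
        exact_mod_cast congrArg (Nat.cast : ℕ → clInt p) hs
      rw [this]
      ring
    rw [this]
    exact dvd_add dvd_rfl (dvd_mul_of_dvd_right h3 _)
  have h6 := norm_map_le_of_pow_dvd (clInt p).subtype (fun x => x.2) (N := 1)
    (x := 1) (by rwa [pow_one])
  rw [map_one, norm_one, pow_one] at h6
  have hp1 : (1 : ℝ) < p := by exact_mod_cast (Fact.out : p.Prime).one_lt
  have := inv_lt_one_of_one_lt₀ hp1
  linarith

variable {R : Type*} [CommRing R] [Algebra R (PadicAlgCl p)]

/-- A global unit in `U` acts on every weight module of weight `μ` as `ε ^ μ`, where `ε = 1`, or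
possibly `ε = -1` if `p = 2`. -/
theorem exists_levelAct_diagScalar (hR : Function.Injective (algebraMap R (PadicAlgCl p)))
    (σ : Emb p w → w.adicCompletionIntegers F →+* R)
    (hσ : ∀ τ x, algebraMap R (PadicAlgCl p) (σ τ x) = τ.1 x)
    (ψ : Gf F D →* PadicAlgCl p) (hψD : ∀ δ, ψ (diag F D δ) = 1)
    (hψU : ∀ u (hu : u ∈ 𝓤.U),
      ψ u = ∏ τ : Emb p w, τ.1 (pInt θ ⟨u, 𝓤.integral hu⟩).det)
    {z : Fˣ} (hz : diagScalar F D z ∈ 𝓤.U) :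
    ∃ ε : R, (ε = 1 ∨ p = 2 ∧ ε = -1) ∧ ∀ (m v : Emb p w → ℕ) (μ : ℕ),
      (∀ τ, m τ + 2 * v τ = μ) → ∀ f, levelAct 𝓤 σ m v hz f = ε ^ μ • f := by
  have h0 : algebraMap R (PadicAlgCl p) (∏ τ, σ τ (scalarAt 𝓤 hz)) =
      ∏ τ : Emb p w, τ.1 (scalarAt 𝓤 hz) := by
    rw [map_prod]
    exact Finset.prod_congr rfl fun τ _ => hσ τ _
  refine ⟨∏ τ, σ τ (scalarAt 𝓤 hz), ?_, fun m v μ hμ f => ?_⟩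
  · rcases prod_scalarAt 𝓤 ψ hψD hψU hz with h | ⟨hp, h⟩
    · exact Or.inl (hR (by rw [h0, h, map_one]))
    · exact Or.inr ⟨hp, hR (by rw [h0, h, map_neg, map_one])⟩
  · rw [levelAct, pInt_diagScalar 𝓤 hz, weightAct_scalar σ m v μ hμ]

/-- Global units in `U` act trivially on the weight module, unless `p = 2` and the weight is odd;
in the latter case there may be a unit which acts as `-1`, and it does so in every odd weight. -/
theorem levelAct_diagScalar (hR : Function.Injective (algebraMap R (PadicAlgCl p)))
    (σ : Emb p w → w.adicCompletionIntegers F →+* R)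
    (hσ : ∀ τ x, algebraMap R (PadicAlgCl p) (σ τ x) = τ.1 x)
    (ψ : Gf F D →* PadicAlgCl p) (hψD : ∀ δ, ψ (diag F D δ) = 1)
    (hψU : ∀ u (hu : u ∈ 𝓤.U),
      ψ u = ∏ τ : Emb p w, τ.1 (pInt θ ⟨u, 𝓤.integral hu⟩).det)
    {m v : Emb p w → ℕ} {μ : ℕ} (hμ : ∀ τ, m τ + 2 * v τ = μ)
    {z : Fˣ} (hz : diagScalar F D z ∈ 𝓤.U) :
    levelAct 𝓤 σ m v hz = 1 ∨ p = 2 ∧ Odd μ ∧ ∀ (m' v' : Emb p w → ℕ) (μ' : ℕ),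
      (∀ τ, m' τ + 2 * v' τ = μ') → Odd μ' → ∀ f, levelAct 𝓤 σ m' v' hz f = (-1 : R) • f := by
  obtain ⟨ε, hε, hact⟩ := exists_levelAct_diagScalar 𝓤 hR σ hσ ψ hψD hψU hz
  by_cases h1 : ε ^ μ = 1
  · refine Or.inl (LinearMap.ext fun f => ?_)
    rw [hact m v μ hμ, h1, one_smul]
    rfl
  · rcases hε with rfl | ⟨hp, rfl⟩
    · exact absurd (one_pow μ) h1
    · refine Or.inr ⟨hp, Nat.not_even_iff_odd.1 fun h => h1 h.neg_one_pow,
        fun m' v' μ' hμ' hodd f => ?_⟩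
      rw [hact m' v' μ' hμ', hodd.neg_one_pow]

/-- If a global unit in `U` acts as `-1` then there are no forms. -/
theorem slopeDim_eq_zero_of_levelAct_neg
    (hR : Function.Injective (algebraMap R (PadicAlgCl p)))
    (σ : Emb p w → w.adicCompletionIntegers F →+* R) {k v : Emb p w → ℕ} {z : Fˣ}
    (hz : diagScalar F D z ∈ 𝓤.U)
    (h : ∀ f, levelAct 𝓤 σ (fun τ => k τ - 2) v hz f = (-1 : R) • f) (α : ℝ) :
    slopeDim 𝓤 σ k v α = 0 := by
  have : IsDomain R := hR.isDomain
  have h2 : (2 : R) ≠ 0 := fun h => by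
    have := congrArg (algebraMap R (PadicAlgCl p)) h
    rw [map_ofNat, map_zero] at this
    exact two_ne_zero this
  have hsub : Subsingleton (Forms 𝓤 σ (fun τ => k τ - 2) v) := by
    refine subsingleton_of_forall_eq 0 fun f => Subtype.ext (funext fun x => ?_)
    have h1 := congrFun (f.2.2 _ hz) x
    change levelAct 𝓤 σ (fun τ => k τ - 2) v hz (f.1 (x * diagScalar F D z)) = f.1 x at h1
    have hcomm : x * diagScalar F D z = diagScalar F D z * x := by
      apply Units.ext
      change x.1 * (Algebra.TensorProduct.includeRight (algebraMap F D z)) =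
        (Algebra.TensorProduct.includeRight (algebraMap F D z)) * x.1
      rw [AlgHom.commutes]
      exact (Algebra.commutes _ _).symm
    rw [hcomm, f.2.1, h] at h1
    refine eq_zero_of_two_smul_eq_zero h2 _ ?_
    have e : (2 : R) = -(-1) + 1 := by norm_num
    rw [e, add_smul, one_smul]
    nth_rewrite 2 [← h1]
    rw [← add_smul]
    simp
  rw [slopeDim, slopeCount]
  have : Subsingleton (PadicAlgCl p ⊗[R] Forms 𝓤 σ (fun τ => k τ - 2) v) :=
    subsingleton_of_forall_eq 0 fun x => by
      induction x with
      | zero => rfl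
      | add x y hx hy => rw [hx, hy, add_zero]
      | tmul a f => rw [Subsingleton.elim f 0, TensorProduct.tmul_zero]
  exact Module.finrank_zero_of_subsingleton

/-- The theorem, given a character `ψ` of `Dˣ \ G_f` which interpolates the norm of the determinant
of the component at `p`. -/
theorem slopeDim_eq_of_character (hR : Function.Injective (algebraMap R (PadicAlgCl p)))
    (σ : Emb p w → w.adicCompletionIntegers F →+* R)
    (hσ : ∀ τ x, algebraMap R (PadicAlgCl p) (σ τ x) = τ.1 x)
    (ψ : Gf F D →* PadicAlgCl p) (hψD : ∀ δ, ψ (diag F D δ) = 1)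
    (hψU : ∀ u (hu : u ∈ 𝓤.U),
      ψ u = ∏ τ : Emb p w, τ.1 (pInt θ ⟨u, 𝓤.integral hu⟩).det)
    (hψη : ψ (eta θ p) = 1) (hΓ : ∀ γ : Gf F D, Subsingleton (Gamma 𝓤.U γ))
    [Finite (ClassSet 𝓤.U)] {d h : ℕ} (hd : Fintype.card (Emb p w) ≤ d)
    (hh : Nat.card (ClassSet 𝓤.U) = h) (α : ℝ) (n : ℕ)
    (hn : n = ⌊(2 * (h + 3) * α - -(h + 3)) ^ (d + 1)⌋₊) (k v k' v' : Emb p w → ℕ)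
    (hk : IsWeight k v) (hk' : IsWeight k' v') (hnk : ∀ τ, n ≤ k τ) (hnk' : ∀ τ, n ≤ k' τ)
    (hkk : ∀ τ, k τ ≡ k' τ [MOD p ^ n]) :
    slopeDim 𝓤 σ k v α = slopeDim 𝓤 σ k' v' α := by
  classical
  have := Fintype.ofFinite (ClassSet 𝓤.U)
  have hpp : p.Prime := Fact.out
  have hint : ∀ x, ‖(clInt p).subtype x‖ ≤ 1 := fun x => x.2
  obtain ⟨X, hX⟩ := exists_localHecke 𝓤 ψ hψD hψU hψη hΓ
  obtain ⟨μ, hμ⟩ := hk.parallel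
  obtain ⟨μ', hμ'⟩ := hk'.parallel
  obtain ⟨τ₀, -⟩ := hk.exists_zero
  have htriv := fun z (hz : diagScalar F D z ∈ 𝓤.U) =>
    levelAct_diagScalar 𝓤 hR σ hσ ψ hψD hψU (m := fun τ => k τ - 2) hμ hz
  have htriv' := fun z (hz : diagScalar F D z ∈ 𝓤.U) =>
    levelAct_diagScalar 𝓤 hR σ hσ ψ hψD hψU (m := fun τ => k' τ - 2) hμ' hz
  rcases lt_or_ge α 0 with hα | hα
  · -- negative slopes do not occur
    have hzero : ∀ (k v : Emb p w → ℕ) (μ : ℕ) (_ : ∀ τ, k τ - 2 + 2 * v τ = μ),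
        slopeDim 𝓤 σ k v α = 0 := by
      intro k v μ hμ
      by_cases hex : ∀ z (hz : diagScalar F D z ∈ 𝓤.U),
          levelAct 𝓤 σ (fun τ => k τ - 2) v hz = 1
      · obtain ⟨E, hE⟩ := hX R σ (fun τ => k τ - 2) v hex
        rw [slopeDim_eq_countP 𝓤 σ hσ X k v E hE 0 α]
        exact X.data.countP_eq_zero_of_neg _ hint _ _ hα
      · push Not at hex
        obtain ⟨z, hz, hne⟩ := hex
        rcases levelAct_diagScalar 𝓤 hR σ hσ ψ hψD hψU (m := fun τ => k τ - 2) hμ hz with h | h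
        · exact absurd h hne
        · exact slopeDim_eq_zero_of_levelAct_neg 𝓤 hR σ hz (h.2.2 _ _ μ hμ h.2.1) α
    rw [hzero k v μ hμ, hzero k' v' μ' hμ']
  have hx : (1 : ℝ) ≤ 2 * α + 1 := by linarith
  have hhpos : (0 : ℝ) ≤ h := Nat.cast_nonneg h
  -- the size of `n`
  have hn1 : 1 + 2 * h * α * (2 * α + 1) ^ d < n := by
    have h1 := Nat.lt_floor_add_one ((2 * ((h : ℝ) + 3) * α - -(h + 3)) ^ (d + 1))
    rw [← hn] at h1
    have h2 : (2 * ((h : ℝ) + 3) * α - -(h + 3)) ^ (d + 1) =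
        (h + 3) ^ (d + 1) * (2 * α + 1) ^ (d + 1) := by
      rw [← mul_pow]
      ring
    have h3 : (h : ℝ) + 3 ≤ (h + 3) ^ (d + 1) :=
      le_self_pow₀ (by linarith) (Nat.succ_ne_zero d)
    have h4 : (1 : ℝ) ≤ (2 * α + 1) ^ d := one_le_pow₀ hx
    have h5 : (1 : ℝ) ≤ (2 * α + 1) ^ (d + 1) := one_le_pow₀ hx
    have h6 : ((h : ℝ) + 3) * (2 * α + 1) ^ (d + 1) ≤
        (h + 3) ^ (d + 1) * (2 * α + 1) ^ (d + 1) :=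
      mul_le_mul_of_nonneg_right h3 (by linarith)
    have h7 : 2 * (h : ℝ) * α * (2 * α + 1) ^ d ≤ h * (2 * α + 1) ^ (d + 1) := by
      have : 0 ≤ (h : ℝ) * (2 * α + 1) ^ d := by positivity
      rw [pow_succ]
      nlinarith
    linarith
  have hn2 : 2 ≤ n := by
    have : (1 : ℝ) < n := by
      have : 0 ≤ 2 * h * α * (2 * α + 1) ^ d := by positivity
      linarith
    exact_mod_cast this
  have hmm : ∀ τ, k τ - 2 ≡ k' τ - 2 [MOD p ^ n] := fun τ => by
    refine Nat.ModEq.add_right_cancel' 2 ?_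
    rw [Nat.sub_add_cancel (hk.two_le τ), Nat.sub_add_cancel (hk'.two_le τ)]
    exact hkk τ
  -- the two weights have the same parity if `p = 2`
  have hpar : p = 2 → (Odd μ ↔ Odd μ') := by
    rintro rfl
    have := (hmm τ₀).of_dvd (dvd_pow_self _ (by omega))
    rw [← hμ τ₀, ← hμ' τ₀]
    unfold Nat.ModEq at this
    rw [Nat.odd_iff, Nat.odd_iff]
    omega
  by_cases hex : ∃ z, ∃ hz : diagScalar F D z ∈ 𝓤.U,
      levelAct 𝓤 σ (fun τ => k τ - 2) v hz ≠ 1 ∨ levelAct 𝓤 σ (fun τ => k' τ - 2) v' hz ≠ 1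
  · -- a global unit acts as `-1` in both weights, so that there are no forms
    obtain ⟨z, hz, hne⟩ := hex
    obtain ⟨hodd, hodd', hneg⟩ : Odd μ ∧ Odd μ' ∧ ∀ (m' v' : Emb p w → ℕ) (μ' : ℕ),
        (∀ τ, m' τ + 2 * v' τ = μ') → Odd μ' →
          ∀ f, levelAct 𝓤 σ m' v' hz f = (-1 : R) • f := by
      rcases hne with hne | hne
      · obtain ⟨hp, ho, h⟩ := (htriv z hz).resolve_left hne
        exact ⟨ho, (hpar hp).1 ho, h⟩
      · obtain ⟨hp, ho, h⟩ := (htriv' z hz).resolve_left hne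
        exact ⟨(hpar hp).2 ho, ho, h⟩
    rw [slopeDim_eq_zero_of_levelAct_neg 𝓤 hR σ hz (hneg _ _ μ hμ hodd) α,
      slopeDim_eq_zero_of_levelAct_neg 𝓤 hR σ hz (hneg _ _ μ' hμ' hodd') α]
  push Not at hex
  obtain ⟨E, hE⟩ := hX R σ (fun τ => k τ - 2) v fun z hz => (hex z hz).1
  obtain ⟨E', hE'⟩ := hX R σ (fun τ => k' τ - 2) v' fun z hz => (hex z hz).2
  obtain ⟨c, c', hcc⟩ := exists_modEq_twist hpp (by omega) hμ hμ' hmm τ₀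
  rw [slopeDim_eq_countP 𝓤 σ hσ X k v E hE c α, slopeDim_eq_countP 𝓤 σ hσ X k' v' E' hE' c' α]
  refine X.data.countP_eq _ hint (fun i j τ => ?_) (fun i j τ => ?_) (n - 1) _ _ _ _
    (fun τ => ?_) (fun τ => ?_) (fun τ => ?_) hcc hα ?_
  · have := map_dvd τ.toInt (X.e_cong i j)
    rwa [map_natCast, map_sub, map_one] at this
  · have := map_dvd τ.toInt (X.u_cong i j)
    rwa [map_natCast, map_sub, map_one] at this
  · have := hnk τ
    have := hk.two_le τ
    omega
  · have := hnk' τ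
    have := hk'.two_le τ
    omega
  · exact (hmm τ).of_dvd (pow_dvd_pow p (Nat.sub_le n 1))
  · have h1 : (Fintype.card (ClassSet 𝓤.U) : ℝ) = h := by
      rw [← hh, Nat.card_eq_fintype_card]
    rw [h1, Nat.cast_sub (by omega), Nat.cast_one]
    have h2 : (2 * α + 1) ^ Fintype.card (Emb p w) ≤ (2 * α + 1) ^ d := pow_le_pow_right₀ hx hd
    have h3 := mul_le_mul_of_nonneg_left h2 (by positivity : 0 ≤ 2 * (h : ℝ) * α)
    linarith

end Comparison

/-! ### Embeddings of `F` and of its completion at an inert prime -/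

section Embeddings

variable {p : ℕ} [Fact p.Prime] {F : Type*} [Field F] [NumberField F]
  {w : HeightOneSpectrum (𝓞 F)}

theorem valued_algebraMap (v : HeightOneSpectrum (𝓞 F)) (x : F) :
    Valued.v (algebraMap F (v.adicCompletion F) x) = v.valuation F x :=
  HeightOneSpectrum.valuedAdicCompletion_eq_valuation' v x

theorem valued_le_mem_nhds_zero {v : HeightOneSpectrum (𝓞 F)} {g : v.adicCompletion F}
    (hg : g ≠ 0) : {y : v.adicCompletion F | Valued.v y ≤ Valued.v g} ∈ nhds 0 := by
  have hc : Continuous fun y : v.adicCompletion F => y * g⁻¹ := continuous_mul_const _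
  have hO : (v.adicCompletionIntegers F : Set (v.adicCompletion F)) ∈ nhds (0 * g⁻¹) := by
    rw [zero_mul]
    exact (Valued.isOpen_valuationSubring _).mem_nhds (zero_mem _)
  refine Filter.mem_of_superset (hc.continuousAt.preimage_mem_nhds hO) fun y hy => ?_
  change Valued.v (_ * _) ≤ (1 : WithZero (Multiplicative ℤ)) at hy
  rw [map_mul, map_inv₀, ← div_eq_mul_inv] at hy
  exact (div_le_one₀ (zero_lt_iff.2 ((Valuation.ne_zero_iff _).2 hg))).1 hy

theorem norm_map_ringOfIntegers_le_one {p : ℕ} [Fact p.Prime] {F : Type*} [Field F]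
    (f : F →+* PadicAlgCl p) (a : 𝓞 F) : ‖f a‖ ≤ 1 := by
  have h : IsIntegral (PadicAlgCl.valued p).v.integer (f a) := by
    have := (a.isIntegral_coe.map f.toIntAlgHom).tower_top (A := (PadicAlgCl.valued p).v.integer)
    exact this
  exact (Valuation.integer.integers (PadicAlgCl.valued p).v).mem_of_integral h

theorem norm_map_le_one_of_inert (hw : w.asIdeal = Ideal.span {(p : 𝓞 F)})
    (f : F →+* PadicAlgCl p) {x : F} (hx : w.valuation F x ≤ 1) : ‖f x‖ ≤ 1 := by
  obtain ⟨a, ⟨s, hs⟩, h⟩ := w.exists_primeCompl_mul_eq_of_integer x hx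
  change x * (s : F) = a at h
  -- the denominator is invertible modulo `p`, hence its image is a unit
  obtain ⟨t, y, hty⟩ : ∃ t y : 𝓞 F, s * t = 1 + p * y := by
    have hmax := w.isMaximal
    obtain ⟨t, ht⟩ := hmax.exists_inv hs
    obtain ⟨z, hz, hzt⟩ := ht
    rw [hw, Ideal.mem_span_singleton] at hz
    obtain ⟨y, rfl⟩ := hz
    exact ⟨t, -y, by linear_combination hzt⟩
  have hpy : ‖(p : PadicAlgCl p) * f y‖ < 1 := by
    rw [norm_mul]
    have h1 : ‖(p : PadicAlgCl p)‖ < 1 := by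
      rw [← map_natCast (algebraMap ℚ_[p] (PadicAlgCl p)), norm_algebraMap', Padic.norm_p]
      exact inv_lt_one_of_one_lt₀ (by exact_mod_cast (Fact.out : p.Prime).one_lt)
    exact mul_lt_one_of_nonneg_of_lt_one_left (norm_nonneg _) h1
      (norm_map_ringOfIntegers_le_one f y)
  have h1 : ‖f s‖ * ‖f t‖ = 1 := by
    rw [← norm_mul, ← map_mul]
    have : (s : F) * t = 1 + p * y := by exact_mod_cast congrArg (algebraMap (𝓞 F) F) hty
    rw [this, map_add, map_one, map_mul, map_natCast]
    have := IsUltrametricDist.norm_add_eq_max_of_norm_ne_norm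
      (x := (1 : PadicAlgCl p)) (y := p * f y) (by rw [norm_one]; exact hpy.ne')
    rw [this, norm_one, max_eq_left hpy.le]
  have h2 : ‖f s‖ = 1 := by
    refine le_antisymm (norm_map_ringOfIntegers_le_one f s) ?_
    nlinarith [norm_map_ringOfIntegers_le_one f t, norm_nonneg (f s), norm_nonneg (f t)]
  have h3 := congrArg (fun z => ‖f z‖) h
  simp only [map_mul, norm_mul] at h3
  rw [h2, mul_one] at h3
  rw [h3]
  exact norm_map_ringOfIntegers_le_one f a

/-- Every embedding of `F` into `ℚ̄_p` is continuous for the topology of the completion at the inert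
prime `p`, so that it extends to the completion: its image lies in a finite extension of `ℚ_p`,
which is complete. -/
theorem exists_emb_extending (hw : w.asIdeal = Ideal.span {(p : 𝓞 F)})
    (f : F →+* PadicAlgCl p) :
    ∃ τ : Emb p w, τ.1.comp (algebraMap F (w.adicCompletion F)) = f := by
  let E : Subalgebra ℚ_[p] (PadicAlgCl p) :=
    Algebra.adjoin ℚ_[p] (f '' Set.range (Module.finBasis ℚ F))
  have hfin : FiniteDimensional ℚ_[p] E := by
    refine Algebra.finite_adjoin_of_finite_of_isIntegral ((Set.finite_range _).image _) fun x _ =>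
      (Algebra.IsAlgebraic.isAlgebraic x).isIntegral
  have hE : ∀ x, f x ∈ E := by
    intro x
    rw [← (Module.finBasis ℚ F).sum_repr x, map_sum]
    refine sum_mem fun i _ => ?_
    rw [Algebra.smul_def, map_mul]
    refine mul_mem ?_ (Algebra.subset_adjoin ⟨_, ⟨i, rfl⟩, rfl⟩)
    rw [eq_ratCast, map_ratCast, ← map_ratCast (algebraMap ℚ_[p] (PadicAlgCl p))]
    exact E.algebraMap_mem _
  have hcomp : CompleteSpace E := FiniteDimensional.complete ℚ_[p] E
  let g : F →+* E := f.codRestrict E hE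
  let _ : UniformSpace F := UniformSpace.comap (algebraMap F (w.adicCompletion F)) inferInstance
  have hi : IsUniformInducing (algebraMap F (w.adicCompletion F)) := ⟨rfl⟩
  have : IsUniformAddGroup F := IsUniformAddGroup.comap (algebraMap F (w.adicCompletion F))
  have hp1 : ‖(p : PadicAlgCl p)‖ < 1 := by
    rw [← map_natCast (algebraMap ℚ_[p] (PadicAlgCl p)), norm_algebraMap', Padic.norm_p]
    exact inv_lt_one_of_one_lt₀ (by exact_mod_cast (Fact.out : p.Prime).one_lt)
  have hp0 : (p : F) ≠ 0 := by exact_mod_cast (Fact.out : p.Prime).ne_zero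
  have hg : UniformContinuous g := by
    refine uniformContinuous_of_continuousAt_zero g ?_
    rw [ContinuousAt, map_zero, Metric.tendsto_nhds]
    intro ε hε
    obtain ⟨n, hn⟩ := exists_pow_lt_of_lt_one hε hp1
    have h0 : algebraMap F (w.adicCompletion F) ((p : F) ^ n) ≠ 0 := by
      rw [map_ne_zero]
      exact pow_ne_zero _ hp0
    have hopen : {y : w.adicCompletion F | Valued.v y ≤
        Valued.v (algebraMap F (w.adicCompletion F) ((p : F) ^ n))} ∈ nhds 0 :=
      valued_le_mem_nhds_zero h0
    have hn0 : nhds (0 : F) = (nhds (0 : w.adicCompletion F)).comap (algebraMap F _) := by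
      rw [hi.isInducing.nhds_eq_comap, map_zero]
    rw [hn0]
    refine Filter.mem_of_superset (Filter.preimage_mem_comap hopen) fun x hx => ?_
    change Valued.v (algebraMap F (w.adicCompletion F) x) ≤ _ at hx
    rw [valued_algebraMap, valued_algebraMap] at hx
    have h1 : w.valuation F (x / (p : F) ^ n) ≤ 1 := by
      rw [map_div₀]
      exact div_le_one_of_le₀ hx zero_le
    have h2 := norm_map_le_one_of_inert hw f h1
    rw [map_div₀, map_pow, map_natCast, norm_div, norm_pow] at h2
    change dist (f x) (0 : PadicAlgCl p) < ε
    rw [dist_zero_right]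
    refine lt_of_le_of_lt ?_ hn
    have hpos : 0 < ‖(p : PadicAlgCl p)‖ ^ n := by
      refine pow_pos (norm_pos_iff.2 ?_) n
      exact_mod_cast (Fact.out : p.Prime).ne_zero
    rwa [div_le_one hpos] at h2
  have hd : DenseRange (algebraMap F (w.adicCompletion F)) :=
    HeightOneSpectrum.denseRange_algebraMap F w
  let G := IsDenseInducing.extendRingHom hi hd hg
  have hG : Continuous G := (uniformContinuous_uniformly_extend hi hd hg).continuous
  refine ⟨⟨(E.val : E →+* PadicAlgCl p).comp G, continuous_subtype_val.comp hG⟩, ?_⟩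
  refine RingHom.ext fun x => ?_
  have h1 : G (algebraMap F _ x) = g x :=
    IsDenseInducing.extend_eq (hi.isDenseInducing hd) hg.continuous x
  change ((G (algebraMap F _ x) : E) : PadicAlgCl p) = f x
  rw [h1]
  rfl

/-- The embeddings of `F_p` into `ℚ̄_p` are those of `F`. -/
def embEquiv (hw : w.asIdeal = Ideal.span {(p : 𝓞 F)}) : Emb p w ≃ (F →+* PadicAlgCl p) :=
  Equiv.ofBijective (fun τ => τ.1.comp (algebraMap F (w.adicCompletion F)))
    ⟨fun τ τ' h => Subtype.ext <| RingHom.ext <| congrFun <|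
      (HeightOneSpectrum.denseRange_algebraMap F w).equalizer τ.2 τ'.2 <|
        funext fun x => RingHom.congr_fun h x, exists_emb_extending hw⟩

theorem prod_emb_algebraMap (hw : w.asIdeal = Ideal.span {(p : 𝓞 F)}) (x : F) :
    ∏ τ : Emb p w, τ.1 (algebraMap F (w.adicCompletion F) x) =
      algebraMap ℚ (PadicAlgCl p) (Algebra.norm ℚ x) := by
  rw [Algebra.norm_eq_prod_embeddings ℚ (PadicAlgCl p) x]
  exact Fintype.prod_equiv ((embEquiv hw).trans (RingHom.equivRatAlgHom _ _)) _ _ fun τ => rfl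

theorem card_emb (hw : w.asIdeal = Ideal.span {(p : 𝓞 F)}) :
    Fintype.card (Emb p w) = Module.finrank ℚ F := by
  rw [← NumberField.Embeddings.card F (PadicAlgCl p)]
  exact Fintype.card_congr (embEquiv hw)

end Embeddings

/-! ### The reduced norm -/

section ReducedNorm

/-- The extension of scalars of a linear form. -/
def extForm {F : Type*} [Field F] {D : Type*} [Ring D] [Algebra F D] (K : Type*) [Field K]
    [Algebra F K] (φ : D →ₗ[F] F) : K ⊗[F] D →ₗ[K] K :=
  (TensorProduct.AlgebraTensorModule.rid F K K).toLinearMap ∘ₗ φ.baseChange K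

theorem extForm_tmul {F : Type*} [Field F] {D : Type*} [Ring D] [Algebra F D] (K : Type*) [Field K]
    [Algebra F K] (φ : D →ₗ[F] F) (x : D) :
    extForm K φ (1 ⊗ₜ x) = algebraMap F K (φ x) := by
  simp [extForm, Algebra.smul_def]

/-- Two elements of `F` which are the trace and the norm of a noncentral element after some
extension of scalars in which every element is quadratic. -/
theorem exists_sq_eq {F : Type*} [Field F] {D : Type*} [Ring D] [Algebra F D] [Nontrivial D]
    {K : Type*} [Field K] [Algebra F K] {t n : K} {δ : D}
    (hδ : δ ∉ Submodule.span F {(1 : D)})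
    (h : (1 ⊗ₜ (δ * δ) : K ⊗[F] D) = t • (1 ⊗ₜ δ) - n • (1 ⊗ₜ 1)) :
    ∃ t₀ n₀ : F, algebraMap F K t₀ = t ∧ algebraMap F K n₀ = n ∧ δ * δ = t₀ • δ - n₀ • 1 := by
  have hmem : δ * δ ∈ Submodule.span F {(1 : D), δ} := by
    by_contra hnot
    obtain ⟨φ, hφ, hker⟩ := Submodule.exists_le_ker_of_notMem hnot
    have h1 : φ 1 = 0 := hker (Submodule.subset_span (by simp))
    have h2 : φ δ = 0 := hker (Submodule.subset_span (by simp))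
    have h3 := congrArg (extForm K φ) h
    rw [map_sub, map_smul, map_smul, extForm_tmul, extForm_tmul, extForm_tmul, h1, h2, map_zero,
      smul_zero, smul_zero, sub_zero, map_eq_zero] at h3
    exact hφ h3
  obtain ⟨a, b, hab⟩ := Submodule.mem_span_pair.1 hmem
  have hsub : (1 ⊗ₜ (δ * δ) : K ⊗[F] D) =
      algebraMap F K b • (1 ⊗ₜ δ) + algebraMap F K a • (1 ⊗ₜ 1) := by
    rw [← hab, TensorProduct.tmul_add, TensorProduct.tmul_smul, TensorProduct.tmul_smul,
      algebraMap_smul, algebraMap_smul, add_comm]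
  obtain ⟨φ, hφ, hker⟩ := Submodule.exists_le_ker_of_notMem hδ
  have h1 : φ 1 = 0 := hker (Submodule.subset_span (by simp))
  rw [hsub] at h
  have hb : algebraMap F K b = t := by
    have h3 := congrArg (extForm K φ) h
    rw [map_add, map_sub, map_smul, map_smul, map_smul, map_smul, extForm_tmul, extForm_tmul, h1,
      map_zero, smul_zero, smul_zero, sub_zero, add_zero, smul_eq_mul, smul_eq_mul] at h3
    exact mul_right_cancel₀ (by rwa [Ne, map_eq_zero]) h3
  have ha : algebraMap F K (-a) = n := by
    rw [hb, sub_eq_add_neg, add_right_inj, ← neg_smul] at h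
    have h10 : (1 : D) ∉ (⊥ : Submodule F D) := by simp
    obtain ⟨χ, hχ, -⟩ := Submodule.exists_le_ker_of_notMem h10
    have h3 := congrArg (extForm K χ) h
    rw [map_smul, map_smul, extForm_tmul, smul_eq_mul, smul_eq_mul] at h3
    have := mul_right_cancel₀ (by rwa [Ne, map_eq_zero]) h3
    rw [map_neg, this, neg_neg]
  refine ⟨b, -a, hb, ha, ?_⟩
  rw [← hab]
  module

theorem Matrix.sq_fin_two {K : Type*} [CommRing K] (M : Matrix (Fin 2) (Fin 2) K) :
    M * M = M.trace • M - M.det • 1 := by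
  ext i j
  fin_cases i <;> fin_cases j <;>
    simp [Matrix.mul_apply, Fin.sum_univ_two, Matrix.trace, Matrix.det_fin_two] <;> ring

variable {F : Type*} [Field F] [NumberField F] {D : Type*} [Ring D] [Algebra F D]

/-- The determinant of an element of `D` at a finite place lies in `F` and is totally positive. -/
theorem exists_reducedNorm (hD : IsTotallyDefinite F D) {w : HeightOneSpectrum (𝓞 F)}
    (θ : w.adicCompletion F ⊗[F] D ≃ₐ[w.adicCompletion F]
      Matrix (Fin 2) (Fin 2) (w.adicCompletion F)) (δ : Dˣ) :
    ∃ n : F, (θ (1 ⊗ₜ δ.1)).det = algebraMap F _ n ∧ ∀ s : F →+* ℝ, 0 < s n := by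
  have := hD.simple
  by_cases hδ : δ.1 ∈ Submodule.span F {(1 : D)}
  · obtain ⟨z, hz⟩ := Submodule.mem_span_singleton.1 hδ
    have hz0 : z ≠ 0 := by
      rintro rfl
      rw [zero_smul] at hz
      exact δ.ne_zero hz.symm
    refine ⟨z ^ 2, ?_, fun s => ?_⟩
    · have h1 : θ (1 ⊗ₜ δ.1) = algebraMap F (w.adicCompletion F) z • 1 := by
        rw [← hz, TensorProduct.tmul_smul, ← algebraMap_smul (w.adicCompletion F) z, map_smul,
          ← Algebra.TensorProduct.one_def, map_one]
      rw [h1, Matrix.det_smul, Matrix.det_one, mul_one, Fintype.card_fin, map_pow]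
    · rw [map_pow]
      have : s z ≠ 0 := (map_ne_zero s).2 hz0
      positivity
  · have h1 : (1 ⊗ₜ (δ.1 * δ.1) : w.adicCompletion F ⊗[F] D) =
        (θ (1 ⊗ₜ δ.1)).trace • (1 ⊗ₜ δ.1) - (θ (1 ⊗ₜ δ.1)).det • (1 ⊗ₜ 1) := by
      apply θ.injective
      have e : (1 ⊗ₜ (δ.1 * δ.1) : w.adicCompletion F ⊗[F] D) = (1 ⊗ₜ δ.1) * (1 ⊗ₜ δ.1) := by
        rw [Algebra.TensorProduct.tmul_mul_tmul, mul_one]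
      rw [e, map_mul, map_sub, map_smul, map_smul, ← Algebra.TensorProduct.one_def, map_one]
      exact Matrix.sq_fin_two _
    obtain ⟨t, n, -, hn, h2⟩ := exists_sq_eq hδ h1
    refine ⟨n, hn.symm, fun s => ?_⟩
    let _ := s.toAlgebra
    obtain ⟨e⟩ := hD.ramified s
    set q := e (1 ⊗ₜ δ.1) with hq
    have h3 : q * q = s t • q - s n • 1 := by
      rw [hq, ← map_mul, Algebra.TensorProduct.tmul_mul_tmul, mul_one, h2, TensorProduct.tmul_sub,
        TensorProduct.tmul_smul, TensorProduct.tmul_smul, ← algebraMap_smul ℝ t,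
        ← algebraMap_smul ℝ n, map_sub, map_smul, map_smul, ← Algebra.TensorProduct.one_def,
        map_one]
      rfl
    have o1 : (1 : Quaternion ℝ).re = 1 := rfl
    have o2 : (1 : Quaternion ℝ).imI = 0 := rfl
    have o3 : (1 : Quaternion ℝ).imJ = 0 := rfl
    have o4 : (1 : Quaternion ℝ).imK = 0 := rfl
    -- the image of a noncentral element is not real
    have h4 : ¬ (q.imI = 0 ∧ q.imJ = 0 ∧ q.imK = 0) := by
      rintro ⟨hi, hj, hk⟩
      have h5 : q = q.re • (1 : Quaternion ℝ) := by
        ext <;> simp [hi, hj, hk, o1, o2, o3, o4]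
      have h6 : (1 ⊗ₜ δ.1 : ℝ ⊗[F] D) = q.re • (1 ⊗ₜ 1) := by
        apply e.injective
        rw [map_smul, ← Algebra.TensorProduct.one_def, map_one, ← h5]
      obtain ⟨φ, hφ, hker⟩ := Submodule.exists_le_ker_of_notMem hδ
      have h7 : φ 1 = 0 := hker (Submodule.subset_span (by simp))
      have h8 := congrArg (extForm ℝ φ) h6
      rw [map_smul, extForm_tmul, extForm_tmul, h7, map_zero, smul_zero, map_eq_zero] at h8
      exact hφ h8
    have e1 := congrArg QuaternionAlgebra.re h3
    have e2 := congrArg QuaternionAlgebra.imI h3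
    have e3 := congrArg QuaternionAlgebra.imJ h3
    have e4 := congrArg QuaternionAlgebra.imK h3
    simp [o1, o2, o3, o4] at e1 e2 e3 e4
    have h9 : s t = 2 * q.re := by
      by_contra hne
      have hne' : s t - 2 * q.re ≠ 0 := sub_ne_zero.2 hne
      refine h4 ⟨?_, ?_, ?_⟩
      · exact (mul_eq_zero.1 (show (s t - 2 * q.re) * q.imI = 0 by linarith)).resolve_left hne'
      · exact (mul_eq_zero.1 (show (s t - 2 * q.re) * q.imJ = 0 by linarith)).resolve_left hne'
      · exact (mul_eq_zero.1 (show (s t - 2 * q.re) * q.imK = 0 by linarith)).resolve_left hne'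
    have h10 : s n = q.re ^ 2 + q.imI ^ 2 + q.imJ ^ 2 + q.imK ^ 2 := by
      rw [h9] at e1
      linarith
    rw [h10]
    by_contra hle
    refine h4 ⟨?_, ?_, ?_⟩ <;>
      nlinarith [sq_nonneg q.re, sq_nonneg q.imI, sq_nonneg q.imJ, sq_nonneg q.imK]

/-- The norm of a totally positive element of a totally real field is positive. -/
theorem norm_pos_of_totally_positive [NumberField.IsTotallyReal F] {n : F}
    (hn : ∀ s : F →+* ℝ, 0 < s n) : 0 < Algebra.norm ℚ n := by
  have h : ∃ r : ℝ, 0 < r ∧ (∏ σ : F →ₐ[ℚ] ℂ, σ n) = r := by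
    refine Finset.prod_induction _ (fun z : ℂ => ∃ r : ℝ, 0 < r ∧ z = r) ?_ ⟨1, one_pos, by simp⟩
      fun σ _ => ?_
    · rintro _ _ ⟨a, ha, rfl⟩ ⟨b, hb, rfl⟩
      exact ⟨a * b, mul_pos ha hb, by simp⟩
    · have hσ := NumberField.IsTotallyReal.complexEmbedding_isReal (σ : F →+* ℂ)
      exact ⟨hσ.embedding n, hn _, (hσ.coe_embedding_apply n).symm⟩
  obtain ⟨r, hr, h⟩ := h
  rw [← Algebra.norm_eq_prod_embeddings, eq_ratCast] at h
  have h1 : ((Algebra.norm ℚ n : ℚ) : ℝ) = r := by exact_mod_cast h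
  exact_mod_cast h1 ▸ hr

end ReducedNorm

/-! ### The adelic absolute value of the reduced norm -/

section AdelicNorm

theorem norm_matrix_fin_two {K : Type*} [Field K] (M : Matrix (Fin 2) (Fin 2) K) :
    Algebra.norm K M = M.det ^ 2 := by
  rw [Algebra.norm_eq_matrix_det (Matrix.stdBasis K (Fin 2) (Fin 2)) M]
  have h : Algebra.leftMulMatrix (Matrix.stdBasis K (Fin 2) (Fin 2)) M =
      Matrix.kroneckerMap (fun a b => a * b) M (1 : Matrix (Fin 2) (Fin 2) K) := by
    ext ⟨i, j⟩ ⟨k, l⟩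
    rw [Algebra.leftMulMatrix_eq_repr_mul, Matrix.stdBasis_eq_single]
    change (M * Matrix.single k l (1 : K)) i j = M i k * (1 : Matrix (Fin 2) (Fin 2) K) j l
    rcases eq_or_ne l j with rfl | h
    · simp
    · simp [h.symm]
  rw [h, Matrix.det_kronecker]
  simp

variable {F : Type*} [Field F] [NumberField F] {D : Type*} [Ring D] [Algebra F D]

theorem evalAt_repr {ι : Type*} (b : Module.Basis ι F D) (v : HeightOneSpectrum (𝓞 F))
    (x : AdelicAlg F D) (i : ι) :
    evalAt v ((Algebra.TensorProduct.basis (FiniteAdeleRing (𝓞 F) F) b).repr x i) =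
      (Algebra.TensorProduct.basis (v.adicCompletion F) b).repr (component D v x) i := by
  induction x using TensorProduct.induction_on with
  | zero => simp
  | add x y hx hy => simp only [map_add, Finsupp.add_apply, hx, hy]
  | tmul a d => simp [component]

theorem evalAt_norm [Module.Finite F D] (v : HeightOneSpectrum (𝓞 F)) (x : AdelicAlg F D) :
    evalAt v (Algebra.norm (FiniteAdeleRing (𝓞 F) F) x) =
      Algebra.norm (v.adicCompletion F) (component D v x) := by
  let b := Module.finBasis F D
  rw [Algebra.norm_eq_matrix_det (Algebra.TensorProduct.basis (FiniteAdeleRing (𝓞 F) F) b),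
    Algebra.norm_eq_matrix_det (Algebra.TensorProduct.basis (v.adicCompletion F) b)]
  change (evalAt v).toRingHom (Matrix.det _) = _
  rw [RingHom.map_det]
  congr 1
  refine Matrix.ext fun i j => ?_
  rw [RingHom.mapMatrix_apply, Matrix.map_apply, Algebra.leftMulMatrix_eq_repr_mul,
    Algebra.leftMulMatrix_eq_repr_mul]
  refine (evalAt_repr b v _ i).trans ?_
  rw [map_mul, Algebra.TensorProduct.basis_apply, Algebra.TensorProduct.basis_apply]
  simp [component]

theorem det_pComp_sq [Module.Finite F D] {v : HeightOneSpectrum (𝓞 F)}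
    (θ : v.adicCompletion F ⊗[F] D ≃ₐ[v.adicCompletion F]
      Matrix (Fin 2) (Fin 2) (v.adicCompletion F)) (x : Gf F D) :
    (pComp θ x).det ^ 2 = evalAt v (Algebra.norm (FiniteAdeleRing (𝓞 F) F) x.1) := by
  rw [evalAt_norm, ← Algebra.norm_eq_of_algEquiv θ, norm_matrix_fin_two]
  rfl

theorem continuous_norm_adelicAlg [Module.Finite F D] :
    letI : TopologicalSpace (AdelicAlg F D) := moduleTopology (FiniteAdeleRing (𝓞 F) F) _
    Continuous fun x : AdelicAlg F D => Algebra.norm (FiniteAdeleRing (𝓞 F) F) x := by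
  let _ : TopologicalSpace (AdelicAlg F D) := moduleTopology (FiniteAdeleRing (𝓞 F) F) _
  have : IsModuleTopology (FiniteAdeleRing (𝓞 F) F) (AdelicAlg F D) := ⟨rfl⟩
  let B := Algebra.TensorProduct.basis (FiniteAdeleRing (𝓞 F) F) (Module.finBasis F D)
  simp only [Algebra.norm_eq_matrix_det B]
  refine Continuous.matrix_det (continuous_matrix fun i j => ?_)
  simp only [Algebra.leftMulMatrix_eq_repr_mul]
  exact IsModuleTopology.continuous_of_linearMap
    (B.coord i ∘ₗ LinearMap.mulRight (FiniteAdeleRing (𝓞 F) F) (B j))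

open scoped Classical in
/-- The normalized absolute value of `F_v`, with values in `ℚ`. -/
def absAt (v : HeightOneSpectrum (𝓞 F)) (x : v.adicCompletion F) : ℚ :=
  if x = 0 then 0 else (Ideal.absNorm v.asIdeal : ℚ) ^ WithZero.log (Valued.v x)

theorem coe_absAt (v : HeightOneSpectrum (𝓞 F)) (x : v.adicCompletion F) :
    (absAt v x : ℝ) = ‖x‖ := by
  rw [absAt]
  split_ifs with h
  · rw [h, norm_zero, Rat.cast_zero]
  · have h0 : Valued.v x ≠ 0 := (Valuation.ne_zero_iff _).2 h
    rw [NumberField.FinitePlace.norm_def, WithZeroMulInt.toNNReal_neg_apply _ h0]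
    push_cast
    congr 1
    conv_lhs => rw [← WithZero.coe_unzero h0]
    rfl

theorem absAt_mul (v : HeightOneSpectrum (𝓞 F)) (x y : v.adicCompletion F) :
    absAt v (x * y) = absAt v x * absAt v y := by
  have : ((absAt v (x * y) : ℚ) : ℝ) = ((absAt v x * absAt v y : ℚ) : ℝ) := by
    rw [Rat.cast_mul, coe_absAt, coe_absAt, coe_absAt, norm_mul]
  exact_mod_cast this

theorem absAt_one (v : HeightOneSpectrum (𝓞 F)) : absAt v 1 = 1 := by
  have : ((absAt v 1 : ℚ) : ℝ) = ((1 : ℚ) : ℝ) := by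
    rw [coe_absAt, norm_one, Rat.cast_one]
  exact_mod_cast this

theorem absAt_eq_one_of_norm {v : HeightOneSpectrum (𝓞 F)} {x : v.adicCompletion F}
    (h : ‖x‖ = 1) : absAt v x = 1 := by
  have : ((absAt v x : ℚ) : ℝ) = ((1 : ℚ) : ℝ) := by rw [coe_absAt, h, Rat.cast_one]
  exact_mod_cast this

variable (Θ : ∀ v : HeightOneSpectrum (𝓞 F), v.adicCompletion F ⊗[F] D ≃ₐ[v.adicCompletion F]
  Matrix (Fin 2) (Fin 2) (v.adicCompletion F))

theorem finite_mulSupport_absAt [Module.Finite F D] (x : Gf F D) :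
    (Function.mulSupport fun v => absAt v (pComp (Θ v) x).det).Finite := by
  have hu : IsUnit (Algebra.norm (FiniteAdeleRing (𝓞 F) F) x.1) := x.isUnit.map _
  refine (Filter.eventually_cofinite.1 (FiniteAdeleRing.isUnit_iff.1 hu).2).subset fun v hv => ?_
  rw [Set.mem_ofPred_eq]
  refine fun h => hv (absAt_eq_one_of_norm ?_)
  have h1 := congrArg Valued.v (det_pComp_sq (Θ v) x)
  change _ = Valued.v ((Algebra.norm (FiniteAdeleRing (𝓞 F) F) x.1) v) at h1
  rw [h, map_pow] at h1
  have h2 : Valued.v (pComp (Θ v) x).det = 1 := (pow_eq_one_iff_of_nonneg zero_le two_ne_zero).1 h1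
  rw [NumberField.FinitePlace.norm_def, h2, map_one, NNReal.coe_one]

/-- The adelic absolute value of the reduced norm of an element of `G_f`. -/
def adelicAbs [Module.Finite F D] : Gf F D →* ℚ where
  toFun x := ∏ᶠ v, absAt v (pComp (Θ v) x).det
  map_one' := by
    refine finprod_eq_one_of_forall_eq_one fun v => ?_
    rw [map_one, Matrix.det_one, absAt_one]
  map_mul' x y := by
    rw [← finprod_mul_distrib (finite_mulSupport_absAt Θ x) (finite_mulSupport_absAt Θ y)]
    refine finprod_congr fun v => ?_
    rw [map_mul, Matrix.det_mul, absAt_mul]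

/-- The reduced norm is a unit everywhere on a compact subgroup, since its powers are bounded. -/
theorem adelicAbs_eq_one_of_mem [Module.Finite F D] {U : Subgroup (Gf F D)}
    (hU : IsOpenCompact F D U) {u : Gf F D} (hu : u ∈ U) : adelicAbs Θ u = 1 := by
  refine finprod_eq_one_of_forall_eq_one fun v => absAt_eq_one_of_norm ?_
  let _ : TopologicalSpace (AdelicAlg F D) := moduleTopology (FiniteAdeleRing (𝓞 F) F) _
  have hc : Continuous fun x : Gf F D =>
      evalAt v (Algebra.norm (FiniteAdeleRing (𝓞 F) F) x.1) :=
    (RestrictedProduct.continuous_eval v).comp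
      (continuous_norm_adelicAlg.comp Units.continuous_val)
  obtain ⟨C, hC⟩ := hU.2.exists_bound_of_continuousOn hc.continuousOn
  have hle : ∀ u ∈ U, ‖(pComp (Θ v) u).det‖ ≤ 1 := by
    intro u hu
    by_contra! h
    obtain ⟨n, hn⟩ := pow_unbounded_of_one_lt C h
    have h1 := hC (u ^ n) (pow_mem hu n)
    rw [← det_pComp_sq (Θ v), map_pow, Matrix.det_pow, norm_pow, norm_pow] at h1
    have h2 : (1 : ℝ) ≤ ‖(pComp (Θ v) u).det‖ ^ n := one_le_pow₀ h.le
    nlinarith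
  refine le_antisymm (hle u hu) ?_
  have h1 := hle _ (inv_mem hu)
  have h2 : ‖(pComp (Θ v) u).det‖ * ‖(pComp (Θ v) u⁻¹).det‖ = 1 := by
    rw [← norm_mul, ← Matrix.det_mul, ← map_mul, mul_inv_cancel, map_one, Matrix.det_one, norm_one]
  nlinarith [norm_nonneg (pComp (Θ v) u).det, norm_nonneg (pComp (Θ v) u⁻¹).det]

theorem pComp_diag {v : HeightOneSpectrum (𝓞 F)}
    (θ : v.adicCompletion F ⊗[F] D ≃ₐ[v.adicCompletion F]
      Matrix (Fin 2) (Fin 2) (v.adicCompletion F)) (δ : Dˣ) :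
    pComp θ (diag F D δ) = θ (1 ⊗ₜ δ.1) := by
  change θ (component D v (1 ⊗ₜ δ.1)) = _
  simp [component]

theorem finprod_norm_algebraMap {n : F} (hn : n ≠ 0) :
    ∏ᶠ v : HeightOneSpectrum (𝓞 F), ‖algebraMap F (v.adicCompletion F) n‖ =
      ((|Algebra.norm ℚ n|⁻¹ : ℚ) : ℝ) := by
  rw [← NumberField.FinitePlace.prod_eq_inv_abs_norm hn,
    ← finprod_comp_equiv NumberField.FinitePlace.equivHeightOneSpectrum.symm]
  rfl

/-- On `Dˣ` the adelic absolute value of the reduced norm is given by the product formula. -/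
theorem adelicAbs_diag [Module.Finite F D] (δ : Dˣ) {n : F} (hn : n ≠ 0)
    {w : HeightOneSpectrum (𝓞 F)} (h : (Θ w (1 ⊗ₜ δ.1)).det = algebraMap F _ n) :
    adelicAbs Θ (diag F D δ) = |Algebra.norm ℚ n|⁻¹ := by
  -- the square of the determinant at each place is the norm from `D` to `F`
  have hsq : ∀ v, (pComp (Θ v) (diag F D δ)).det ^ 2 =
      algebraMap F (v.adicCompletion F) (Algebra.norm F δ.1) := by
    intro v
    rw [pComp_diag, ← norm_matrix_fin_two, Algebra.norm_eq_of_algEquiv]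
    rw [Algebra.norm_apply, Algebra.norm_apply, ← LinearMap.det_baseChange]
    congr 1
    refine TensorProduct.AlgebraTensorModule.ext fun a x => ?_
    simp
  have hn2 : Algebra.norm F δ.1 = n ^ 2 := by
    apply (algebraMap F (w.adicCompletion F)).injective
    rw [← hsq w, pComp_diag, h, map_pow]
  have habs : ∀ v, (absAt v (pComp (Θ v) (diag F D δ)).det : ℝ) =
      ‖algebraMap F (v.adicCompletion F) n‖ := by
    intro v
    have h1 := congrArg norm (hsq v)
    rw [hn2, map_pow, norm_pow, norm_pow] at h1
    rw [coe_absAt]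
    exact (pow_left_inj₀ (norm_nonneg _) (norm_nonneg _) two_ne_zero).1 h1
  have hcast : ((adelicAbs Θ (diag F D δ) : ℚ) : ℝ) = ((|Algebra.norm ℚ n|⁻¹ : ℚ) : ℝ) := by
    rw [← finprod_norm_algebraMap hn]
    simp only [← habs]
    exact (Rat.castHom ℝ).toMonoidHom.map_finprod_of_preimage_one
      (fun x hx => by
        have h1 : (x : ℝ) = 1 := hx
        exact_mod_cast h1) _
  exact_mod_cast hcast

theorem component_singleComponent_of_ne {v w : HeightOneSpectrum (𝓞 F)} (h : v ≠ w)
    (x : w.adicCompletion F ⊗[F] D) : component D v (singleComponent D w x) = 0 := by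
  induction x with
  | zero => simp
  | add x₁ x₂ h₁ h₂ => simp only [map_add, h₁, h₂, add_zero]
  | tmul a b =>
    have : evalAt v (singleAt w a) = 0 := singleFun_ne w a v h
    simp [component, singleComponent, this]

theorem pComp_eta_of_ne {p : ℕ} [Fact p.Prime] {v w : HeightOneSpectrum (𝓞 F)} (h : v ≠ w)
    (θ' : v.adicCompletion F ⊗[F] D ≃ₐ[v.adicCompletion F]
      Matrix (Fin 2) (Fin 2) (v.adicCompletion F))
    (θ : w.adicCompletion F ⊗[F] D ≃ₐ[w.adicCompletion F]
      Matrix (Fin 2) (Fin 2) (w.adicCompletion F)) : pComp θ' (eta θ p) = 1 := by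
  change θ' (component D v (eta θ p).1) = 1
  simp [eta, localUnit, component_singleComponent_of_ne h]

theorem adelicAbs_eta [Module.Finite F D] {p : ℕ} [Fact p.Prime] {w : HeightOneSpectrum (𝓞 F)}
    (hw : w.asIdeal = Ideal.span {(p : 𝓞 F)}) :
    adelicAbs Θ (eta (Θ w) p) = ((p : ℚ) ^ Module.finrank ℚ F)⁻¹ := by
  have h0 : (p : F) ≠ 0 := by exact_mod_cast (Fact.out : p.Prime).ne_zero
  have h1 : adelicAbs Θ (eta (Θ w) p) = absAt w (p : w.adicCompletion F) := by
    refine (finprod_eq_single _ w fun v hv => ?_).trans ?_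
    · rw [pComp_eta_of_ne hv, Matrix.det_one, absAt_one]
    · rw [pComp_eta, Matrix.det_fin_two_of]
      simp
  -- the prime `w` is the only one at which `p` is not a unit
  have h2 := finprod_norm_algebraMap h0
  rw [finprod_eq_single _ w fun v hv => ?_] at h2
  · have h3 : ((absAt w (p : w.adicCompletion F) : ℚ) : ℝ) =
        ((|Algebra.norm ℚ (p : F)|⁻¹ : ℚ) : ℝ) := by
      rw [coe_absAt, ← h2, map_natCast]
    have h4 : Algebra.norm ℚ (p : F) = (p : ℚ) ^ Module.finrank ℚ F := by
      rw [← map_natCast (algebraMap ℚ F), Algebra.norm_algebraMap]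
    rw [h1, ← abs_of_nonneg (by positivity : (0 : ℚ) ≤ (p : ℚ) ^ Module.finrank ℚ F), ← h4]
    exact_mod_cast h3
  · have : (p : 𝓞 F) ∉ v.asIdeal := by
      intro hp
      refine hv (HeightOneSpectrum.ext ?_)
      have hle : w.asIdeal ≤ v.asIdeal := by
        rw [hw, Ideal.span_singleton_le_iff_mem]
        exact hp
      exact (w.isMaximal.eq_of_le v.isPrime.ne_top hle).symm
    have := (NumberField.FinitePlace.norm_eq_one_iff_notMem F v (p : 𝓞 F)).2 this
    rw [map_natCast] at this
    exact this

/-- The character of `Dˣ \ G_f` which is the norm of the reduced norm at `p`, divided by its part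
outside of `p`. -/
theorem exists_character [NumberField.IsTotallyReal F] (hD : IsTotallyDefinite F D) {p : ℕ}
    [Fact p.Prime] {w : HeightOneSpectrum (𝓞 F)} (hw : w.asIdeal = Ideal.span {(p : 𝓞 F)})
    {θ : w.adicCompletion F ⊗[F] D ≃ₐ[w.adicCompletion F]
      Matrix (Fin 2) (Fin 2) (w.adicCompletion F)} (𝓤 : Level θ p) :
    ∃ ψ : Gf F D →* PadicAlgCl p, (∀ δ, ψ (diag F D δ) = 1) ∧
      (∀ u (hu : u ∈ 𝓤.U), ψ u = ∏ τ : Emb p w, τ.1 (pInt θ ⟨u, 𝓤.integral hu⟩).det) ∧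
      ψ (eta θ p) = 1 := by
  classical
  have : Module.Finite F D := Module.finite_of_finrank_pos (by rw [hD.finrank_eq]; norm_num)
  obtain ⟨Θ, rfl⟩ : ∃ Θ : ∀ v : HeightOneSpectrum (𝓞 F),
      v.adicCompletion F ⊗[F] D ≃ₐ[v.adicCompletion F]
        Matrix (Fin 2) (Fin 2) (v.adicCompletion F), Θ w = θ :=
    ⟨Function.update (fun v => (hD.unramified v).some) w θ, Function.update_self _ _ _⟩
  let ψ : Gf F D →* PadicAlgCl p :=
    { toFun x := (∏ τ : Emb p w, τ.1 (pComp (Θ w) x).det) *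
        algebraMap ℚ (PadicAlgCl p) (adelicAbs Θ x)
      map_one' := by simp
      map_mul' x y := by
        simp only [map_mul, Matrix.det_mul, Finset.prod_mul_distrib]
        ring }
  refine ⟨ψ, fun δ => ?_, fun u hu => ?_, ?_⟩
  · obtain ⟨n, hn, hpos⟩ := exists_reducedNorm hD (Θ w) δ
    have hN := norm_pos_of_totally_positive hpos
    have hn0 : n ≠ 0 := by
      rintro rfl
      rw [Algebra.norm_zero] at hN
      exact lt_irrefl _ hN
    change (∏ τ : Emb p w, τ.1 (pComp (Θ w) (diag F D δ)).det) *
        algebraMap ℚ (PadicAlgCl p) (adelicAbs Θ (diag F D δ)) = 1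
    rw [adelicAbs_diag Θ δ hn0 hn, pComp_diag, hn, prod_emb_algebraMap hw, ← map_mul,
      abs_of_pos hN, mul_inv_cancel₀ hN.ne', map_one]
  · change (∏ τ : Emb p w, τ.1 (pComp (Θ w) u).det) *
        algebraMap ℚ (PadicAlgCl p) (adelicAbs Θ u) = _
    rw [adelicAbs_eq_one_of_mem Θ 𝓤.isOpenCompact hu, map_one, mul_one]
    refine Finset.prod_congr rfl fun τ _ => congrArg τ.1 ?_
    exact ((w.adicCompletionIntegers F).subtype.map_det (pInt (Θ w) ⟨u, 𝓤.integral hu⟩)).symm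
  · change (∏ τ : Emb p w, τ.1 (pComp (Θ w) (eta (Θ w) p)).det) *
        algebraMap ℚ (PadicAlgCl p) (adelicAbs Θ (eta (Θ w) p)) = 1
    have hp0 : (p : PadicAlgCl p) ≠ 0 := by exact_mod_cast (Fact.out : p.Prime).ne_zero
    rw [adelicAbs_eta Θ hw, pComp_eta, Matrix.det_fin_two_of]
    simp only [mul_one, mul_zero, sub_zero, map_natCast, Finset.prod_const, Finset.card_univ,
      card_emb hw, map_inv₀, map_pow]
    exact mul_inv_cancel₀ (pow_ne_zero _ hp0)

end AdelicNorm

/-! ### Lattices in division algebras over `ℚ` -/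

section Lattice

variable {D ι : Type*} [Ring D] [Algebra ℚ D] [Fintype ι] (e : Module.Basis ι ℚ D)

theorem leftMulMatrix_eq_sum [DecidableEq ι] (z : D) :
    Algebra.leftMulMatrix e z = ∑ i, e.repr z i • Algebra.leftMulMatrix e (e i) := by
  conv_lhs => rw [← e.sum_repr z]
  simp only [map_sum, map_smul]

/-- Elements with small coordinates have small norm. -/
theorem exists_abs_norm_lt_one [Nontrivial D] :
    ∃ ε : ℝ, 0 < ε ∧ ∀ z : D, (∀ i, |(e.repr z i : ℝ)| < ε) → |Algebra.norm ℚ z| < 1 := by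
  classical
  have : Nonempty ι := e.index_nonempty
  let A : ι → Matrix ι ι ℝ := fun i => (Rat.castHom ℝ).mapMatrix (Algebra.leftMulMatrix e (e i))
  let f : (ι → ℝ) → ℝ := fun t => (∑ i, t i • A i).det
  have hf : Continuous f := by
    refine Continuous.matrix_det (continuous_finsetSum _ fun i _ => ?_)
    exact (continuous_apply i).smul continuous_const
  have hf0 : f 0 = 0 := by
    simp only [f, Pi.zero_apply, zero_smul, Finset.sum_const_zero]
    exact Matrix.det_zero
  obtain ⟨ε, hε, h⟩ := Metric.continuousAt_iff.1 (hf.continuousAt (x := 0)) 1 one_pos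
  refine ⟨ε, hε, fun z hz => ?_⟩
  have h1 : f (fun i => (e.repr z i : ℝ)) = (Algebra.norm ℚ z : ℝ) := by
    rw [Algebra.norm_eq_matrix_det e, leftMulMatrix_eq_sum e z]
    change _ = Rat.castHom ℝ _
    rw [RingHom.map_det, map_sum]
    refine congrArg Matrix.det (Finset.sum_congr rfl fun i _ => ?_)
    ext a b
    simp [A]
  have h2 := h (x := fun i => (e.repr z i : ℝ)) (by
    rw [dist_pi_lt_iff hε]
    intro i
    rw [Pi.zero_apply, Real.dist_0_eq_abs]
    exact hz i)
  rw [hf0, h1, Real.dist_0_eq_abs] at h2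
  exact_mod_cast h2

/-- Simultaneous approximation: a bounded multiple of `z` differs from a lattice element by an
element of norm less than `1`. -/
theorem exists_abs_norm_smul_sub_lt_one [Nontrivial D] :
    ∃ C : ℕ, ∀ z : D, ∃ r : ℕ, 0 < r ∧ r ≤ C ∧ ∃ q : D, (∀ i, ∃ c : ℤ, e.repr q i = c) ∧
      |Algebra.norm ℚ ((r : ℚ) • z - q)| < 1 := by
  classical
  obtain ⟨ε, hε, h⟩ := exists_abs_norm_lt_one e
  obtain ⟨N, hN⟩ := exists_nat_one_div_lt hε
  refine ⟨(N + 1) ^ Fintype.card ι, fun z => ?_⟩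
  have hN0 : (0 : ℝ) < N + 1 := by positivity
  -- the pigeonhole principle for the boxes of side `1 / (N + 1)` in the unit cube
  let g : Fin ((N + 1) ^ Fintype.card ι + 1) → ι → Fin (N + 1) := fun r i =>
    ⟨⌊Int.fract ((r : ℚ) * e.repr z i) * (N + 1)⌋₊, by
      rw [Nat.floor_lt (by positivity)]
      push_cast
      have := Int.fract_lt_one ((r : ℚ) * e.repr z i)
      have h0 : (0 : ℚ) < N + 1 := by positivity
      nlinarith⟩
  obtain ⟨r₁, r₂, hne, heq⟩ := Fintype.exists_ne_map_eq_of_card_lt g (by simp)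
  wlog hlt : r₁ < r₂ generalizing r₁ r₂
  · exact this r₂ r₁ hne.symm heq.symm (lt_of_le_of_ne (not_lt.1 hlt) hne.symm)
  have hlt' : (r₁ : ℕ) < r₂ := hlt
  refine ⟨r₂ - r₁, by omega, by omega,
    e.equivFun.symm fun i => ((⌊(r₂ : ℚ) * e.repr z i⌋ - ⌊(r₁ : ℚ) * e.repr z i⌋ : ℤ) : ℚ),
    fun i => ⟨⌊(r₂ : ℚ) * e.repr z i⌋ - ⌊(r₁ : ℚ) * e.repr z i⌋, ?_⟩, h _ fun i => ?_⟩
  · rw [← e.equivFun_apply, LinearEquiv.apply_symm_apply]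
  · have hi : ⌊Int.fract ((r₁ : ℚ) * e.repr z i) * (N + 1)⌋₊ =
        ⌊Int.fract ((r₂ : ℚ) * e.repr z i) * (N + 1)⌋₊ :=
      congrArg Fin.val (congrFun heq i)
    have h1 : e.repr (((r₂ - r₁ : ℕ) : ℚ) • z - e.equivFun.symm fun i =>
        ((⌊(r₂ : ℚ) * e.repr z i⌋ - ⌊(r₁ : ℚ) * e.repr z i⌋ : ℤ) : ℚ)) i =
        Int.fract ((r₂ : ℚ) * e.repr z i) - Int.fract ((r₁ : ℚ) * e.repr z i) := by
      rw [map_sub, map_smul, Finsupp.sub_apply, ← e.equivFun_apply (e.equivFun.symm _),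
        LinearEquiv.apply_symm_apply, Finsupp.smul_apply, smul_eq_mul, Nat.cast_sub hlt'.le,
        Int.fract, Int.fract]
      push_cast
      ring
    have a1 := Nat.floor_le (a := Int.fract ((r₁ : ℚ) * e.repr z i) * (N + 1)) (by positivity)
    have a2 := Nat.floor_le (a := Int.fract ((r₂ : ℚ) * e.repr z i) * (N + 1)) (by positivity)
    have b1 := Nat.lt_floor_add_one (Int.fract ((r₁ : ℚ) * e.repr z i) * (N + 1))
    have b2 := Nat.lt_floor_add_one (Int.fract ((r₂ : ℚ) * e.repr z i) * (N + 1))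
    rw [hi] at a1 b1
    have h2 : |(Int.fract ((r₂ : ℚ) * e.repr z i) - Int.fract ((r₁ : ℚ) * e.repr z i)) *
        (N + 1)| < 1 := by
      rw [abs_lt]
      constructor <;> linarith
    rw [abs_mul, abs_of_pos (by positivity : (0 : ℚ) < N + 1)] at h2
    rw [h1]
    refine lt_trans ?_ hN
    rw [lt_div_iff₀ hN0]
    exact_mod_cast h2

theorem exists_int_norm_eq (he : ∀ i j k, ∃ c : ℤ, e.repr (e i * e j) k = c) {z : D}
    (hz : ∀ i, ∃ c : ℤ, e.repr z i = c) : ∃ m : ℤ, Algebra.norm ℚ z = m := by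
  classical
  choose c hc using he
  choose t ht using hz
  refine ⟨(Matrix.of fun k j => ∑ i, t i * c i j k : Matrix ι ι ℤ).det, ?_⟩
  rw [Algebra.norm_eq_matrix_det e]
  change _ = Int.castRingHom ℚ _
  rw [RingHom.map_det, leftMulMatrix_eq_sum e z]
  congr 1
  ext k j
  simp [Matrix.sum_apply, Algebra.leftMulMatrix_eq_repr_mul, hc, ht]

/-- In a division algebra over `ℚ`, a lattice which is a left module under an order `Λ` contains a
principal module of bounded index, generated by an element of minimal norm. -/
theorem exists_smul_mem_principal [Nontrivial D] (hunit : ∀ x : D, x ≠ 0 → IsUnit x)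
    (he : ∀ i j k, ∃ c : ℤ, e.repr (e i * e j) k = c) :
    ∃ C : ℕ, 0 < C ∧ ∀ M : AddSubgroup D,
      (∀ q : D, (∀ i, ∃ c : ℤ, e.repr q i = c) → ∀ y ∈ M, q * y ∈ M) →
      (∃ y ∈ M, y ≠ 0) → (∃ t : D, t ≠ 0 ∧ ∀ y ∈ M, ∀ i, ∃ c : ℤ, e.repr (t * y) i = c) →
      ∃ x ∈ M, x ≠ 0 ∧ ∀ y ∈ M, ∃ q : D, (∀ i, ∃ c : ℤ, e.repr q i = c) ∧ (C : ℚ) • y = q * x := by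
  classical
  obtain ⟨C, hC⟩ := exists_abs_norm_smul_sub_lt_one e
  refine ⟨C.factorial, C.factorial_pos, fun M hM hne ⟨t, ht0, ht⟩ => ?_⟩
  have hnorm : ∀ y ∈ M, ∃ m : ℕ, |Algebra.norm ℚ (t * y)| = m := by
    intro y hy
    obtain ⟨m, hm⟩ := exists_int_norm_eq e he (ht y hy)
    exact ⟨m.natAbs, by rw [hm, Nat.cast_natAbs, Int.cast_abs]⟩
  have hex : ∃ m : ℕ, ∃ y ∈ M, y ≠ 0 ∧ |Algebra.norm ℚ (t * y)| = m := by
    obtain ⟨y, hy, hy0⟩ := hne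
    obtain ⟨m, hm⟩ := hnorm y hy
    exact ⟨m, y, hy, hy0, hm⟩
  obtain ⟨x, hx, hx0, hxm⟩ := Nat.find_spec hex
  refine ⟨x, hx, hx0, fun y hy => ?_⟩
  obtain ⟨u, rfl⟩ := hunit x hx0
  obtain ⟨r, hr0, hrC, q, hq, hlt⟩ := hC (y * (u⁻¹ : Dˣ))
  have hmem : (r : ℚ) • y - q * u ∈ M := by
    refine M.sub_mem ?_ (hM q hq _ hx)
    rw [Nat.cast_smul_eq_nsmul]
    exact M.nsmul_mem hy r
  have hfac : (r : ℚ) • y - q * u = ((r : ℚ) • (y * (u⁻¹ : Dˣ)) - q) * u := by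
    rw [sub_mul, smul_mul_assoc, mul_assoc, Units.inv_mul, mul_one]
  -- the remainder has smaller norm, hence vanishes
  have hzero : (r : ℚ) • y - q * u = 0 := by
    by_contra hne0
    obtain ⟨m, hm⟩ := hnorm _ hmem
    refine Nat.find_min hex (m := m) ?_ ⟨_, hmem, hne0, hm⟩
    have h1 : (m : ℚ) < (Nat.find hex : ℕ) := by
      rw [← hm, ← hxm, hfac, map_mul, map_mul, map_mul, abs_mul, abs_mul, abs_mul]
      have htpos : 0 < |Algebra.norm ℚ t| * |Algebra.norm ℚ (u : D)| :=
        mul_pos (abs_pos.2 ((hunit t ht0).map (Algebra.norm ℚ)).ne_zero)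
          (abs_pos.2 (u.isUnit.map (Algebra.norm ℚ)).ne_zero)
      nlinarith
    exact_mod_cast h1
  obtain ⟨s, hs⟩ := Nat.dvd_factorial hr0 hrC
  refine ⟨(s : ℚ) • q, fun i => ?_, ?_⟩
  · obtain ⟨c, hc⟩ := hq i
    exact ⟨s * c, by rw [map_smul, Finsupp.smul_apply, hc]; push_cast; rfl⟩
  · rw [hs, Nat.cast_mul, mul_comm, mul_smul, sub_eq_zero.1 hzero, smul_mul_assoc]

end Lattice

/-! ### Integral adeles -/

section IntegralAdeles

variable {F : Type*} [Field F] [NumberField F]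

/-- The ring of integral finite adeles. -/
def intAdeles (F : Type*) [Field F] [NumberField F] : Subring (FiniteAdeleRing (𝓞 F) F) where
  carrier := {a | ∀ v, a v ∈ v.adicCompletionIntegers F}
  one_mem' v := one_mem (v.adicCompletionIntegers F)
  zero_mem' v := zero_mem (v.adicCompletionIntegers F)
  add_mem' ha hb v := add_mem (ha v) (hb v)
  mul_mem' ha hb v := mul_mem (ha v) (hb v)
  neg_mem' ha v := neg_mem (ha v)

theorem algebraMap_mem_intAdeles_iff {x : F} :
    algebraMap F (FiniteAdeleRing (𝓞 F) F) x ∈ intAdeles F ↔ IsIntegral ℤ x := by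
  constructor
  · intro h
    obtain ⟨a, rfl⟩ := HeightOneSpectrum.mem_integers_of_valuation_le_one F x fun v => by
      rw [← valued_algebraMap]
      exact h v
    exact a.isIntegral_coe
  · intro h v
    change Valued.v (algebraMap F (v.adicCompletion F) x) ≤ 1
    rw [valued_algebraMap]
    exact v.valuation_le_one (⟨x, h⟩ : 𝓞 F)

theorem valued_natCast_le_one (v : HeightOneSpectrum (𝓞 F)) (n : ℕ) :
    Valued.v (n : v.adicCompletion F) ≤ 1 :=
  natCast_mem (v.adicCompletionIntegers F) n

/-- There are positive integers which are arbitrarily small at a given finite place. -/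
theorem exists_natCast_valued_le (v : HeightOneSpectrum (𝓞 F)) {g : v.adicCompletion F}
    (hg : g ≠ 0) : ∃ n : ℕ, 0 < n ∧ Valued.v (n : v.adicCompletion F) ≤ Valued.v g := by
  obtain ⟨b, hb, h⟩ :=
    HeightOneSpectrum.adicCompletion.mul_nonZeroDivisor_mem_adicCompletionIntegers v g⁻¹
  have hb0 : b ≠ 0 := nonZeroDivisors.ne_zero hb
  refine ⟨Ideal.absNorm (Ideal.span {b}), Nat.pos_of_ne_zero ?_, ?_⟩
  · rw [Ne, Ideal.absNorm_eq_zero_iff, Ideal.span_singleton_eq_bot]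
    exact hb0
  · obtain ⟨c, hc⟩ := Ideal.mem_span_singleton.1 (Ideal.absNorm_mem (Ideal.span {b}))
    have h1 : ((Ideal.absNorm (Ideal.span {b}) : ℕ) : v.adicCompletion F) =
        algebraMap (𝓞 F) (v.adicCompletion F) b * algebraMap (𝓞 F) (v.adicCompletion F) c := by
      rw [← map_mul, ← hc, map_natCast]
    have h2 : Valued.v (g⁻¹ * algebraMap (𝓞 F) (v.adicCompletion F) b) ≤ 1 := h
    have h3 : Valued.v (algebraMap (𝓞 F) (v.adicCompletion F) c) ≤ 1 :=
      v.coe_mem_adicCompletionIntegers c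
    rw [map_mul, map_inv₀, inv_mul_eq_div,
      div_le_one₀ (zero_lt_iff.2 ((Valuation.ne_zero_iff _).2 hg))] at h2
    rw [h1, map_mul]
    exact (mul_le_of_le_one_right' h3).trans h2

theorem exists_natCast_forall_valued_le {S : Set (HeightOneSpectrum (𝓞 F))} (hS : S.Finite)
    (g : ∀ v : HeightOneSpectrum (𝓞 F), v.adicCompletion F) (hg : ∀ v, g v ≠ 0) :
    ∃ n : ℕ, 0 < n ∧ ∀ v ∈ S, Valued.v (n : v.adicCompletion F) ≤ Valued.v (g v) := by
  choose n hn hle using fun v => exists_natCast_valued_le v (hg v)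
  refine ⟨∏ v ∈ hS.toFinset, n v, Finset.prod_pos fun v _ => hn v, fun v hv => ?_⟩
  obtain ⟨c, hc⟩ := Finset.dvd_prod_of_mem n (hS.mem_toFinset.2 hv)
  rw [hc, Nat.cast_mul, map_mul]
  exact (mul_le_of_le_one_right' (valued_natCast_le_one v c)).trans (hle v)

theorem exists_natCast_mul_mem_intAdeles (a : FiniteAdeleRing (𝓞 F) F) :
    ∃ n : ℕ, 0 < n ∧ (n : FiniteAdeleRing (𝓞 F) F) * a ∈ intAdeles F := by
  classical
  have hfin : {v | a v ∉ v.adicCompletionIntegers F}.Finite := a.2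
  obtain ⟨n, hn, h⟩ := exists_natCast_forall_valued_le hfin
    (fun v => if a v = 0 then 1 else (a v)⁻¹) fun v => by
      split_ifs with h
      exacts [one_ne_zero, inv_ne_zero h]
  refine ⟨n, hn, fun v => ?_⟩
  have hev : ((n : FiniteAdeleRing (𝓞 F) F) * a) v = (n : v.adicCompletion F) * a v := by
    rw [adele_mul_apply]
    exact congrArg (· * a v) (map_natCast (evalAt v) n)
  rw [hev]
  by_cases hv : a v ∈ v.adicCompletionIntegers F
  · exact mul_mem (natCast_mem _ n) hv
  · have h0 : a v ≠ 0 := fun h0 => hv (h0 ▸ zero_mem _)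
    have h1 := h v hv
    simp only [h0, if_false] at h1
    change Valued.v (_ * _) ≤ (1 : WithZero (Multiplicative ℤ))
    rw [map_inv₀] at h1
    rw [map_mul]
    rw [← mul_inv_cancel₀ ((Valuation.ne_zero_iff Valued.v).2 h0), mul_comm]
    exact mul_le_mul_right h1 _

theorem exists_sub_mem_at (v : HeightOneSpectrum (𝓞 F)) {a g : v.adicCompletion F}
    (ha : a ∈ v.adicCompletionIntegers F) (hg : g ≠ 0) :
    ∃ x : 𝓞 F, Valued.v (algebraMap (𝓞 F) (v.adicCompletion F) x - a) ≤ Valued.v g := by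
  -- approximate by an element of `F`, and the latter by an integer
  have hopen : {y : v.adicCompletion F | Valued.v (y - a) ≤ Valued.v g} ∈ nhds a := by
    have hc : Continuous fun y : v.adicCompletion F => y - a := continuous_sub_right a
    have h0 : {y : v.adicCompletion F | Valued.v y ≤ Valued.v g} ∈ nhds (a - a) := by
      rw [sub_self]
      exact valued_le_mem_nhds_zero hg
    exact hc.continuousAt.preimage_mem_nhds h0
  have ha1 : (v.adicCompletionIntegers F : Set (v.adicCompletion F)) ∈ nhds a :=
    (Valued.isOpen_valuationSubring _).mem_nhds ha
  obtain ⟨_, ⟨hy, hy1⟩, y, rfl⟩ := mem_closure_iff_nhds.1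
    (HeightOneSpectrum.denseRange_algebraMap F v a) _ (Filter.inter_mem hopen ha1)
  have hy1' : v.valuation F y ≤ 1 := by
    rw [← valued_algebraMap]
    exact hy1
  obtain ⟨x, hx⟩ := v.exists_valuation_sub_lt_of_integer hy1'
    (Units.mk0 (Valued.v g) ((Valuation.ne_zero_iff _).2 hg))
  refine ⟨x, ?_⟩
  have h1 : algebraMap (𝓞 F) (v.adicCompletion F) x - a =
      algebraMap F (v.adicCompletion F) (algebraMap (𝓞 F) F x - y) +
        (algebraMap F (v.adicCompletion F) y - a) := by
    rw [map_sub, ← IsScalarTower.algebraMap_apply]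
    ring
  rw [h1]
  refine Valuation.map_add_le _ ?_ hy
  rw [valued_algebraMap]
  exact hx.le

/-- Strong approximation for integral adeles. -/
theorem exists_eq_algebraMap_add {a : FiniteAdeleRing (𝓞 F) F} (ha : a ∈ intAdeles F) {n : ℕ}
    (hn : 0 < n) : ∃ x : 𝓞 F, ∃ z ∈ intAdeles F,
      a = algebraMap F (FiniteAdeleRing (𝓞 F) F) x + (n : FiniteAdeleRing (𝓞 F) F) * z := by
  have hn0 : (n : F) ≠ 0 := by exact_mod_cast hn.ne'
  have hn0' : ∀ v : HeightOneSpectrum (𝓞 F), (n : v.adicCompletion F) ≠ 0 := fun v => by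
    rw [← map_natCast (algebraMap F (v.adicCompletion F))]
    exact (map_ne_zero _).2 hn0
  have hnO : (n : 𝓞 F) ≠ 0 := by exact_mod_cast hn.ne'
  choose x hx using fun v => exists_sub_mem_at v (ha v) (hn0' v)
  -- the Chinese remainder theorem at the prime divisors of `n`
  have hfin : {v : HeightOneSpectrum (𝓞 F) | v.asIdeal ∣ Ideal.span {(n : 𝓞 F)}}.Finite :=
    Ideal.finite_factors (by simpa using hnO)
  let e : HeightOneSpectrum (𝓞 F) → ℕ := fun v =>
    multiplicity v.asIdeal (Ideal.span {(n : 𝓞 F)})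
  have he : ∀ v : HeightOneSpectrum (𝓞 F),
      Valued.v (n : v.adicCompletion F) = WithZero.exp (-(e v : ℤ)) := fun v => by
    rw [← map_natCast (algebraMap F (v.adicCompletion F)), valued_algebraMap,
      ← map_natCast (algebraMap (𝓞 F) F), HeightOneSpectrum.valuation_of_algebraMap,
      HeightOneSpectrum.intValuation_eq_exp_neg_multiplicity _ hnO]
  obtain ⟨y, hy⟩ := IsDedekindDomain.exists_forall_sub_mem_ideal (s := hfin.toFinset)
    (fun v => v.asIdeal) e (fun v _ => v.prime)
    (fun v _ v' _ hne h => hne (HeightOneSpectrum.ext h)) fun v => x v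
  have hmem : ∀ v : HeightOneSpectrum (𝓞 F),
      Valued.v (a v - algebraMap (𝓞 F) (v.adicCompletion F) y) ≤
        Valued.v (n : v.adicCompletion F) := by
    intro v
    by_cases hv : v.asIdeal ∣ Ideal.span {(n : 𝓞 F)}
    · have h1 : a v - algebraMap (𝓞 F) (v.adicCompletion F) y =
          -(algebraMap (𝓞 F) (v.adicCompletion F) (x v) - a v) -
            algebraMap F (v.adicCompletion F) (algebraMap (𝓞 F) F (y - x v)) := by
        rw [← IsScalarTower.algebraMap_apply, map_sub]
        ring
      rw [h1]
      refine Valuation.map_sub_le (v := Valued.v) ?_ ?_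
      · rw [Valuation.map_neg]
        exact hx v
      · rw [valued_algebraMap, HeightOneSpectrum.valuation_of_algebraMap, he,
          HeightOneSpectrum.intValuation_le_pow_iff_mem]
        exact hy v (hfin.mem_toFinset.2 hv)
    · have h1 : Valued.v (n : v.adicCompletion F) = 1 := by
        rw [← map_natCast (algebraMap F (v.adicCompletion F)), valued_algebraMap,
          ← map_natCast (algebraMap (𝓞 F) F), HeightOneSpectrum.valuation_of_algebraMap]
        refine le_antisymm (v.intValuation_le_one _) (not_lt.1 fun hlt => hv ?_)
        exact (v.intValuation_lt_one_iff_dvd _).1 hlt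
      rw [h1]
      exact sub_mem (ha v) (v.coe_mem_adicCompletionIntegers y)
  refine ⟨y, algebraMap F _ (n : F)⁻¹ * (a - algebraMap F _ (y : F)), fun v => ?_, ?_⟩
  · have hev : (algebraMap F (FiniteAdeleRing (𝓞 F) F) (n : F)⁻¹ *
        (a - algebraMap F (FiniteAdeleRing (𝓞 F) F) (y : F))) v =
        (n : v.adicCompletion F)⁻¹ * (a v - algebraMap (𝓞 F) (v.adicCompletion F) y) := by
      change evalAt v (algebraMap F (FiniteAdeleRing (𝓞 F) F) (n : F)⁻¹ *
        (a - algebraMap F (FiniteAdeleRing (𝓞 F) F) (y : F))) = _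
      rw [map_mul, map_sub, AlgHom.commutes, AlgHom.commutes, map_inv₀, map_natCast]
      rfl
    rw [hev]
    change Valued.v (_ * _) ≤ (1 : WithZero (Multiplicative ℤ))
    rw [map_mul, map_inv₀, inv_mul_eq_div,
      div_le_one₀ (zero_lt_iff.2 ((Valuation.ne_zero_iff _).2 (hn0' v)))]
    exact hmem v
  · rw [← map_natCast (algebraMap F (FiniteAdeleRing (𝓞 F) F)) n, ← mul_assoc, ← map_mul,
      mul_inv_cancel₀ hn0, map_one, one_mul, add_sub_cancel]

theorem exists_natCast_mul_mem_of_mem_nhds {W : Set (FiniteAdeleRing (𝓞 F) F)}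
    (hW : W ∈ nhds 0) :
    ∃ n : ℕ, 0 < n ∧ ∀ a ∈ intAdeles F, (n : FiniteAdeleRing (𝓞 F) F) * a ∈ W := by
  let s : (∀ v : HeightOneSpectrum (𝓞 F), v.adicCompletionIntegers F) → FiniteAdeleRing (𝓞 F) F :=
    RestrictedProduct.structureMap _ _ _
  have hs : Continuous s := RestrictedProduct.isEmbedding_structureMap.continuous
  have hW' : s ⁻¹' W ∈ nhds 0 := hs.continuousAt.preimage_mem_nhds hW
  rw [nhds_pi, Filter.mem_pi] at hW'
  obtain ⟨I, hI, t, ht, hsub⟩ := hW'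
  have ht' : ∀ v, ∃ g : v.adicCompletion F, g ≠ 0 ∧ ∀ x : v.adicCompletionIntegers F,
      Valued.v (x : v.adicCompletion F) ≤ Valued.v g → x ∈ t v := by
    intro v
    obtain ⟨u, hu, hut⟩ := mem_nhds_subtype _ _ _ |>.1 (ht v)
    obtain ⟨g, hg0, hg⟩ := exists_valued_le_subset_of_mem_nhds_zero hu
    exact ⟨g, hg0, fun x hx => hut (hg x hx)⟩
  choose g hg0 hg using ht'
  obtain ⟨n, hn, hle⟩ := exists_natCast_forall_valued_le hI g hg0
  refine ⟨n, hn, fun a ha => ?_⟩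
  have hmem : (n : FiniteAdeleRing (𝓞 F) F) * a ∈ intAdeles F := mul_mem (natCast_mem _ n) ha
  have : s (fun v => ⟨_, hmem v⟩) ∈ W := by
    refine hsub fun v hv => hg v _ ?_
    have hev : ((n : FiniteAdeleRing (𝓞 F) F) * a) v = (n : v.adicCompletion F) * a v := by
      rw [adele_mul_apply]
      exact congrArg (· * a v) (map_natCast (evalAt v) n)
    change Valued.v (((n : FiniteAdeleRing (𝓞 F) F) * a) v) ≤ _
    rw [hev, map_mul]
    exact (mul_le_of_le_one_right' (ha v)).trans (hle v hv)
  exact this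

end IntegralAdeles

/-! ### Adelic lattices -/

section AdelicLattice

variable {F : Type*} [Field F] [NumberField F] {D : Type*} [Ring D] [Algebra F D]

/-- A totally definite quaternion algebra is a division algebra, since it embeds into the
quaternions. -/
theorem IsTotallyDefinite.isUnit [NumberField.IsTotallyReal F] (hD : IsTotallyDefinite F D)
    {x : D} (hx : x ≠ 0) : IsUnit x := by
  have := hD.simple
  have : Module.Finite F D := Module.finite_of_finrank_pos (by rw [hD.finrank_eq]; norm_num)
  obtain ⟨φ⟩ : Nonempty (F →+* ℂ) := inferInstance
  have hφ := NumberField.IsTotallyReal.complexEmbedding_isReal φ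
  let _ := hφ.embedding.toAlgebra
  obtain ⟨e⟩ := hD.ramified hφ.embedding
  have hinj : Function.Injective (fun x : D => e (1 ⊗ₜ x)) :=
    e.injective.comp (Algebra.TensorProduct.includeRight_injective (algebraMap F ℝ).injective)
  have hdom : NoZeroDivisors D := by
    refine ⟨fun {a b} hab => ?_⟩
    have h1 : e (1 ⊗ₜ a) * e (1 ⊗ₜ b) = 0 := by
      rw [← map_mul, Algebra.TensorProduct.tmul_mul_tmul, hab, TensorProduct.tmul_zero, map_zero]
    rcases mul_eq_zero.1 h1 with h | h
    · exact Or.inl (hinj (by simpa using h))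
    · exact Or.inr (hinj (by simpa using h))
  have : IsDomain D := NoZeroDivisors.to_isDomain D
  let _ := divisionRingOfFiniteDimensional F D
  exact isUnit_iff_ne_zero.2 hx

/-- Every finite-dimensional algebra over a number field has a basis with integral structure
constants. -/
theorem exists_basis_isIntegral [Module.Finite F D] :
    ∃ b : Module.Basis (Fin (Module.finrank F D)) F D,
      ∀ i j k, IsIntegral ℤ (b.repr (b i * b j) k) := by
  let b := Module.finBasis F D
  choose n hn h using fun t : Fin (Module.finrank F D) × Fin (Module.finrank F D) ×
    Fin (Module.finrank F D) => exists_natCast_mul_mem_intAdeles (F := F)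
      (algebraMap F (FiniteAdeleRing (𝓞 F) F) (b.repr (b t.1 * b t.2.1) t.2.2))
  let N : ℕ := ∏ t, n t
  have hN : (N : F) ≠ 0 := by
    have : 0 < N := Finset.prod_pos fun t _ => hn t
    exact_mod_cast this.ne'
  refine ⟨b.unitsSMul fun _ => Units.mk0 (N : F) hN, fun i j k => ?_⟩
  have h1 : (b.unitsSMul fun _ => Units.mk0 (N : F) hN).repr
      ((b.unitsSMul fun _ => Units.mk0 (N : F) hN) i *
        (b.unitsSMul fun _ => Units.mk0 (N : F) hN) j) k = N * b.repr (b i * b j) k := by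
    rw [Module.Basis.repr_unitsSMul, Module.Basis.unitsSMul_apply, Module.Basis.unitsSMul_apply,
      Units.smul_def, Units.smul_def, Units.smul_def, Units.val_inv_eq_inv_val, Units.val_mk0,
      smul_mul_smul_comm, map_smul, Finsupp.smul_apply, smul_eq_mul, smul_eq_mul]
    field_simp
  rw [h1]
  obtain ⟨c, hc⟩ := Finset.dvd_prod_of_mem n (Finset.mem_univ (i, j, k))
  have h2 := h (i, j, k)
  rw [← map_natCast (algebraMap F (FiniteAdeleRing (𝓞 F) F)), ← map_mul,
    algebraMap_mem_intAdeles_iff] at h2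
  have h3 : (N : F) * b.repr (b i * b j) k = c * (n (i, j, k) * b.repr (b i * b j) k) := by
    change ((∏ t, n t : ℕ) : F) * _ = _
    rw [hc]
    push_cast
    ring
  rw [h3]
  have h4 : IsIntegral ℤ (c : F) := by
    simpa using isIntegral_algebraMap (R := ℤ) (A := F) (x := (c : ℤ))
  exact h4.mul h2

variable {ι : Type*} (b : Module.Basis ι F D)

/-- The elements of `D ⊗_F A_{F,f}` with integral coordinates. -/
def adelicLattice : AddSubgroup (AdelicAlg F D) where
  carrier := {x | ∀ i,
    (Algebra.TensorProduct.basis (FiniteAdeleRing (𝓞 F) F) b).repr x i ∈ intAdeles F}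
  zero_mem' i := by
    rw [map_zero]
    exact zero_mem _
  add_mem' {x y} hx hy i := by
    rw [map_add]
    exact add_mem (hx i) (hy i)
  neg_mem' {x} hx i := by
    rw [map_neg]
    exact neg_mem (hx i)

theorem mem_adelicLattice {x : AdelicAlg F D} : x ∈ adelicLattice b ↔ ∀ i,
    (Algebra.TensorProduct.basis (FiniteAdeleRing (𝓞 F) F) b).repr x i ∈ intAdeles F := Iff.rfl

theorem tmul_mem_adelicLattice_iff {δ : D} :
    (1 ⊗ₜ δ : AdelicAlg F D) ∈ adelicLattice b ↔ ∀ i, IsIntegral ℤ (b.repr δ i) := by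
  rw [mem_adelicLattice]
  refine forall_congr' fun i => ?_
  rw [Algebra.TensorProduct.basis_repr_tmul, one_smul, Finsupp.mapRange_apply]
  exact algebraMap_mem_intAdeles_iff

theorem mul_mem_adelicLattice [Fintype ι] (hb : ∀ i j k, IsIntegral ℤ (b.repr (b i * b j) k))
    {x y : AdelicAlg F D} (hx : x ∈ adelicLattice b) (hy : y ∈ adelicLattice b) :
    x * y ∈ adelicLattice b := by
  let B := Algebra.TensorProduct.basis (FiniteAdeleRing (𝓞 F) F) b
  have h1 : x * y = ∑ i, ∑ j, (B.repr x i * B.repr y j) • (1 ⊗ₜ (b i * b j) : AdelicAlg F D) := by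
    conv_lhs => rw [← B.sum_repr x, ← B.sum_repr y]
    rw [Finset.sum_mul_sum]
    refine Finset.sum_congr rfl fun i _ => Finset.sum_congr rfl fun j _ => ?_
    rw [smul_mul_smul_comm, Algebra.TensorProduct.basis_apply, Algebra.TensorProduct.basis_apply,
      Algebra.TensorProduct.tmul_mul_tmul, one_mul]
  rw [h1]
  refine sum_mem fun i _ => sum_mem fun j _ k => ?_
  rw [map_smul, Finsupp.smul_apply, smul_eq_mul]
  exact mul_mem (mul_mem (hx i) (hy j)) ((tmul_mem_adelicLattice_iff b).2 (hb i j) k)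

theorem exists_nsmul_mem_adelicLattice [Fintype ι] (x : AdelicAlg F D) :
    ∃ n : ℕ, 0 < n ∧ n • x ∈ adelicLattice b := by
  let B := Algebra.TensorProduct.basis (FiniteAdeleRing (𝓞 F) F) b
  choose n hn h using fun i => exists_natCast_mul_mem_intAdeles (B.repr x i)
  refine ⟨∏ i, n i, Finset.prod_pos fun i _ => hn i, fun i => ?_⟩
  obtain ⟨c, hc⟩ := Finset.dvd_prod_of_mem n (Finset.mem_univ i)
  rw [map_nsmul, Finsupp.smul_apply, hc, mul_comm, mul_smul, nsmul_eq_mul (n i)]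
  exact nsmul_mem (h i) c

/-- Strong approximation in coordinates. -/
theorem exists_repr_eq_add [Fintype ι] {x : AdelicAlg F D} (hx : x ∈ adelicLattice b) {n : ℕ}
    (hn : 0 < n) : ∃ c : ι → 𝓞 F, ∃ z ∈ adelicLattice b,
      x = 1 ⊗ₜ (∑ i, (c i : F) • b i) + n • z := by
  let B := Algebra.TensorProduct.basis (FiniteAdeleRing (𝓞 F) F) b
  choose c z hz h using fun i => exists_eq_algebraMap_add (hx i) hn
  refine ⟨c, ∑ i, z i • B i, fun i => ?_, ?_⟩
  · change B.repr _ i ∈ _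
    rw [B.repr_sum_self]
    exact hz i
  · conv_lhs => rw [← B.sum_repr x]
    rw [TensorProduct.tmul_sum, Finset.smul_sum, ← Finset.sum_add_distrib]
    refine Finset.sum_congr rfl fun i _ => ?_
    change (B.repr x i) • B i = _
    have hB : B i = 1 ⊗ₜ b i := Algebra.TensorProduct.basis_apply b i
    rw [h i, add_smul, mul_smul, TensorProduct.tmul_smul, algebraMap_smul,
      Nat.cast_smul_eq_nsmul, hB]

theorem exists_eq_tmul_add [Fintype ι] (x : AdelicAlg F D) {n : ℕ} (hn : 0 < n) :
    ∃ δ : D, ∃ z ∈ adelicLattice b, x = 1 ⊗ₜ δ + n • z := by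
  obtain ⟨m, hm, hmx⟩ := exists_nsmul_mem_adelicLattice b x
  obtain ⟨c, z, hz, h⟩ := exists_repr_eq_add b hmx (mul_pos hm hn)
  have hm0 : (m : F) ≠ 0 := by exact_mod_cast hm.ne'
  refine ⟨(m : F)⁻¹ • ∑ i, (c i : F) • b i, z, hz, ?_⟩
  have h1 := congrArg (fun y => (m : F)⁻¹ • y) h
  simp only [smul_add, mul_smul] at h1
  rw [← Nat.cast_smul_eq_nsmul F m x, ← Nat.cast_smul_eq_nsmul F m, inv_smul_smul₀ hm0,
    inv_smul_smul₀ hm0] at h1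
  rw [h1, TensorProduct.tmul_smul]

/-- The principal congruence subgroups form a basis of neighbourhoods of `1` in `G_f`. -/
theorem exists_congruence_subset [Fintype ι] {U : Subgroup (Gf F D)} (hU : IsOpenCompact F D U) :
    ∃ n : ℕ, 0 < n ∧ ∀ x : Gf F D, (∃ z ∈ adelicLattice b, x.1 = 1 + n • z) →
      (∃ z ∈ adelicLattice b, (x⁻¹ : Gf F D).1 = 1 + n • z) → x ∈ U := by
  let _ : TopologicalSpace (AdelicAlg F D) := moduleTopology (FiniteAdeleRing (𝓞 F) F) _
  have : IsModuleTopology (FiniteAdeleRing (𝓞 F) F) (AdelicAlg F D) := ⟨rfl⟩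
  have := IsModuleTopology.toContinuousAdd (FiniteAdeleRing (𝓞 F) F) (AdelicAlg F D)
  let B := Algebra.TensorProduct.basis (FiniteAdeleRing (𝓞 F) F) b
  -- neighbourhoods of `1` in `D ⊗ A_{F,f}`
  have key : ∀ W ∈ nhds (1 : AdelicAlg F D), ∃ n : ℕ, 0 < n ∧ ∀ m : ℕ, n ∣ m →
      ∀ z ∈ adelicLattice b, 1 + m • z ∈ W := by
    intro W hW
    let f : (ι → FiniteAdeleRing (𝓞 F) F) → AdelicAlg F D := fun a => 1 + B.equivFun.symm a
    have hf : Continuous f := continuous_const.add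
      (IsModuleTopology.continuous_of_linearMap B.equivFun.symm.toLinearMap)
    have hf0 : f ⁻¹' W ∈ nhds 0 := hf.continuousAt.preimage_mem_nhds (by simpa [f] using hW)
    rw [nhds_pi, Filter.mem_pi] at hf0
    obtain ⟨I, -, t, ht, hsub⟩ := hf0
    choose n hn hmem using fun i => exists_natCast_mul_mem_of_mem_nhds (ht i)
    refine ⟨∏ i, n i, Finset.prod_pos fun i _ => hn i, fun m hm z hz => ?_⟩
    have h1 : f (fun i => m • B.repr z i) ∈ W := by
      refine hsub fun i _ => ?_
      obtain ⟨c, hc⟩ := (Finset.dvd_prod_of_mem n (Finset.mem_univ i)).trans hm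
      change m • B.repr z i ∈ t i
      rw [hc, mul_smul, nsmul_eq_mul]
      exact hmem i _ (nsmul_mem (hz i) c)
    have h2 : f (fun i => m • B.repr z i) = 1 + m • z := by
      change 1 + B.equivFun.symm (m • B.equivFun z) = _
      rw [map_nsmul, LinearEquiv.symm_apply_apply]
    rwa [h2] at h1
  have h1 : (U : Set (Gf F D)) ∈ nhds 1 := hU.1.mem_nhds (one_mem U)
  rw [Units.isInducing_embedProduct.nhds_eq_comap, Filter.mem_comap, map_one] at h1
  obtain ⟨W, hW, hWU⟩ := h1
  obtain ⟨W₁, h₁, W₂, h₂, hsub⟩ := mem_nhds_prod_iff.1 hW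
  obtain ⟨n₁, hn₁, hm₁⟩ := key W₁ h₁
  obtain ⟨n₂, hn₂, hm₂⟩ := key (MulOpposite.op ⁻¹' W₂)
    (MulOpposite.continuous_op.continuousAt.preimage_mem_nhds h₂)
  refine ⟨n₁ * n₂, mul_pos hn₁ hn₂, ?_⟩
  rintro x ⟨z, hz, hx⟩ ⟨z', hz', hx'⟩
  refine hWU (hsub ⟨?_, ?_⟩)
  · change x.1 ∈ W₁
    rw [hx]
    exact hm₁ _ (dvd_mul_right _ _) z hz
  · change (x⁻¹ : Gf F D).1 ∈ MulOpposite.op ⁻¹' W₂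
    rw [hx']
    exact hm₂ _ (dvd_mul_left _ _) z' hz'

end AdelicLattice

/-! ### Finiteness of the class set -/

section ClassFinite

variable {F : Type*} [Field F] [NumberField F] {D : Type*} [Ring D] [Algebra F D]

theorem isIntegral_iff_repr_integralBasis {x : F} : IsIntegral ℤ x ↔
    ∀ j, ∃ c : ℤ, (NumberField.integralBasis F).repr x j = c := by
  have h1 : IsIntegral ℤ x ↔ x ∈ (algebraMap (𝓞 F) F).range :=
    ⟨fun h => ⟨⟨x, h⟩, rfl⟩, fun ⟨a, ha⟩ => ha ▸ a.isIntegral_coe⟩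
  rw [h1, ← SetLike.mem_coe, RingHom.coe_range]
  have h2 := NumberField.mem_span_integralBasis F (x := x)
  rw [Module.Basis.mem_span_iff_repr_mem ℤ] at h2
  refine (h2.symm).trans (forall_congr' fun j => ?_)
  exact ⟨fun ⟨c, hc⟩ => ⟨c, by simpa using hc.symm⟩, fun ⟨c, hc⟩ => ⟨c, by simpa using hc.symm⟩⟩

/-- The existence of elements of lattices in `D` generating a submodule of bounded index, in terms
of integral coordinates with respect to a basis over `F`. -/
theorem exists_smul_mem_principal_of_isIntegral {ι : Type*} [Fintype ι] [Nontrivial D]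
    (b : Module.Basis ι F D) (hunit : ∀ x : D, x ≠ 0 → IsUnit x)
    (hb : ∀ i j k, IsIntegral ℤ (b.repr (b i * b j) k)) :
    ∃ C : ℕ, 0 < C ∧ ∀ M : AddSubgroup D,
      (∀ q : D, (∀ i, IsIntegral ℤ (b.repr q i)) → ∀ y ∈ M, q * y ∈ M) →
      (∃ y ∈ M, y ≠ 0) → (∃ t : D, t ≠ 0 ∧ ∀ y ∈ M, ∀ i, IsIntegral ℤ (b.repr (t * y) i)) →
      ∃ x ∈ M, x ≠ 0 ∧ ∀ y ∈ M, ∃ q : D, (∀ i, IsIntegral ℤ (b.repr q i)) ∧ C • y = q * x := by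
  let _ : Algebra ℚ D := Algebra.compHom D (algebraMap ℚ F)
  have : IsScalarTower ℚ F D := IsScalarTower.of_algebraMap_eq fun _ => rfl
  let e := (NumberField.integralBasis F).smulTower b
  have hint : ∀ x : D, (∀ i, ∃ c : ℤ, e.repr x i = c) ↔ ∀ i, IsIntegral ℤ (b.repr x i) := by
    intro x
    simp only [isIntegral_iff_repr_integralBasis]
    refine ⟨fun h i j => ?_, fun h ij => ?_⟩
    · obtain ⟨c, hc⟩ := h (j, i)
      exact ⟨c, by rw [← hc, Module.Basis.smulTower_repr]⟩
    · obtain ⟨c, hc⟩ := h ij.2 ij.1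
      exact ⟨c, by rw [← hc, Module.Basis.smulTower_repr]⟩
  have he : ∀ i j k, ∃ c : ℤ, e.repr (e i * e j) k = c := by
    intro i j
    rw [hint]
    intro k
    rw [Module.Basis.smulTower_apply, Module.Basis.smulTower_apply, smul_mul_smul_comm, map_smul,
      Finsupp.smul_apply, smul_eq_mul]
    have hω : ∀ j, IsIntegral ℤ (NumberField.integralBasis F j) := fun j => by
      rw [NumberField.integralBasis_apply]
      exact (NumberField.RingOfIntegers.basis F j).isIntegral_coe
    exact ((hω _).mul (hω _)).mul (hb _ _ _)
  obtain ⟨C, hC, h⟩ := exists_smul_mem_principal e hunit he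
  refine ⟨C, hC, fun M h1 h2 h3 => ?_⟩
  simp only [hint] at h
  obtain ⟨x, hx, hx0, hxM⟩ := h M h1 h2 h3
  refine ⟨x, hx, hx0, fun y hy => ?_⟩
  obtain ⟨q, hq, hqx⟩ := hxM y hy
  exact ⟨q, hq, by rw [← hqx, Nat.cast_smul_eq_nsmul]⟩

/-- Every class has a representative which, together with its inverse, lies in a fixed
lattice. -/
theorem exists_representative {ι : Type*} [Fintype ι] [Nontrivial D]
    (b : Module.Basis ι F D) (hunit : ∀ x : D, x ≠ 0 → IsUnit x)
    (hb : ∀ i j k, IsIntegral ℤ (b.repr (b i * b j) k)) :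
    ∃ N : ℕ, 0 < N ∧ ∀ g : Gf F D, ∃ δ : Dˣ, (diag F D δ * g).1 ∈ adelicLattice b ∧
      N • ((diag F D δ * g)⁻¹ : Gf F D).1 ∈ adelicLattice b := by
  obtain ⟨C, hC, h⟩ := exists_smul_mem_principal_of_isIntegral b hunit hb
  obtain ⟨N₀, hN₀, h1⟩ := exists_nsmul_mem_adelicLattice b (1 : AdelicAlg F D)
  have : CharZero D := charZero_of_injective_algebraMap (algebraMap F D).injective
  refine ⟨C * N₀, mul_pos hC hN₀, fun g => ?_⟩
  -- the lattice of the elements of `D` which `g` maps into the adelic lattice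
  let M : AddSubgroup D := (adelicLattice b).comap
    (((AddMonoidHom.mulRight g.1).comp
      (Algebra.TensorProduct.includeRight : D →ₐ[F] AdelicAlg F D).toRingHom.toAddMonoidHom))
  have hM : ∀ x : D, x ∈ M ↔ (1 ⊗ₜ x : AdelicAlg F D) * g.1 ∈ adelicLattice b := fun x => Iff.rfl
  have htmul : ∀ x y : D, (1 ⊗ₜ (x * y) : AdelicAlg F D) = (1 ⊗ₜ x) * (1 ⊗ₜ y) := fun x y => by
    rw [Algebra.TensorProduct.tmul_mul_tmul, one_mul]
  have hnat : ∀ n : ℕ, (1 ⊗ₜ (n : D) : AdelicAlg F D) = n := fun n =>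
    map_natCast (Algebra.TensorProduct.includeRight : D →ₐ[F] AdelicAlg F D) n
  obtain ⟨T₁, hT₁, hg⟩ := exists_nsmul_mem_adelicLattice b g.1
  obtain ⟨T₀, hT₀, hg'⟩ := exists_nsmul_mem_adelicLattice b (g⁻¹ : Gf F D).1
  obtain ⟨x, hx, hx0, hxM⟩ := h M
    (fun q hq y hy => by
      rw [hM, htmul, mul_assoc]
      exact mul_mem_adelicLattice b hb ((tmul_mem_adelicLattice_iff b).2 hq) hy)
    ⟨T₁, by
      rw [hM, hnat, ← nsmul_eq_mul]
      exact hg, by exact_mod_cast hT₁.ne'⟩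
    ⟨T₀, by exact_mod_cast hT₀.ne', fun y hy => by
      rw [← tmul_mem_adelicLattice_iff b, htmul, hnat, ← nsmul_eq_mul]
      have := mul_mem_adelicLattice b hb ((hM y).1 hy) hg'
      rwa [mul_smul_comm, mul_assoc, Units.mul_inv, mul_one] at this⟩
  obtain ⟨u, rfl⟩ := hunit x hx0
  refine ⟨u, hx, ?_⟩
  obtain ⟨T₂, hT₂, hu⟩ := exists_nsmul_mem_adelicLattice b (1 ⊗ₜ (u⁻¹ : Dˣ).1 : AdelicAlg F D)
  -- approximate `N₀ g⁻¹` by an element of `D`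
  obtain ⟨l, z, hz, hlz⟩ := exists_eq_tmul_add b (N₀ • (g⁻¹ : Gf F D).1) (mul_pos hT₁ hT₂)
  have hlM : l ∈ M := by
    have e1 : (1 ⊗ₜ l : AdelicAlg F D) * g.1 = N₀ • 1 - T₂ • (z * (T₁ • g.1)) := by
      rw [eq_sub_of_add_eq hlz.symm, sub_mul, smul_mul_assoc, Units.inv_mul, smul_mul_assoc,
        mul_smul_comm, smul_smul, mul_comm T₂]
    rw [hM, e1]
    exact sub_mem h1 (nsmul_mem (mul_mem_adelicLattice b hb hz hg) _)
  obtain ⟨q, hq, hql⟩ := hxM l hlM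
  have hql' : C • (1 ⊗ₜ l : AdelicAlg F D) * (1 ⊗ₜ (u⁻¹ : Dˣ).1) = 1 ⊗ₜ q := by
    rw [← TensorProduct.tmul_smul, hql, ← htmul, mul_assoc, Units.mul_inv, mul_one]
  have e2 : (C * N₀) • ((diag F D u * g)⁻¹ : Gf F D).1 =
      1 ⊗ₜ q + (C * T₁) • (z * (T₂ • (1 ⊗ₜ (u⁻¹ : Dˣ).1))) := by
    rw [mul_inv_rev, ← map_inv, Units.val_mul, mul_smul, ← smul_mul_assoc N₀, hlz, ← hql']
    change C • (_ * (1 ⊗ₜ (u⁻¹ : Dˣ).1)) = _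
    rw [add_mul, smul_add, smul_mul_assoc, smul_mul_assoc, mul_smul_comm, smul_smul, smul_smul,
      mul_assoc]
  rw [e2]
  exact add_mem ((tmul_mem_adelicLattice_iff b).2 hq)
    (nsmul_mem (mul_mem_adelicLattice b hb hz hu) _)

theorem finite_classSet [NumberField.IsTotallyReal F] (hD : IsTotallyDefinite F D)
    {U : Subgroup (Gf F D)} (hU : IsOpenCompact F D U) : Finite (ClassSet U) := by
  have := hD.simple
  have : Module.Finite F D := Module.finite_of_finrank_pos (by rw [hD.finrank_eq]; norm_num)
  obtain ⟨b, hb⟩ := exists_basis_isIntegral (F := F) (D := D)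
  obtain ⟨N, hN, hrep⟩ := exists_representative b (fun x hx => hD.isUnit hx) hb
  obtain ⟨n, hn, hcong⟩ := exists_congruence_subset b hU
  choose δ hδ hδ' using fun c : ClassSet U => hrep (clsOut c)
  choose r z hz h using fun c : ClassSet U => exists_repr_eq_add b (hδ c) (mul_pos hN hn)
  -- representatives which are congruent modulo `N n` define the same class
  let f : ClassSet U → Fin (Module.finrank F D) → 𝓞 F ⧸ Ideal.span {((N * n : ℕ) : 𝓞 F)} :=
    fun c i => Ideal.Quotient.mk _ (r c i)
  have hfin : Finite (𝓞 F ⧸ Ideal.span {((N * n : ℕ) : 𝓞 F)}) := by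
    refine Ideal.finiteQuotientOfFreeOfNeBot _ ?_
    rw [Ne, Ideal.span_singleton_eq_bot]
    exact_mod_cast (mul_pos hN hn).ne'
  refine Finite.of_injective f fun c c' hcc => ?_
  have hsub : ∀ c c' : ClassSet U, f c = f c' → ∃ y ∈ adelicLattice b,
      (diag F D (δ c') * clsOut c').1 = (diag F D (δ c) * clsOut c).1 + (N * n) • y := by
    intro c c' hcc
    have h1 : ∀ i, ∃ s : 𝓞 F, r c' i = r c i + (N * n : ℕ) * s := fun i => by
      obtain ⟨s, hs⟩ := Ideal.mem_span_singleton.1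
        (Ideal.Quotient.eq.1 (congrFun hcc i).symm)
      exact ⟨s, by rw [← hs]; ring⟩
    choose s hs using h1
    refine ⟨1 ⊗ₜ (∑ i, (s i : F) • b i) + z c' - z c, sub_mem (add_mem ?_ (hz c')) (hz c), ?_⟩
    · rw [tmul_mem_adelicLattice_iff]
      intro i
      rw [b.repr_sum_self]
      exact (s i).isIntegral_coe
    · have h2 : ∑ i, (r c' i : F) • b i =
          ∑ i, (r c i : F) • b i + (N * n) • ∑ i, (s i : F) • b i := by
        rw [Finset.smul_sum, ← Finset.sum_add_distrib]
        refine Finset.sum_congr rfl fun i _ => ?_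
        have e1 : ((r c i + ((N * n : ℕ) : 𝓞 F) * s i : 𝓞 F) : F) =
            r c i + ((N * n : ℕ) : F) * s i := by simp
        rw [hs i, e1, add_smul, mul_smul, Nat.cast_smul_eq_nsmul]
      rw [h c, h c', h2, TensorProduct.tmul_add, TensorProduct.tmul_smul]
      module
  have hquot : ∀ c c' : ClassSet U, f c = f c' → ∃ y ∈ adelicLattice b,
      ((diag F D (δ c) * clsOut c)⁻¹ * (diag F D (δ c') * clsOut c') : Gf F D).1 = 1 + n • y := by
    intro c c' hcc
    obtain ⟨y, hy, hyc⟩ := hsub c c' hcc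
    refine ⟨_, mul_mem_adelicLattice b hb (hδ' c) hy, ?_⟩
    rw [Units.val_mul, hyc, mul_add, Units.inv_mul, mul_smul_comm, smul_mul_assoc, smul_smul,
      mul_comm n]
  have hmem : (diag F D (δ c) * clsOut c)⁻¹ * (diag F D (δ c') * clsOut c') ∈ U := by
    refine hcong _ (hquot c c' hcc) ?_
    rw [mul_inv_rev, inv_inv]
    exact hquot c' c hcc.symm
  have hcls : ∀ c, cls U (diag F D (δ c) * clsOut c) = c := fun c => by
    conv_rhs => rw [← cls_clsOut c]
    exact cls_eq_of_eq_mul (δ c) (one_mem U) (mul_one _).symm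
  rw [← hcls c, ← hcls c']
  refine (cls_eq_of_eq_mul 1 hmem ?_).symm
  rw [map_one, one_mul, mul_inv_cancel_left]

end ClassFinite

end QuatForms

end

theorem mainTheorem1 (d h : ℕ) :
    ∃ β₁ β₂ : ℝ, 0 < β₁ ∧
      ∀ (p : ℕ) [Fact p.Prime]
        (F : Type*) [Field F] [NumberField F] [NumberField.IsTotallyReal F]
        (D : Type*) [Ring D] [Algebra F D]
        (w : HeightOneSpectrum (𝓞 F))
        (θ : w.adicCompletion F ⊗[F] D ≃ₐ[w.adicCompletion F]
          Matrix (Fin 2) (Fin 2) (w.adicCompletion F))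
        (𝓤 : QuatForms.Level θ p)
        (R : Type*) [CommRing R] [Algebra R (PadicAlgCl p)]
        (σ : QuatForms.Emb p w → w.adicCompletionIntegers F →+* R),
        Module.finrank ℚ F = d → Even d →
        QuatForms.IsTotallyDefinite F D →
        -- `p` is inert in `F`, and `w` is the place `p`
        w.asIdeal = Ideal.span {(p : 𝓞 F)} →
        -- `R` is a subring of `ℚ̄_p` containing the images of `O_{F,p}` under all `τ`
        Function.Injective (algebraMap R (PadicAlgCl p)) →
        (∀ τ x, algebraMap R (PadicAlgCl p) (σ τ x) = τ.1 x) →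
        Nat.card (QuatForms.ClassSet 𝓤.U) = h →
        (∀ γ : QuatForms.Gf F D, Subsingleton (QuatForms.Gamma 𝓤.U γ)) →
        ∀ (α : ℝ) (n : ℕ), n = ⌊(β₁ * α - β₂) ^ (d + 1)⌋₊ →
        ∀ k v k' v' : QuatForms.Emb p w → ℕ,
          QuatForms.IsWeight k v → QuatForms.IsWeight k' v' →
          (∀ τ, n ≤ k τ) → (∀ τ, n ≤ k' τ) → (∀ τ, k τ ≡ k' τ [MOD p ^ n]) →
          QuatForms.slopeDim 𝓤 σ k v α = QuatForms.slopeDim 𝓤 σ k' v' α := by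
  refine ⟨2 * (h + 3), -(h + 3), by positivity, ?_⟩
  intro p _ F _ _ _ D _ _ w θ 𝓤 R _ _ σ hd _ hD hw hR hσ hh hΓ α n hn k v k' v' hk hk' hnk hnk' hkk
  have := QuatForms.finite_classSet hD 𝓤.isOpenCompact
  obtain ⟨ψ, hψD, hψU, hψη⟩ := QuatForms.exists_character hD hw 𝓤
  exact QuatForms.slopeDim_eq_of_character 𝓤 hR σ hσ ψ hψD hψU hψη hΓ
    ((QuatForms.card_emb hw).trans hd).le hh α n hn k v k' v' hk hk' hnk hnk' hkk
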